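/- Conventions. Squares are pairs (row, column), numbered from $0$, with rows going from top to bottom. For a skew shape $\chi=\lambda/\mu$ (partitions $\mu\subseteq\lambda$), $\mathrm{Tab}(\chi)$ is the set of semistandard tableaux of shape $\chi$ with entries in $\mathbb N$ (weakly increasing along rows, strictly increasing down columns), and $\mathrm{Tab}(\chi;n)$ is the subset of those with entries in $\{0,\dots,n-1\}$; for a partition $\nu$, $\mathrm{Tab}(\nu;n)=\mathrm{Tab}(\nu/0;n)$. The weight $\mathrm{wt}\,T$ records for each $i$ the number of entries $i$ of $T$. A valid reading order for $\chi$ is a total order on the squares of $\chi$ in which $(i,j)$ precedes or equals $(i',j')$ whenever $i\le i'$ and $j\ge j'$; the corresponding reading word of $T$ lists its entries in that order. A word is dominant for $i$ if each of its prefixes has at least as many letters $i$ as letters $i+1$, and anti-dominant for $i$ if each of its suffixes has at least as many letters $i+1$ as letters $i$. $\mathrm{LR}(\chi,\nu)$ is the set of Littlewood--Richardson tableaux of shape $\chi$ and weight $\nu$: those $L\in\mathrm{Tab}(\chi)$ of weight $\nu$ whose word, read by rows from top to bottom and from right to left within each row, is dominant for every $i$. Raising operations. For words, $e_i(u\,(i+1)\,v)=u\,i\,v$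 when $u$ is anti-dominant and $v$ is dominant for $i$. For tableaux of shape $\chi$ and a valid reading order, $U=e_i(T)$ means that the reading word of $U$ is obtained by applying $e_i$ to the reading word of $T$. The raising operations are the $e_i$ for all $i\ge0$. Inward jeu de taquin slides. Choose a corner $s$ of $\mu$ and make it the empty square. Repeatedly move into the empty square the smaller of the entries directly to its right and directly below it (the one below in case of equality; the only one if just one is present), until neither exists. If the empty square then is $t$, the result is a tableau of shape $(\lambda\setminus\{t\})/(\mu\setminus\{s\})$. A normal form of $T$ for a rewrite system is an object obtainable from $T$ by finitely many (possibly zero) steps, to which no step applies. Statement. Let $\chi$ be a skew shape and $n\in\mathbb N$. Every $T\in\mathrm{Tab}(\chi;n)$ has a unique normal form $\mathrm{Rob}_0(T)$ for the raising operations, which is the same for every valid reading order, and a unique normal form $\mathrm{Rob}_1(T)$ for inward jeu de taquin slides. There is a partition $\nu$ such that $\mathrm{Rob}_0(T)\in\mathrm{LR}(\chi,\nu)$ and $\mathrm{Rob}_1(T)\in\mathrm{Tab}(\nu;n)$, and $\mathrm{wt}\,\mathrm{Rob}_1(T)=\mathrm{wt}\,T$. The map $T\mapsto(\mathrm{Rob}_0(T),\mathrm{Rob}_1(T))$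 is a bijection $$\mathrm{Tab}(\chi;n)\longrightarrow\bigsqcup_{\nu}\mathrm{LR}(\chi,\nu)\times\mathrm{Tab}(\nu;n),$$ where $\nu$ ranges over all partitions; that is, it is a Robinson bijection. -/

import Mathlib

/-! ### Skew shapes and skew semistandard tableaux

Squares are pairs (row, column), both counted from 0, rows from top to bottom; partitions are
Young diagrams. -/

/-- A skew shape `outer / inner`. -/
structure SkewShape where
  outer : YoungDiagram
  inner : YoungDiagram
  inner_le : inner ≤ outer

namespace SkewShape

/-- The set of squares of a skew shape. -/
def cells (χ : SkewShape) : Finset (ℕ × ℕ) := χ.outer.cells \ χ.inner.cells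

/-- The partition `ν`, regarded as the skew shape `ν / 0`. -/
def ofPartition (ν : YoungDiagram) : SkewShape := ⟨ν, ⊥, bot_le⟩

end SkewShape

/-- Skew semistandard tableaux of shape `χ` with entries in `ℕ`: weakly increasing along rows,
strictly increasing down columns. The value of `entry` outside the shape is `0` by convention. -/
@[ext]
structure SkewTableau (χ : SkewShape) where
  entry : ℕ × ℕ → ℕ
  row_weak : ∀ i j j' : ℕ, j < j' → (i, j) ∈ χ.cells → (i, j') ∈ χ.cells →
    entry (i, j) ≤ entry (i, j')
  col_strict : ∀ i i' j : ℕ, i < i' → (i, j) ∈ χ.cells → (i', j) ∈ χ.cells →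
    entry (i, j) < entry (i', j)
  zeros : ∀ c : ℕ × ℕ, c ∉ χ.cells → entry c = 0

/-- The weight of a tableau: component `i` counts the entries equal to `i`. -/
def SkewTableau.weight {χ : SkewShape} (T : SkewTableau χ) (i : ℕ) : ℕ :=
  (χ.cells.filter (fun c => T.entry c = i)).card

/-- `Tab χ n`: the skew semistandard tableaux of shape `χ` with entries in `{0, …, n - 1}`. -/
def Tab (χ : SkewShape) (n : ℕ) : Type :=
  {T : SkewTableau χ // ∀ c ∈ χ.cells, T.entry c < n}

/-! ### Valid reading orders -/

/-- A valid reading order for `χ`: a total order on the squares of `χ` in which `(i, j)` comes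
before `(i', j')` whenever `i ≤ i'` and `j ≥ j'`. It is given by the list of all squares in
increasing order, so validity says that a square `t` that must precede `s` is not listed after
`s`. -/
structure ReadingOrder (χ : SkewShape) where
  squares : List (ℕ × ℕ)
  nodup : squares.Nodup
  mem_squares : ∀ c : ℕ × ℕ, c ∈ squares ↔ c ∈ χ.cells
  valid : squares.Pairwise (fun s t => ¬ (t.1 ≤ s.1 ∧ s.2 ≤ t.2))

/-- The word formed by the entries of `T`, listed in the reading order `r`. -/
def SkewTableau.word {χ : SkewShape} (T : SkewTableau χ) (r : ReadingOrder χ) : List ℕ :=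
  r.squares.map T.entry

/-- The squares of row `i` of `χ`, from right to left. -/
def SkewShape.revRow (χ : SkewShape) (i : ℕ) : List (ℕ × ℕ) :=
  (((List.range (χ.outer.rowLen i)).filter
    (fun j => χ.inner.rowLen i ≤ j)).reverse).map (fun j => (i, j))

theorem SkewShape.mem_revRow (χ : SkewShape) (i : ℕ) (c : ℕ × ℕ) :
    c ∈ χ.revRow i ↔ c.1 = i ∧ c ∈ χ.cells := by
  obtain ⟨a, b⟩ := c
  simp only [SkewShape.revRow, SkewShape.cells, List.mem_map, List.mem_reverse, List.mem_filter,
    List.mem_range, decide_eq_true_eq, Prod.mk.injEq, Finset.mem_sdiff, YoungDiagram.mem_cells,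
    YoungDiagram.mem_iff_lt_rowLen]
  constructor
  · rintro ⟨j, ⟨h1, h2⟩, rfl, rfl⟩
    exact ⟨rfl, h1, by omega⟩
  · rintro ⟨rfl, h1, h2⟩
    exact ⟨b, ⟨h1, by omega⟩, rfl, rfl⟩

theorem SkewShape.pairwise_revRow (χ : SkewShape) (i : ℕ) :
    (χ.revRow i).Pairwise (fun s t => t.2 < s.2) := by
  unfold SkewShape.revRow
  rw [List.pairwise_map, List.pairwise_reverse]
  exact List.Pairwise.filter _ List.pairwise_lt_range

/-- The Semitic reading order: rows from top to bottom, each row from right to left. -/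
def SkewShape.semitic (χ : SkewShape) : ReadingOrder χ where
  squares := (List.range (χ.outer.colLen 0)).flatMap χ.revRow
  nodup := by
    rw [List.nodup_flatMap]
    refine ⟨fun i _ => (χ.pairwise_revRow i).imp (fun h e => by subst e; omega), ?_⟩
    refine List.pairwise_lt_range.imp ?_
    intro a b hab c ha hb
    have h1 := ((χ.mem_revRow a c).1 ha).1
    have h2 := ((χ.mem_revRow b c).1 hb).1
    omega
  mem_squares c := by
    simp only [List.mem_flatMap, List.mem_range, SkewShape.mem_revRow]
    constructor
    · rintro ⟨i, _, _, h⟩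
      exact h
    · intro h
      refine ⟨c.1, ?_, rfl, h⟩
      have h1 : c ∈ χ.outer := (Finset.mem_sdiff.1 h).1
      rw [← YoungDiagram.mem_iff_lt_colLen]
      exact χ.outer.up_left_mem le_rfl (Nat.zero_le _) h1
  valid := by
    rw [List.pairwise_flatMap]
    refine ⟨fun i _ => (χ.pairwise_revRow i).imp (fun h e => by omega), ?_⟩
    refine List.pairwise_lt_range.imp ?_
    intro a b hab s hs t ht e
    have h1 := ((χ.mem_revRow a s).1 hs).1
    have h2 := ((χ.mem_revRow b t).1 ht).1
    omega

/-! ### Coplactic (raising) operations -/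

/-- `w` is dominant for `i`: every prefix has at least as many letters `i` as `i + 1`. -/
def WordDominantFor (i : ℕ) (w : List ℕ) : Prop :=
  ∀ u : List ℕ, u <+: w → u.count (i + 1) ≤ u.count i

/-- `w` is anti-dominant for `i`: every suffix has at least as many letters `i + 1` as `i`. -/
def WordAntiDominantFor (i : ℕ) (w : List ℕ) : Prop :=
  ∀ v : List ℕ, v <:+ w → v.count i ≤ v.count (i + 1)

/-- `w' = e_i(w)`: one letter `i + 1` of `w` is changed into `i`, the part of `w` to the left of
that letter being anti-dominant for `i` and the part to its right dominant for `i`. -/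
def WordRaise (i : ℕ) (w w' : List ℕ) : Prop :=
  ∃ u v : List ℕ, WordAntiDominantFor i u ∧ WordDominantFor i v ∧
    w = u ++ (i + 1) :: v ∧ w' = u ++ i :: v

/-- One step of the rewrite system of raising operations, determined using the reading order `r`:
`U = e_i(T)` for some `i`. As `U` has the shape of `T`, the equation between words says that `U` is
obtained from `T` by changing the entry of the square that is read as the changing letter. -/
def RaisingStep {χ : SkewShape} (r : ReadingOrder χ) (T U : SkewTableau χ) : Prop :=
  ∃ i : ℕ, WordRaise i (T.word r) (U.word r)

/-- `LR χ ν`: Littlewood-Richardson tableaux of shape `χ` and weight `ν`, i.e., tableaux whose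
(Semitic) reading word is a lattice permutation (every prefix contains, for each `i`, at least as
many letters `i` as `i + 1`). -/
def LR (χ : SkewShape) (ν : YoungDiagram) : Type :=
  {L : SkewTableau χ // (∀ i : ℕ, WordDominantFor i (L.word χ.semitic)) ∧
    ∀ i : ℕ, L.weight i = ν.rowLen i}

/-! ### Normal forms of rewrite systems -/

/-- `y` is a normal form of `x` for the rewrite system `R`: it can be reached from `x`, and no
rewrite step can be applied to it. -/
def IsNormalFormOf {α : Type} (R : α → α → Prop) (x y : α) : Prop :=
  Relation.ReflTransGen R x y ∧ ∀ z : α, ¬ R y z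

/-! ### Jeu de taquin -/

/-- A single move inside an inward slide on a tableau with outer shape `lam`. The state is the
position of the empty square together with the filling. The smaller one of the entries to the right
of and below the empty square moves into it (in case of equality, the one from below). -/
inductive SlideMove (lam : YoungDiagram) :
    (ℕ × ℕ) × (ℕ × ℕ → ℕ) → (ℕ × ℕ) × (ℕ × ℕ → ℕ) → Prop
  | up (i j : ℕ) (f : ℕ × ℕ → ℕ) (hmem : (i + 1, j) ∈ lam)
      (hle : (i, j + 1) ∈ lam → f (i + 1, j) ≤ f (i, j + 1)) :
      SlideMove lam ((i, j), f)
        ((i + 1, j), Function.update (Function.update f (i, j) (f (i + 1, j))) (i + 1, j) 0)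
  | left (i j : ℕ) (f : ℕ × ℕ → ℕ) (hmem : (i, j + 1) ∈ lam)
      (hlt : (i + 1, j) ∈ lam → f (i, j + 1) < f (i + 1, j)) :
      SlideMove lam ((i, j), f)
        ((i, j + 1), Function.update (Function.update f (i, j) (f (i, j + 1))) (i, j + 1) 0)

/-- `T'` is obtained from `T` by one inward jeu de taquin slide: a corner `s` of the inner shape
becomes the empty square, moves are made as long as possible, and the square `t` where the empty
square ends up is removed from the outer shape. (As both `inner` shapes are Young diagrams, `s` is a
corner of the first one.) -/
def InwardSlide (T T' : Σ χ : SkewShape, SkewTableau χ) : Prop :=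
  ∃ s t : ℕ × ℕ, s ∈ T.1.inner ∧
    T'.1.inner.cells = T.1.inner.cells.erase s ∧
    T'.1.outer.cells = T.1.outer.cells.erase t ∧
    IsNormalFormOf (SlideMove T.1.outer) (s, T.2.entry) (t, T'.2.entry)

/-! Fix `i`, count a letter `i + 1` as 1 and a letter `i` as -1, and follow the prefix sums of the
reading word. Dominance says that no prefix sum exceeds 0, anti-dominance that none exceeds the
total, and `e_i` changes the letter `i + 1` at which a positive maximum is first attained. So `e_i`
is injective, is defined exactly on the words that are not dominant and attains exactly those that
are not anti-dominant (`WordRaise.left_unique`, `exists_wordRaise_from`, `exists_wordRaise_to`).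
Semistandardness survives in both directions (`SkewTableau.exists_raise`,
`SkewTableau.exists_lower`). The reading order does not matter: vertical pairs `i` over `i + 1`
cannot create a new maximum, and the squares outside such pairs are read in an order that validity
forces.

The heart is that a slide commutes with `e_i` (`Punct.slide_raise`). A single move of the empty
square keeps every upper bound on the prefix sums (`Punct.gridSum_le_of_move`) and carries the first
maximum along (`Punct.firstMax_of_left`, `Punct.firstMax_of_up`). The slides of a tableau and of its
raised version make the same moves, or they part and their empty squares meet again with the
fillings still related by `e_i` (`Punct.exists_meet`). A slide with known initial and final empty
squares is reversible, and slides preserve weight, dominance and anti-dominance. Hence a commuting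
square of a slide and a raising can be completed from three of its corners (`Slide.raise_right`,
`Slide.raise_left`, `Slide.lift_raise_left`).

The rest is formal. A dominant tableau of partition shape has all entries of row `a` equal to `a`,
so its shape and its weight determine each other and the tableau. Raise `T` to a dominant `L` along
a sequence `l`, and slide `T` to `P` of partition shape along a sequence `σ`. Commutation gives a
dominant `Q` of partition shape, reached from `L` along `σ` and from `P` along `l`. The weight of
`L` alone fixes `Q`, and undoing `l` shows that `P` does not depend on the slides chosen; the shape
of `P` alone also fixes `Q`, and undoing `σ` shows that `L` does not depend on the raisings chosen.
Completing the rectangle from `L`, `Q` and `P` recovers `T`, which is bijectivity. -/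

/-! ### Words: prefix sums, raising and lowering -/

/-- The contribution of the letter `v` to the excess of letters `i + 1` over letters `i`. -/
def letterSign (i v : ℕ) : ℤ := if v = i + 1 then 1 else if v = i then -1 else 0

/-- The excess of letters `i + 1` over letters `i` in a word. -/
def wordSum (i : ℕ) (w : List ℕ) : ℤ := (w.map (letterSign i)).sum

@[simp] theorem wordSum_nil (i : ℕ) : wordSum i [] = 0 := rfl

@[simp] theorem wordSum_cons (i v : ℕ) (w : List ℕ) :
    wordSum i (v :: w) = letterSign i v + wordSum i w := by
  simp [wordSum]

@[simp] theorem wordSum_append (i : ℕ) (u v : List ℕ) :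
    wordSum i (u ++ v) = wordSum i u + wordSum i v := by
  simp [wordSum]

@[simp] theorem letterSign_succ (i : ℕ) : letterSign i (i + 1) = 1 := by simp [letterSign]

@[simp] theorem letterSign_self (i : ℕ) : letterSign i i = -1 := by simp [letterSign]

theorem wordSum_eq_count (i : ℕ) (w : List ℕ) :
    wordSum i w = (w.count (i + 1) : ℤ) - w.count i := by
  induction w with
  | nil => simp
  | cons a w ih =>
    rw [wordSum_cons, ih, List.count_cons, List.count_cons, letterSign]
    by_cases h1 : a = i + 1
    · subst h1; simp; ring
    · by_cases h2 : a = i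
      · subst h2; simp; ring
      · simp [h1, h2]

theorem wordDominantFor_iff (i : ℕ) (w : List ℕ) :
    WordDominantFor i w ↔ ∀ u v, w = u ++ v → wordSum i u ≤ 0 := by
  simp only [WordDominantFor, wordSum_eq_count]
  constructor
  · rintro h u v rfl
    have := h u (List.prefix_append _ _)
    omega
  · rintro h u ⟨v, rfl⟩
    have := h u v rfl
    omega

theorem wordAntiDominantFor_iff (i : ℕ) (w : List ℕ) :
    WordAntiDominantFor i w ↔ ∀ u v, w = u ++ v → 0 ≤ wordSum i v := by
  simp only [WordAntiDominantFor, wordSum_eq_count]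
  constructor
  · rintro h u v rfl
    have := h v (List.suffix_append _ _)
    omega
  · rintro h v ⟨u, rfl⟩
    have := h u v rfl
    omega

theorem wordRaise_iff (i : ℕ) (w w' : List ℕ) :
    WordRaise i w w' ↔ ∃ u v, (∀ p q, u = p ++ q → 0 ≤ wordSum i q) ∧
      (∀ p q, v = p ++ q → wordSum i p ≤ 0) ∧ w = u ++ (i + 1) :: v ∧ w' = u ++ i :: v := by
  simp only [WordRaise, wordDominantFor_iff, wordAntiDominantFor_iff]

/-- With two candidate positions, the word strictly between them would have sum at most 0 by
dominance after the first, and at least 1 by anti-dominance before the second. -/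
theorem WordRaise.left_unique {i : ℕ} {w w₁ w₂ : List ℕ} (h₁ : WordRaise i w₁ w)
    (h₂ : WordRaise i w₂ w) : w₁ = w₂ := by
  rw [wordRaise_iff] at h₁ h₂
  obtain ⟨u, v, hu, hv, rfl, rfl⟩ := h₁
  obtain ⟨u', v', hu', hv', rfl, e⟩ := h₂
  rcases List.append_eq_append_iff.1 e with ⟨z, rfl, e'⟩ | ⟨z, rfl, e'⟩
  · rcases z with _ | ⟨a, z⟩
    · simp_all
    · simp only [List.cons_append, List.cons.injEq] at e'
      obtain ⟨rfl, rfl⟩ := e'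
      have h1 := hv z (i :: v') (by simp)
      have h2 := hu' u (i :: z) (by simp)
      simp at h2
      omega
  · rcases z with _ | ⟨a, z⟩
    · simp_all
    · simp only [List.cons_append, List.cons.injEq] at e'
      obtain ⟨rfl, rfl⟩ := e'
      have h1 := hv' z (i :: v) (by simp)
      have h2 := hu u' (i :: z) (by simp)
      simp at h2
      omega

/-! ### Raising and lowering words at the extremal maxima of prefix sums -/

theorem wordSum_take_succ (i : ℕ) (w : List ℕ) (k : ℕ) (h : k < w.length) :
    wordSum i (w.take (k + 1)) = wordSum i (w.take k) + letterSign i w[k] := by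
  rw [← List.take_append_getElem h, wordSum_append]
  simp

/-- The letter to change is the last one of the shortest prefix with maximal sum. That maximum is
positive as `w` is not dominant, so this prefix is not empty. -/
theorem exists_wordRaise_from {i : ℕ} {w : List ℕ} (h : ¬ WordDominantFor i w) :
    ∃ w', WordRaise i w w' := by
  classical
  rw [wordDominantFor_iff] at h
  push Not at h
  obtain ⟨u, v, rfl, hpos⟩ := h
  set w := u ++ v with hw
  obtain ⟨k₀, hk₀, hmax⟩ := Finset.exists_max_image (Finset.range (w.length + 1))
    (fun k => wordSum i (w.take k)) ⟨0, by simp⟩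
  have hex : ∃ k, k ≤ w.length ∧ ∀ j ≤ w.length, wordSum i (w.take j) ≤ wordSum i (w.take k) :=
    ⟨k₀, by simpa [Nat.lt_succ_iff] using hk₀, fun j hj => hmax j (by simp; omega)⟩
  obtain ⟨hkl, hk⟩ := Nat.find_spec hex
  have hmin := fun j hj => Nat.find_min hex (m := j) hj
  generalize Nat.find hex = k at *
  have hposk : 0 < wordSum i (w.take k) := by
    have := hk u.length (by simp [hw])
    rw [show w.take u.length = u by rw [hw, List.take_left]] at this
    omega
  rcases k with _ | k
  · simp at hposk
  have hlt : ∀ j ≤ k, wordSum i (w.take j) < wordSum i (w.take (k + 1)) := by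
    intro j hj
    have := hmin j (by omega)
    push Not at this
    obtain ⟨j', hj', h2⟩ := this (by omega)
    exact lt_of_lt_of_le h2 (hk j' hj')
  have hs := wordSum_take_succ i w k hkl
  have hwk : w[k] = i + 1 := by
    have := hlt k le_rfl
    rw [hs, letterSign] at this
    by_contra hne
    rw [if_neg hne] at this
    split_ifs at this <;> omega
  rw [hwk, letterSign_succ] at hs
  have hsplit : w = w.take k ++ (i + 1) :: w.drop (k + 1) := by
    rw [← hwk, List.cons_getElem_drop_succ, List.take_append_drop]
  refine ⟨w.take k ++ i :: w.drop (k + 1), ?_⟩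
  rw [wordRaise_iff]
  refine ⟨_, _, ?_, ?_, hsplit, rfl⟩
  · intro p q hpq
    have hl := congrArg List.length hpq
    simp only [List.length_take, List.length_append] at hl
    have h1 := hlt p.length (by omega)
    have h2 : w.take p.length = p := by
      rw [hsplit, hpq, List.append_assoc, List.take_left]
    rw [h2, hs, hpq, wordSum_append] at h1
    omega
  · intro p q hpq
    have h2 : w.take (k + 1 + p.length) = w.take (k + 1) ++ p := by
      conv_lhs => rw [← List.take_append_drop (k + 1) w, hpq, ← List.append_assoc]
      apply List.take_left'
      simp
      omega
    have hl := congrArg List.length hpq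
    simp only [List.length_drop, List.length_append] at hl
    have h1 := hk (k + 1 + p.length) (by omega)
    rw [h2, wordSum_append] at h1
    omega

/-- The letter to change back is the one following the longest prefix with maximal sum. A suffix of
negative sum guarantees that this prefix is not the whole word. -/
theorem exists_wordRaise_to {i : ℕ} {w : List ℕ} (h : ¬ WordAntiDominantFor i w) :
    ∃ w', WordRaise i w' w := by
  classical
  rw [wordAntiDominantFor_iff] at h
  push Not at h
  obtain ⟨u, v, rfl, hneg⟩ := h
  set w := u ++ v with hw
  obtain ⟨k₀, hk₀, hmax⟩ := Finset.exists_max_image (Finset.range (w.length + 1))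
    (fun k => wordSum i (w.take k)) ⟨0, by simp⟩
  -- Minimising `m`, the length of the remaining suffix, selects the longest maximal prefix.
  have hex : ∃ m, m ≤ w.length ∧
      ∀ j ≤ w.length, wordSum i (w.take j) ≤ wordSum i (w.take (w.length - m)) := by
    have : k₀ ≤ w.length := by simpa [Nat.lt_succ_iff] using hk₀
    refine ⟨w.length - k₀, by omega, fun j hj => ?_⟩
    rw [show w.length - (w.length - k₀) = k₀ by omega]
    exact hmax j (by simp; omega)
  obtain ⟨hkl, hk⟩ := Nat.find_spec hex
  have hmin := fun j hj => Nat.find_min hex (m := j) hj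
  generalize Nat.find hex = m at *
  have hm : m ≠ 0 := by
    rintro rfl
    have := hk u.length (by simp [hw])
    rw [Nat.sub_zero, List.take_length, show w.take u.length = u by rw [hw, List.take_left],
      hw, wordSum_append] at this
    omega
  obtain ⟨k, hkm⟩ : ∃ k, k = w.length - m := ⟨_, rfl⟩
  rw [← hkm] at hk
  have hkw : k < w.length := by omega
  have hlt : ∀ j, k < j → j ≤ w.length → wordSum i (w.take j) < wordSum i (w.take k) := by
    intro j hj hj2
    have := hmin (w.length - j) (by omega)
    push Not at this
    obtain ⟨j', hj', h2⟩ := this (by omega)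
    rw [show w.length - (w.length - j) = j by omega] at h2
    exact lt_of_lt_of_le h2 (hk j' hj')
  have hs := wordSum_take_succ i w k hkw
  have hwk : w[k] = i := by
    have := hlt (k + 1) (by omega) (by omega)
    rw [hs, letterSign] at this
    by_contra hne
    rw [if_neg hne] at this
    split_ifs at this <;> omega
  rw [hwk, letterSign_self] at hs
  have hsplit : w = w.take k ++ i :: w.drop (k + 1) := by
    conv_lhs => rw [← List.take_append_drop k w, ← List.cons_getElem_drop_succ (h := hkw), hwk]
  refine ⟨w.take k ++ (i + 1) :: w.drop (k + 1), ?_⟩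
  rw [wordRaise_iff]
  refine ⟨_, _, ?_, ?_, rfl, hsplit⟩
  · intro p q hpq
    have hl := congrArg List.length hpq
    simp only [List.length_take, List.length_append] at hl
    have h1 := hk p.length (by omega)
    have h2 : w.take p.length = p := by
      rw [hsplit, hpq, List.append_assoc, List.take_left]
    rw [h2, hpq, wordSum_append] at h1
    omega
  · intro p q hpq
    have h2 : w.take (k + 1 + p.length) = w.take (k + 1) ++ p := by
      conv_lhs => rw [← List.take_append_drop (k + 1) w, hpq, ← List.append_assoc]
      apply List.take_left'
      simp
      omega
    have hl := congrArg List.length hpq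
    simp only [List.length_drop, List.length_append] at hl
    have h1 := hlt (k + 1 + p.length) (by omega) (by omega)
    rw [h2, wordSum_append] at h1
    omega

theorem WordRaise.not_dominant {i : ℕ} {w w' : List ℕ} (h : WordRaise i w w') :
    ¬ WordDominantFor i w := by
  rw [wordRaise_iff] at h
  rw [wordDominantFor_iff]
  obtain ⟨u, v, hu, hv, rfl, rfl⟩ := h
  intro hd
  have h1 := hd (u ++ [i + 1]) v (by simp)
  have h2 := hu [] u rfl
  simp at h1
  omega

theorem WordRaise.not_antiDominant {i : ℕ} {w w' : List ℕ} (h : WordRaise i w w') :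
    ¬ WordAntiDominantFor i w' := by
  rw [wordRaise_iff] at h
  rw [wordAntiDominantFor_iff]
  obtain ⟨u, v, hu, hv, rfl, rfl⟩ := h
  intro hd
  have h1 := hd u (i :: v) rfl
  have h2 := hv v [] (by simp)
  simp at h1
  omega

/-! ### Words read from a strictly ordered list of positions -/

section Positions

variable {α : Type} [DecidableEq α] (lt : α → α → Prop) [DecidableRel lt]

/-- The excess of `i + 1` over `i` in the part of the word up to and including position `x`. -/
def posSum (s : Finset α) (f : α → ℕ) (i : ℕ) (x : α) : ℤ :=
  ∑ y ∈ s with y = x ∨ lt y x, letterSign i (f y)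

variable {lt}

theorem posSum_append {i : ℕ} {f : α → ℕ} {A B : List α} {x : α} {s : Finset α}
    (hs : s = (A ++ x :: B).toFinset)
    (hl : (A ++ x :: B).Pairwise lt) (hirr : ∀ y, ¬ lt y y) (hasymm : ∀ y z, lt y z → ¬ lt z y) :
    posSum lt s f i x = wordSum i (A.map f) + letterSign i (f x) := by
  have hnd : (A ++ x :: B).Nodup := hl.imp (fun h e => by subst e; exact hirr _ h)
  rw [List.pairwise_append, List.pairwise_cons] at hl
  obtain ⟨hA, ⟨hxB, hB⟩, hAB⟩ := hl
  have hset : s.filter (fun y => y = x ∨ lt y x) = (A ++ [x]).toFinset := by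
    subst hs
    ext y
    simp only [Finset.mem_filter, List.mem_toFinset, List.mem_append, List.mem_cons,
      List.not_mem_nil, or_false]
    constructor
    · rintro ⟨h | h | h, h' | h'⟩
      · exact Or.inl h
      · exact Or.inl h
      · exact Or.inr h
      · exact Or.inr h
      · exact Or.inr h'
      · exact absurd h' (hasymm _ _ (hxB y h))
    · rintro (h | rfl)
      · exact ⟨Or.inl h, Or.inr (hAB y h x (by simp))⟩
      · exact ⟨Or.inr (Or.inl rfl), Or.inl rfl⟩
  have hnd' : (A ++ [x]).Nodup := by
    rw [show A ++ x :: B = (A ++ [x]) ++ B by simp] at hnd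
    exact (List.nodup_append.1 hnd).1
  rw [posSum, hset, List.sum_toFinset _ hnd']
  simp [wordSum, Function.comp_def]

theorem wordDominantFor_map_iff {i : ℕ} {f : α → ℕ} {l : List α} {s : Finset α}
    (hs : s = l.toFinset)
    (hl : l.Pairwise lt) (hirr : ∀ y, ¬ lt y y) (hasymm : ∀ y z, lt y z → ¬ lt z y) :
    WordDominantFor i (l.map f) ↔ ∀ x ∈ l, posSum lt s f i x ≤ 0 := by
  rw [wordDominantFor_iff]
  constructor
  · intro h x hx
    obtain ⟨A, B, rfl⟩ := List.append_of_mem hx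
    rw [posSum_append hs hl hirr hasymm]
    have := h ((A ++ [x]).map f) (B.map f) (by simp)
    simpa using this
  · intro h u v huv
    obtain ⟨A, B, rfl, rfl, rfl⟩ := List.map_eq_append_iff.1 huv
    rcases List.eq_nil_or_concat A with rfl | ⟨A, x, rfl⟩
    · simp
    · have := h x (by simp)
      rw [List.concat_append] at hl hs
      rw [posSum_append hs hl hirr hasymm] at this
      simpa using this

/-- A suffix sum is the total minus a prefix sum. The empty prefix ends at no position and accounts
for the first conjunct. -/
theorem wordAntiDominantFor_map_iff {i : ℕ} {f : α → ℕ} {l : List α} {s : Finset α}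
    (hs : s = l.toFinset)
    (hl : l.Pairwise lt) (hirr : ∀ y, ¬ lt y y) (hasymm : ∀ y z, lt y z → ¬ lt z y) :
    WordAntiDominantFor i (l.map f) ↔ 0 ≤ ∑ y ∈ s, letterSign i (f y) ∧
      ∀ x ∈ l, posSum lt s f i x ≤ ∑ y ∈ s, letterSign i (f y) := by
  have hnd : l.Nodup := hl.imp (fun h e => by subst e; exact hirr _ h)
  have htot : ∑ y ∈ s, letterSign i (f y) = wordSum i (l.map f) := by
    rw [hs, List.sum_toFinset _ hnd]
    simp [wordSum, Function.comp_def]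
  rw [htot, wordAntiDominantFor_iff]
  constructor
  · intro h
    refine ⟨h [] _ rfl, fun x hx => ?_⟩
    obtain ⟨A, B, rfl⟩ := List.append_of_mem hx
    rw [posSum_append hs hl hirr hasymm]
    have := h ((A ++ [x]).map f) (B.map f) (by simp)
    simp only [List.map_append, List.map_cons, wordSum_append, wordSum_cons]
    omega
  · rintro ⟨h0, h⟩ u v huv
    obtain ⟨A, B, rfl, rfl, rfl⟩ := List.map_eq_append_iff.1 huv
    rcases List.eq_nil_or_concat A with rfl | ⟨A, x, rfl⟩
    · simpa using h0
    · have := h x (by simp)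
      rw [List.concat_append] at hl hs this
      rw [posSum_append hs hl hirr hasymm] at this
      simp only [List.map_append, List.map_cons, wordSum_append, wordSum_cons] at this
      omega

/-- Anti-dominance before `x` makes the prefix sum at `x` exceed all earlier ones, including the
empty one, whence positivity. Dominance after `x` says that it is never exceeded later. -/
theorem wordRaise_map_iff {i : ℕ} {f g : α → ℕ} {l : List α} {s : Finset α}
    (hs : s = l.toFinset)
    (hl : l.Pairwise lt) (hirr : ∀ y, ¬ lt y y) (hasymm : ∀ y z, lt y z → ¬ lt z y) :
    WordRaise i (l.map f) (l.map g) ↔ ∃ x ∈ l, f x = i + 1 ∧ g x = i ∧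
      (∀ y ∈ l, y ≠ x → g y = f y) ∧ 0 < posSum lt s f i x ∧
      (∀ y ∈ l, lt y x → posSum lt s f i y < posSum lt s f i x) ∧
      ∀ y ∈ l, lt x y → posSum lt s f i y ≤ posSum lt s f i x := by
  have hnd : l.Nodup := hl.imp (fun h e => by subst e; exact hirr _ h)
  rw [wordRaise_iff]
  constructor
  · rintro ⟨u, v, hu, hv, e1, e2⟩
    obtain ⟨A, B', rfl, rfl, e3⟩ := List.map_eq_append_iff.1 e1
    obtain ⟨x, B, rfl, hx, rfl⟩ := List.map_eq_cons_iff.1 e3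
    have hfg : A.map g = A.map f ∧ g x = i ∧ B.map g = B.map f := by
      rw [List.map_append, List.map_cons] at e2
      have := List.append_inj e2 (by simp)
      simp only [List.cons.injEq] at this
      exact this
    obtain ⟨hfA, hgx, hfB⟩ := hfg
    have hxS := posSum_append (f := f) (i := i) hs hl hirr hasymm
    rw [hx, letterSign_succ] at hxS
    refine ⟨x, by simp, hx, hgx, ?_, ?_, ?_, ?_⟩
    · intro y hy hyx
      simp only [List.mem_append, List.mem_cons, hyx, false_or] at hy
      rcases hy with hy | hy
      · exact List.map_inj_left.1 hfA y hy
      · exact List.map_inj_left.1 hfB y hy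
    · have := hu [] _ rfl
      omega
    · intro y hy hyx
      rw [List.mem_append, List.mem_cons] at hy
      rw [List.pairwise_append, List.pairwise_cons] at hl
      have hyA : y ∈ A := by
        rcases hy with hy | rfl | hy
        · exact hy
        · exact absurd hyx (hirr _)
        · exact absurd hyx (hasymm _ _ (hl.2.1.1 y hy))
      obtain ⟨A1, A2, rfl⟩ := List.append_of_mem hyA
      rw [← List.pairwise_cons, ← List.pairwise_append] at hl
      rw [hxS]
      rw [List.append_assoc, List.cons_append] at hl hs
      rw [posSum_append hs hl hirr hasymm]
      have := hu ((A1 ++ [y]).map f) (A2.map f) (by simp)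
      simp only [List.map_append, List.map_cons, wordSum_append, wordSum_cons]
      omega
    · intro y hy hxy
      rw [List.mem_append, List.mem_cons] at hy
      rw [List.pairwise_append, List.pairwise_cons] at hl
      have hyB : y ∈ B := by
        rcases hy with hy | rfl | hy
        · exact absurd hxy (hasymm _ _ (hl.2.2 y hy x (by simp)))
        · exact absurd hxy (hirr _)
        · exact hy
      obtain ⟨B1, B2, rfl⟩ := List.append_of_mem hyB
      rw [← List.pairwise_cons, ← List.pairwise_append] at hl
      rw [hxS]
      rw [← List.cons_append, ← List.append_assoc] at hl hs
      rw [posSum_append hs hl hirr hasymm]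
      have := hv ((B1 ++ [y]).map f) (B2.map f) (by simp)
      simp only [List.map_append, List.map_cons, wordSum_append, wordSum_cons, hx,
        letterSign_succ, List.map_nil, wordSum_nil] at this ⊢
      omega
  · rintro ⟨x, hx, hfx, hgx, hfg, h0, h1, h2⟩
    obtain ⟨A, B, rfl⟩ := List.append_of_mem hx
    have hxA : x ∉ A := fun h => by
      rw [List.nodup_append] at hnd
      exact hnd.2.2 x h x (by simp) rfl
    have hxB : x ∉ B := fun h => by
      rw [List.nodup_append, List.nodup_cons] at hnd
      exact hnd.2.1.1 h
    have hxS := posSum_append (f := f) (i := i) hs hl hirr hasymm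
    rw [hfx, letterSign_succ] at hxS
    refine ⟨A.map f, B.map f, ?_, ?_, by simp [hfx], ?_⟩
    · intro p q hpq
      obtain ⟨A1, A2, rfl, rfl, rfl⟩ := List.map_eq_append_iff.1 hpq
      rcases List.eq_nil_or_concat A1 with rfl | ⟨A1, y, rfl⟩
      · simp only [List.nil_append] at hxS
        omega
      · have hyx : lt y x := by
          rw [List.pairwise_append] at hl
          exact hl.2.2 y (by simp) x (by simp)
        have h3 := h1 y (by simp) hyx
        rw [hxS] at h3
        rw [List.concat_append, List.append_assoc, List.cons_append] at hl hs
        rw [posSum_append hs hl hirr hasymm] at h3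
        simp only [List.concat_append, List.map_append, List.map_cons, wordSum_append,
          wordSum_cons] at h3
        omega
    · intro p q hpq
      obtain ⟨B1, B2, rfl, rfl, rfl⟩ := List.map_eq_append_iff.1 hpq
      rcases List.eq_nil_or_concat B1 with rfl | ⟨B1, y, rfl⟩
      · simp
      · have hyx : lt x y := by
          rw [List.pairwise_append, List.pairwise_cons] at hl
          exact hl.2.1.1 y (by simp)
        have h3 := h2 y (by simp) hyx
        rw [hxS] at h3
        rw [List.concat_append, ← List.cons_append, ← List.append_assoc] at hl hs
        rw [posSum_append hs hl hirr hasymm] at h3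
        simp only [List.concat_eq_append, List.map_append, List.map_cons, wordSum_append,
          wordSum_cons, hfx, letterSign_succ, List.map_nil, wordSum_nil] at h3 ⊢
        omega
    · simp only [List.map_append, List.map_cons, hgx]
      congr 1
      · exact List.map_congr_left fun y hy => hfg y (by simp [hy]) (by rintro rfl; exact hxA hy)
      · congr 1
        exact List.map_congr_left fun y hy => hfg y (by simp [hy]) (by rintro rfl; exact hxB hy)

end Positions

/-! ### Independence of the reading order -/

theorem SkewShape.mem_cells {χ : SkewShape} {c : ℕ × ℕ} :
    c ∈ χ.cells ↔ c ∈ χ.outer ∧ c ∉ χ.inner := by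
  simp [SkewShape.cells]

theorem SkewShape.mem_cells_of_between {χ : SkewShape} {p q c : ℕ × ℕ} (hp : p ∈ χ.cells)
    (hq : q ∈ χ.cells) (h1 : p.1 ≤ c.1) (h2 : p.2 ≤ c.2) (h3 : c.1 ≤ q.1) (h4 : c.2 ≤ q.2) :
    c ∈ χ.cells := by
  rw [SkewShape.mem_cells] at *
  exact ⟨χ.outer.up_left_mem h3 h4 hq.1, fun h => hp.2 (χ.inner.up_left_mem h1 h2 h)⟩

theorem letterSign_eq_zero {i v : ℕ} (h1 : v ≠ i + 1) (h2 : v ≠ i) : letterSign i v = 0 := by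
  simp [letterSign, h1, h2]

namespace ReadingOrder

variable {χ : SkewShape} (r : ReadingOrder χ)

/-- The strict order in which a reading order lists squares. -/
abbrev lt (p q : ℕ × ℕ) : Prop := r.squares.idxOf p < r.squares.idxOf q

theorem pairwise_lt : r.squares.Pairwise r.lt := by
  rw [List.pairwise_iff_getElem]
  intro m n hm hn hmn
  simpa [lt, r.nodup.idxOf_getElem] using hmn

theorem cells_eq : χ.cells = r.squares.toFinset := by
  ext c
  simp [r.mem_squares]

theorem lt_of_northEast {p q : ℕ × ℕ} (hp : p ∈ χ.cells) (hq : q ∈ χ.cells) (h1 : p.1 ≤ q.1)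
    (h2 : q.2 ≤ p.2) (hne : p ≠ q) : r.lt p q := by
  rw [← r.mem_squares] at hp hq
  by_contra hlt
  have hidx : r.squares.idxOf p ≠ r.squares.idxOf q := fun h => hne ((List.idxOf_inj hp).1 h)
  have hv := List.pairwise_iff_getElem.1 r.valid _ _ (List.idxOf_lt_length_iff.2 hq)
    (List.idxOf_lt_length_iff.2 hp) (by unfold lt at hlt; omega)
  rw [List.getElem_idxOf, List.getElem_idxOf] at hv
  exact hv ⟨h1, h2⟩

end ReadingOrder

namespace SkewTableau

variable {χ : SkewShape} (T : SkewTableau χ)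

/-- A square with entry `i + 1` and no `i` directly above it, or with entry `i` and no `i + 1`
directly below it. -/
def IsFree (i : ℕ) (x : ℕ × ℕ) : Prop :=
  (T.entry x = i + 1 ∧ ∀ a, x.1 = a + 1 → (a, x.2) ∈ χ.cells → T.entry (a, x.2) ≠ i) ∨
    (T.entry x = i ∧ ((x.1 + 1, x.2) ∈ χ.cells → T.entry (x.1 + 1, x.2) ≠ i + 1))

variable {T}

/-- Strict columns leave room for only two rows in the rectangle spanned by the squares. Then `i` is
in both upper corners and `i + 1` in both lower ones, so each given square belongs to a vertical
pair. -/
theorem not_isFree_of_southEast {i a b c d : ℕ} (hs : (a, b) ∈ χ.cells) (ht : (c, d) ∈ χ.cells)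
    (hac : a < c) (hbd : b < d) (h1 : T.entry (a, b) = i ∨ T.entry (a, b) = i + 1)
    (h2 : T.entry (c, d) = i ∨ T.entry (c, d) = i + 1) :
    ¬ T.IsFree i (a, b) ∧ ¬ T.IsFree i (c, d) := by
  have had : (a, d) ∈ χ.cells := χ.mem_cells_of_between hs ht le_rfl hbd.le hac.le le_rfl
  have had' : (a + 1, d) ∈ χ.cells :=
    χ.mem_cells_of_between hs ht (Nat.le_succ a) hbd.le hac le_rfl
  have hab' : (a + 1, b) ∈ χ.cells :=
    χ.mem_cells_of_between hs ht (Nat.le_succ a) le_rfl hac hbd.le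
  have e1 := T.row_weak a b d hbd hs had
  have e2 := T.col_strict a (a + 1) d (Nat.lt_succ_self a) had had'
  have e3 := T.col_strict a (a + 1) b (Nat.lt_succ_self a) hs hab'
  have e4 := T.row_weak (a + 1) b d hbd hab' had'
  have e5 : c = a + 1 := by
    by_contra hne
    have := T.col_strict (a + 1) c d (by omega) had' ht
    omega
  subst e5
  refine ⟨?_, ?_⟩
  · rintro (⟨h, -⟩ | ⟨-, h⟩)
    · omega
    · exact h hab' (show T.entry (a + 1, b) = i + 1 by omega)
  · rintro (⟨-, h⟩ | ⟨h, -⟩)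
    · exact h a rfl had (show T.entry (a, d) = i by omega)
    · omega

theorem IsFree.comparable {i : ℕ} {x y : ℕ × ℕ} (hf : T.IsFree i x) (hx : x ∈ χ.cells)
    (hy : y ∈ χ.cells) (h : T.entry y = i ∨ T.entry y = i + 1) :
    (y.1 ≤ x.1 ∧ x.2 ≤ y.2) ∨ (x.1 ≤ y.1 ∧ y.2 ≤ x.2) := by
  obtain ⟨a, b⟩ := x
  obtain ⟨c, d⟩ := y
  have h' : T.entry (a, b) = i ∨ T.entry (a, b) = i + 1 := hf.symm.imp And.left And.left
  by_contra hcon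
  simp only [not_or, not_and_or, not_le] at hcon
  by_cases hac : a < c
  · exact (not_isFree_of_southEast hx hy hac (by omega) h' h).1 hf
  · exact (not_isFree_of_southEast hy hx (by omega) (by omega) h h').2 hf

/-- Stepping one square up injects the letters `i + 1` in `E` into the letters `i` in `E`. -/
theorem sum_letterSign_nonpos {i : ℕ} {E : Finset (ℕ × ℕ)}
    (hE : ∀ q ∈ E, T.entry q = i + 1 → ∃ a, q.1 = a + 1 ∧ (a, q.2) ∈ E ∧ T.entry (a, q.2) = i) :
    ∑ y ∈ E, letterSign i (T.entry y) ≤ 0 := by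
  have hsum : ∑ y ∈ E, letterSign i (T.entry y) =
      ((E.filter fun y => T.entry y = i + 1).card : ℤ) - (E.filter fun y => T.entry y = i).card := by
    rw [Finset.card_filter, Finset.card_filter]
    push_cast
    rw [← Finset.sum_sub_distrib]
    refine Finset.sum_congr rfl fun y _ => ?_
    unfold letterSign
    split_ifs <;> omega
  have hcard : (E.filter fun y => T.entry y = i + 1).card ≤
      (E.filter fun y => T.entry y = i).card := by
    refine Finset.card_le_card_of_injOn (fun q => (q.1 - 1, q.2)) ?_ ?_
    · intro q hq
      simp only [Finset.coe_filter, Set.mem_ofPred_eq] at hq ⊢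
      obtain ⟨a, h1, h2, h3⟩ := hE q hq.1 hq.2
      rw [h1]
      exact ⟨h2, h3⟩
    · rintro ⟨a, b⟩ hq ⟨c, d⟩ hq' h
      simp only [Finset.coe_filter, Set.mem_ofPred_eq, Prod.mk.injEq] at hq hq' h ⊢
      obtain ⟨_, h1, _⟩ := hE _ hq.1 hq.2
      obtain ⟨_, h2, _⟩ := hE _ hq'.1 hq'.2
      omega
  rw [hsum]
  omega

variable (T)

/-- The prefix sums of the word of `T` in a reading order. -/
abbrev readSum (r : ReadingOrder χ) (i : ℕ) (x : ℕ × ℕ) : ℤ :=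
  posSum r.lt χ.cells T.entry i x

variable {T}

theorem above_of_not_isFree {i : ℕ} {q : ℕ × ℕ} (h : T.entry q = i + 1)
    (hf : ¬ T.IsFree i q) : ∃ a, q.1 = a + 1 ∧ (a, q.2) ∈ χ.cells ∧ T.entry (a, q.2) = i := by
  by_contra hcon
  push Not at hcon
  exact hf (Or.inl ⟨h, fun a h1 h2 => hcon a h1 h2⟩)

/-- Only letters `i` and `i + 1` count, and each such square is comparable with a free `x`. Whether
it is read before `x` is therefore decided by validity alone. -/
theorem readSum_eq_of_isFree {i : ℕ} {x : ℕ × ℕ} (r r' : ReadingOrder χ) (hf : T.IsFree i x)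
    (hx : x ∈ χ.cells) : T.readSum r i x = T.readSum r' i x := by
  unfold readSum posSum
  rw [Finset.sum_filter, Finset.sum_filter]
  refine Finset.sum_congr rfl fun y hy => ?_
  by_cases h : T.entry y = i ∨ T.entry y = i + 1
  · have key : ∀ r : ReadingOrder χ, (y = x ∨ r.lt y x) ↔ (y.1 ≤ x.1 ∧ x.2 ≤ y.2) := by
      intro r
      constructor
      · rintro (rfl | hlt)
        · exact ⟨le_rfl, le_rfl⟩
        · rcases hf.comparable hx hy h with h' | h'
          · exact h'
          · by_cases hxy : x = y
            · subst hxy; exact ⟨le_rfl, le_rfl⟩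
            · exact absurd (r.lt_of_northEast hx hy h'.1 h'.2 hxy) (by unfold ReadingOrder.lt at *; omega)
      · intro h'
        by_cases hxy : y = x
        · exact Or.inl hxy
        · exact Or.inr (r.lt_of_northEast hy hx h'.1 h'.2 hxy)
    simp only [key]
  · rw [not_or] at h
    simp [letterSign_eq_zero h.2 h.1]

/-- Take for `x` the last free square read no later than `w`. Every `i + 1` read after `x` and up to
`w` is not free, so it has an `i` above it, also read in that interval. The interval then
contributes at most 0. If there is no such `x`, the same pairing applies to the whole prefix. -/
theorem readSum_le_isFree {i : ℕ} {w : ℕ × ℕ} (r : ReadingOrder χ) :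
    T.readSum r i w ≤ 0 ∨ ∃ x ∈ χ.cells, T.IsFree i x ∧ (x = w ∨ r.lt x w) ∧
      T.readSum r i w ≤ T.readSum r i x := by
  classical
  by_cases hex : (χ.cells.filter fun x => T.IsFree i x ∧ (x = w ∨ r.lt x w)).Nonempty
  · right
    obtain ⟨x, hx, hmax⟩ := Finset.exists_max_image _ (fun x => r.squares.idxOf x) hex
    simp only [Finset.mem_filter] at hx hmax
    refine ⟨x, hx.1, hx.2.1, hx.2.2, ?_⟩
    have hsplit : χ.cells.filter (fun y => y = w ∨ r.lt y w) =
        χ.cells.filter (fun y => y = x ∨ r.lt y x) ∪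
          χ.cells.filter (fun y => (y = w ∨ r.lt y w) ∧ r.lt x y) := by
      ext y
      simp only [Finset.mem_filter, Finset.mem_union]
      constructor
      · rintro ⟨hy, hyw⟩
        by_cases h1 : r.lt x y
        · exact Or.inr ⟨hy, hyw, h1⟩
        · refine Or.inl ⟨hy, ?_⟩
          by_cases h2 : r.lt y x
          · exact Or.inr h2
          · left
            unfold ReadingOrder.lt at *
            exact (List.idxOf_inj ((r.mem_squares y).2 hy)).1 (by omega)
      · rintro (⟨hy, rfl | h⟩ | ⟨hy, h, -⟩)
        · exact ⟨hy, hx.2.2⟩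
        · refine ⟨hy, Or.inr ?_⟩
          rcases hx.2.2 with h' | h'
          · exact h' ▸ h
          · exact lt_trans h h'
        · exact ⟨hy, h⟩
    unfold readSum posSum
    rw [hsplit, Finset.sum_union]
    · have : ∑ y ∈ χ.cells.filter (fun y => (y = w ∨ r.lt y w) ∧ r.lt x y),
          letterSign i (T.entry y) ≤ 0 := by
        refine sum_letterSign_nonpos fun q hq hqi => ?_
        simp only [Finset.mem_filter] at hq
        have hqf : ¬ T.IsFree i q := fun hf => by
          have := hmax q ⟨hq.1, hf, hq.2.1⟩
          have := hq.2.2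
          unfold ReadingOrder.lt at this
          omega
        obtain ⟨a, h1, h2, h3⟩ := above_of_not_isFree hqi hqf
        have hpq : r.lt (a, q.2) q := r.lt_of_northEast h2 hq.1 (by simp [h1]) le_rfl (by
          intro h; rw [← h] at h1; simp at h1)
        refine ⟨a, h1, ?_, h3⟩
        simp only [Finset.mem_filter]
        refine ⟨h2, Or.inr ?_, ?_⟩
        · rcases hq.2.1 with h' | h'
          · exact h' ▸ hpq
          · exact lt_trans hpq h'
        · have hxp : x ≠ (a, q.2) := by
            rintro rfl
            rcases hx.2.1 with h | h
            · omega
            · refine h.2 ?_ ?_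
              · simp only [← h1]
                exact hq.1
              · simp only [← h1]
                exact hqi
          have hxq : x ≠ q := by
            rintro rfl
            exact hqf hx.2.1
          -- Being read before `q`, the square `x` lies north-east of `q`. If it were also
          -- south-west of the square above `q`, it would be one of these two squares, and neither
          -- is possible.
          rcases hx.2.1.comparable hx.1 h2 (Or.inl h3) with h | h
          · rcases hx.2.1.comparable hx.1 hq.1 (Or.inr hqi) with h' | h'
            · exact absurd (r.lt_of_northEast hq.1 hx.1 h'.1 h'.2 hxq.symm)
                (not_lt.2 (le_of_lt hq.2.2))
            · exfalso
              obtain ⟨x1, x2⟩ := x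
              obtain ⟨q1, q2⟩ := q
              simp only [ne_eq, Prod.mk.injEq] at *
              omega
          · exact r.lt_of_northEast hx.1 h2 h.1 h.2 hxp
      linarith
    · rw [Finset.disjoint_left]
      intro y h1 h2
      simp only [Finset.mem_filter] at h1 h2
      rcases h1.2 with rfl | h
      · exact lt_irrefl _ h2.2.2
      · exact lt_asymm h h2.2.2
  · left
    rw [Finset.not_nonempty_iff_eq_empty, Finset.filter_eq_empty_iff] at hex
    refine sum_letterSign_nonpos fun q hq hqi => ?_
    simp only [Finset.mem_filter] at hq
    obtain ⟨a, h1, h2, h3⟩ := above_of_not_isFree hqi (fun hf => hex hq.1 ⟨hf, hq.2⟩)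
    have hpq : r.lt (a, q.2) q := r.lt_of_northEast h2 hq.1 (by simp [h1]) le_rfl (by
      intro h; rw [← h] at h1; simp at h1)
    refine ⟨a, h1, ?_, h3⟩
    simp only [Finset.mem_filter]
    refine ⟨h2, Or.inr ?_⟩
    rcases hq.2 with h' | h'
    · exact h' ▸ hpq
    · exact lt_trans hpq h'

/-- By `readSum_le_isFree`, a positive maximum is first attained at a free square, and comparison
with free squares suffices. Their prefix sums and their relative order are the same for `r` and
`r'`. -/
theorem wordRaise_of_wordRaise {i : ℕ} {U : SkewTableau χ} (r r' : ReadingOrder χ)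
    (h : WordRaise i (T.word r) (U.word r)) : WordRaise i (T.word r') (U.word r') := by
  have hirr : ∀ (r : ReadingOrder χ) y, ¬ r.lt y y := fun r y => lt_irrefl _
  have hasymm : ∀ (r : ReadingOrder χ) y z, r.lt y z → ¬ r.lt z y := fun r y z => lt_asymm
  unfold SkewTableau.word at h ⊢
  rw [wordRaise_map_iff r.cells_eq r.pairwise_lt (hirr r) (hasymm r)] at h
  rw [wordRaise_map_iff r'.cells_eq r'.pairwise_lt (hirr r') (hasymm r')]
  simp only [r.mem_squares] at h
  simp only [r'.mem_squares]
  obtain ⟨x, hx, h1, h2, h3, h4, h5, h6⟩ := h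
  have hf : T.IsFree i x := by
    by_contra hf
    rcases readSum_le_isFree (T := T) (i := i) (w := x) r with h | ⟨y, hy, hyf, rfl | hlt, hle⟩
    · exact absurd h4 (not_lt.2 h)
    · exact hf hyf
    · exact absurd (h5 y hy hlt) (not_lt.2 hle)
  refine ⟨x, hx, h1, h2, h3, ?_, ?_, ?_⟩
  · change 0 < T.readSum r' i x
    rw [← readSum_eq_of_isFree r r' hf hx]
    exact h4
  · intro w hw hwx
    change T.readSum r' i w < T.readSum r' i x
    rcases readSum_le_isFree (T := T) (i := i) (w := w) r' with h | ⟨y, hy, hyf, hyw, hle⟩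
    · rw [← readSum_eq_of_isFree r r' hf hx]
      exact lt_of_le_of_lt h h4
    · refine lt_of_le_of_lt hle ?_
      have hyx : r'.lt y x := by
        rcases hyw with rfl | hyw
        · exact hwx
        · exact lt_trans hyw hwx
      rw [← readSum_eq_of_isFree r r' hf hx, ← readSum_eq_of_isFree r r' hyf hy]
      refine h5 y hy ?_
      have hyi : T.entry y = i ∨ T.entry y = i + 1 := hyf.symm.imp And.left And.left
      have hne : y ≠ x := by rintro rfl; exact lt_irrefl _ hyx
      rcases hf.comparable hx hy hyi with h | h
      · exact r.lt_of_northEast hy hx h.1 h.2 hne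
      · exact absurd (r'.lt_of_northEast hx hy h.1 h.2 hne.symm) (lt_asymm hyx)
  · intro w hw hwx
    change T.readSum r' i w ≤ T.readSum r' i x
    rcases readSum_le_isFree (T := T) (i := i) (w := w) r' with h | ⟨y, hy, hyf, hyw, hle⟩
    · rw [← readSum_eq_of_isFree r r' hf hx]
      exact h.trans h4.le
    · refine hle.trans ?_
      rw [← readSum_eq_of_isFree r r' hf hx, ← readSum_eq_of_isFree r r' hyf hy]
      by_cases hyx : y = x
      · rw [hyx]
      · rcases lt_or_gt_of_ne (fun h => hyx ((List.idxOf_inj ((r.mem_squares y).2 hy)).1 h)) with h | h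
        · exact (h5 y hy h).le
        · exact h6 y hy h

theorem raisingStep_iff {U : SkewTableau χ} (r : ReadingOrder χ) :
    RaisingStep r T U ↔ ∃ i, WordRaise i (T.word χ.semitic) (U.word χ.semitic) :=
  exists_congr fun _ => ⟨wordRaise_of_wordRaise r _, wordRaise_of_wordRaise _ r⟩

end SkewTableau

/-! ### Fillings of the grid and prefix sums of their row reading words

A filling is a function `g : ℕ × ℕ → ℕ`; the value `0` marks an unoccupied square and `v + 1` a
square containing the letter `v`. -/

/-- The contribution of the value `v` of a filling to the excess of `i + 1` over `i`. -/
def gridSign (i v : ℕ) : ℤ := if v = i + 2 then 1 else if v = i + 1 then -1 else 0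

/-- Rows from top to bottom, each row from right to left. -/
def Bef (p q : ℕ × ℕ) : Prop := p.1 < q.1 ∨ (p.1 = q.1 ∧ q.2 < p.2)

instance : DecidableRel Bef := fun _ _ => inferInstanceAs (Decidable (_ ∨ _))

theorem Bef.irrefl (p : ℕ × ℕ) : ¬ Bef p p := by unfold Bef; omega

theorem Bef.asymm (p q : ℕ × ℕ) (h : Bef p q) : ¬ Bef q p := by unfold Bef at *; omega

theorem Bef.trans {p q r : ℕ × ℕ} (h : Bef p q) (h' : Bef q r) : Bef p r := by
  unfold Bef at *; omega

theorem Bef.trichotomy (p q : ℕ × ℕ) : Bef p q ∨ p = q ∨ Bef q p := by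
  obtain ⟨a, b⟩ := p
  obtain ⟨c, d⟩ := q
  simp only [Bef, Prod.mk.injEq]
  omega

/-- The sum of `gridSign` over the squares in the first `N` columns up to and including `p`. -/
def gridSum (i N : ℕ) (g : ℕ × ℕ → ℕ) (p : ℕ × ℕ) : ℤ :=
  ∑ a ∈ Finset.range p.1, ∑ c ∈ Finset.range N, gridSign i (g (a, c)) +
    ∑ c ∈ Finset.range N, if p.2 ≤ c then gridSign i (g (p.1, c)) else 0

theorem gridSum_zero (i N : ℕ) (g : ℕ × ℕ → ℕ) : gridSum i N g (0, N) = 0 := by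
  simp only [gridSum, Finset.range_zero, Finset.sum_empty, zero_add]
  refine Finset.sum_eq_zero fun c hc => if_neg ?_
  simpa using hc

theorem gridSum_row_sub (i N : ℕ) (g : ℕ × ℕ → ℕ) (a b c : ℕ) :
    gridSum i N g (a, b) - gridSum i N g (a, c) = ∑ j ∈ Finset.range N,
      ((if b ≤ j then gridSign i (g (a, j)) else 0) -
        (if c ≤ j then gridSign i (g (a, j)) else 0)) := by
  rw [Finset.sum_sub_distrib]
  simp only [gridSum]
  ring

/-- Collects the letters read between two positions in adjacent rows column by column. The
inequalities below bound each column separately, where strictness relates the two entries. -/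
theorem gridSum_succ_row_sub (i N : ℕ) (g : ℕ × ℕ → ℕ) (a b c : ℕ) :
    gridSum i N g (a + 1, c) - gridSum i N g (a, b) = ∑ j ∈ Finset.range N,
      ((if j < b then gridSign i (g (a, j)) else 0) +
        (if c ≤ j then gridSign i (g (a + 1, j)) else 0)) := by
  have : ∑ j ∈ Finset.range N, gridSign i (g (a, j)) =
      ∑ j ∈ Finset.range N, (if j < b then gridSign i (g (a, j)) else 0) +
        ∑ j ∈ Finset.range N, (if b ≤ j then gridSign i (g (a, j)) else 0) := by
    rw [← Finset.sum_add_distrib]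
    refine Finset.sum_congr rfl fun j _ => ?_
    split_ifs <;> omega
  rw [Finset.sum_add_distrib]
  simp only [gridSum, Finset.sum_range_succ, this]
  ring

theorem gridSum_succ_col (i N : ℕ) (g : ℕ × ℕ → ℕ) (a b : ℕ) (hb : b < N) :
    gridSum i N g (a, b) = gridSum i N g (a, b + 1) + gridSign i (g (a, b)) := by
  rw [← sub_eq_iff_eq_add', gridSum_row_sub]
  rw [Finset.sum_eq_single b]
  · simp
  · intro j _ hj
    split_ifs <;> omega
  · intro h
    simp at h
    omega

theorem gridSum_eq_sum (i N : ℕ) (g : ℕ × ℕ → ℕ) (s : Finset (ℕ × ℕ))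
    (hs : ∀ c, g c ≠ 0 → c ∈ s) (hN : ∀ c ∈ s, c.2 < N) (p : ℕ × ℕ) :
    gridSum i N g p = ∑ y ∈ s with y = p ∨ Bef y p, gridSign i (g y) := by
  have h1 : gridSum i N g p = ∑ y ∈ Finset.range (p.1 + 1) ×ˢ Finset.range N,
      if y = p ∨ Bef y p then gridSign i (g y) else 0 := by
    rw [Finset.sum_product, Finset.sum_range_succ, gridSum]
    congr 1
    · refine Finset.sum_congr rfl fun a ha => Finset.sum_congr rfl fun c _ => ?_
      rw [Finset.mem_range] at ha
      rw [if_pos]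
      exact Or.inr (Or.inl ha)
    · refine Finset.sum_congr rfl fun c _ => ?_
      refine if_congr ?_ rfl rfl
      obtain ⟨p1, p2⟩ := p
      simp only [Bef, Prod.mk.injEq, true_and]
      omega
  rw [h1, ← Finset.sum_filter]
  have hz : ∀ y, gridSign i (g y) ≠ 0 → y ∈ s := by
    intro y hy
    refine hs y fun h => hy ?_
    rw [h, gridSign]
    simp
  rw [← Finset.sum_filter_ne_zero, ← Finset.sum_filter_ne_zero (s.filter _)]
  refine Finset.sum_congr ?_ fun _ _ => rfl
  ext y
  simp only [Finset.mem_filter, Finset.mem_product, Finset.mem_range]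
  constructor
  · rintro ⟨⟨-, h⟩, h'⟩
    exact ⟨⟨hz y h', h⟩, h'⟩
  · rintro ⟨⟨hy, h⟩, h'⟩
    refine ⟨⟨⟨?_, hN y hy⟩, h⟩, h'⟩
    rcases h with rfl | h
    · omega
    · unfold Bef at h; omega

theorem gridSum_update (i N : ℕ) (g : ℕ × ℕ → ℕ) (p : ℕ × ℕ) (hp : p.2 < N) (v : ℕ)
    (w : ℕ × ℕ) : gridSum i N (Function.update g p v) w = gridSum i N g w +
      if p = w ∨ Bef p w then gridSign i v - gridSign i (g p) else 0 := by
  obtain ⟨a, b⟩ := p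
  obtain ⟨c, d⟩ := w
  simp only at hp
  have hrow : ∀ e, ∑ j ∈ Finset.range N, gridSign i (Function.update g (a, b) v (e, j)) =
      ∑ j ∈ Finset.range N, gridSign i (g (e, j)) +
        if e = a then gridSign i v - gridSign i (g (a, b)) else 0 := by
    intro e
    split_ifs with he
    · subst he
      rw [← sub_eq_iff_eq_add', ← Finset.sum_sub_distrib, Finset.sum_eq_single b]
      · simp
      · intro j _ hj
        rw [Function.update_of_ne (by simp [hj]), sub_self]
      · intro h
        simp at h
        omega
    · rw [add_zero]
      refine Finset.sum_congr rfl fun j _ => ?_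
      rw [Function.update_of_ne (by simp [he])]
  simp only [gridSum, hrow, Finset.sum_add_distrib, Finset.sum_ite_eq', Finset.mem_range]
  have hlast : ∑ j ∈ Finset.range N, (if d ≤ j then
      gridSign i (Function.update g (a, b) v (c, j)) else 0) =
      ∑ j ∈ Finset.range N, (if d ≤ j then gridSign i (g (c, j)) else 0) +
        if c = a ∧ d ≤ b then gridSign i v - gridSign i (g (a, b)) else 0 := by
    split_ifs with he
    · obtain ⟨rfl, hd⟩ := he
      rw [← sub_eq_iff_eq_add', ← Finset.sum_sub_distrib, Finset.sum_eq_single b]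
      · simp [hd]
      · intro j _ hj
        rw [Function.update_of_ne (by simp [hj]), sub_self]
      · intro h
        simp at h
        omega
    · rw [add_zero]
      refine Finset.sum_congr rfl fun j _ => ?_
      split_ifs with hj
      · rw [Function.update_of_ne]
        simp only [ne_eq, Prod.mk.injEq]
        omega
      · rfl
  rw [hlast]
  simp only [Bef, Prod.mk.injEq]
  split_ifs <;> omega

/-- `x` carries the letter `i + 1` and is the first position where the prefix sums are maximal. -/
def FirstMax (i N : ℕ) (g : ℕ × ℕ → ℕ) (x : ℕ × ℕ) : Prop :=
  g x = i + 2 ∧ (∀ w, Bef w x → gridSum i N g w < gridSum i N g x) ∧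
    ∀ w, Bef x w → gridSum i N g w ≤ gridSum i N g x

/-! ### Fillings of skew shapes -/

/-- The filling given by a skew tableau. -/
def SkewTableau.grid {χ : SkewShape} (T : SkewTableau χ) (c : ℕ × ℕ) : ℕ :=
  if c ∈ χ.cells then T.entry c + 1 else 0

namespace SkewTableau

variable {χ : SkewShape}

theorem grid_of_mem (T : SkewTableau χ) {c : ℕ × ℕ} (h : c ∈ χ.cells) :
    T.grid c = T.entry c + 1 := if_pos h

theorem grid_ne_zero (T : SkewTableau χ) (c : ℕ × ℕ) : T.grid c ≠ 0 ↔ c ∈ χ.cells := by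
  unfold grid
  split_ifs with h <;> simp [h]

theorem entry_eq_grid (T : SkewTableau χ) : T.entry = fun c => T.grid c - 1 := by
  funext c
  unfold grid
  split_ifs with h
  · simp
  · simpa using T.zeros c h

theorem grid_injective {T U : SkewTableau χ} (h : T.grid = U.grid) : T = U := by
  ext c
  rw [T.entry_eq_grid, U.entry_eq_grid, h]

theorem grid_row (T : SkewTableau χ) {a b b' : ℕ} (h : b < b') (h1 : T.grid (a, b) ≠ 0)
    (h2 : T.grid (a, b') ≠ 0) : T.grid (a, b) ≤ T.grid (a, b') := by
  rw [grid_ne_zero] at h1 h2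
  rw [grid_of_mem T h1, grid_of_mem T h2]
  have := T.row_weak a b b' h h1 h2
  omega

theorem grid_col (T : SkewTableau χ) {a a' b : ℕ} (h : a < a') (h1 : T.grid (a, b) ≠ 0)
    (h2 : T.grid (a', b) ≠ 0) : T.grid (a, b) < T.grid (a', b) := by
  rw [grid_ne_zero] at h1 h2
  rw [grid_of_mem T h1, grid_of_mem T h2]
  have := T.col_strict a a' b h h1 h2
  omega

theorem exists_grid_eq (χ : SkewShape) (g : ℕ × ℕ → ℕ) (hdom : ∀ c, g c ≠ 0 ↔ c ∈ χ.cells)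
    (hrow : ∀ a b b', b < b' → g (a, b) ≠ 0 → g (a, b') ≠ 0 → g (a, b) ≤ g (a, b'))
    (hcol : ∀ a a' b, a < a' → g (a, b) ≠ 0 → g (a', b) ≠ 0 → g (a, b) < g (a', b)) :
    ∃ T : SkewTableau χ, T.grid = g := by
  refine ⟨⟨fun c => g c - 1, ?_, ?_, ?_⟩, ?_⟩
  · intro a b b' h h1 h2
    have := hrow a b b' h ((hdom _).2 h1) ((hdom _).2 h2)
    omega
  · intro a a' b h h1 h2
    have := hcol a a' b h ((hdom _).2 h1) ((hdom _).2 h2)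
    have := (hdom _).2 h1
    omega
  · intro c hc
    rw [← hdom, not_not] at hc
    simp [hc]
  · funext c
    unfold grid
    have := hdom c
    split_ifs with h
    · have := (hdom c).2 h
      simp only
      omega
    · rw [← hdom, not_not] at h
      exact h.symm

theorem mem_cells_snd_lt {c : ℕ × ℕ} (h : c ∈ χ.cells) : c.2 < χ.outer.rowLen 0 := by
  rw [SkewShape.mem_cells] at h
  rw [← YoungDiagram.mem_iff_lt_rowLen]
  exact χ.outer.up_left_mem (Nat.zero_le _) le_rfl h.1

theorem mem_cells_fst_lt {c : ℕ × ℕ} (h : c ∈ χ.cells) : c.1 < χ.outer.colLen 0 := by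
  rw [SkewShape.mem_cells] at h
  rw [← YoungDiagram.mem_iff_lt_colLen]
  exact χ.outer.up_left_mem le_rfl (Nat.zero_le _) h.1

theorem pairwise_bef_semitic (χ : SkewShape) : χ.semitic.squares.Pairwise Bef := by
  change ((List.range (χ.outer.colLen 0)).flatMap χ.revRow).Pairwise Bef
  rw [List.pairwise_flatMap]
  refine ⟨fun i _ => ?_, ?_⟩
  · have := (χ.pairwise_revRow i)
    refine List.Pairwise.imp_of_mem ?_ this
    intro s t hs ht h
    exact Or.inr ⟨((χ.mem_revRow i s).1 hs).1.trans ((χ.mem_revRow i t).1 ht).1.symm, h⟩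
  · refine List.pairwise_lt_range.imp ?_
    intro a b hab s hs t ht
    have h1 := ((χ.mem_revRow a s).1 hs).1
    have h2 := ((χ.mem_revRow b t).1 ht).1
    left
    omega

variable (T : SkewTableau χ)

/-- The prefix sums of the row reading word of `T`. -/
abbrev rowSum (i : ℕ) (p : ℕ × ℕ) : ℤ := gridSum i (χ.outer.rowLen 0) T.grid p

variable {T}

theorem rowSum_eq_posSum (i : ℕ) (p : ℕ × ℕ) :
    T.rowSum i p = posSum Bef χ.cells T.entry i p := by
  rw [rowSum, gridSum_eq_sum i _ _ χ.cells (fun c => (T.grid_ne_zero c).1)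
    (fun c => mem_cells_snd_lt), posSum]
  refine Finset.sum_congr rfl fun y hy => ?_
  rw [grid_of_mem T (Finset.mem_filter.1 hy).1, gridSign, letterSign]
  split_ifs <;> omega

/-- The last occupied square up to `w` has the same prefix sum. Thus all positions of the grid can
be used in comparisons, which matters when the empty square moves and the shape changes. -/
theorem rowSum_eq_zero_or (i : ℕ) (w : ℕ × ℕ) :
    T.rowSum i w = 0 ∨ ∃ y ∈ χ.cells, (y = w ∨ Bef y w) ∧ T.rowSum i w = T.rowSum i y := by
  by_cases hne : (χ.cells.filter fun y => y = w ∨ Bef y w).Nonempty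
  · right
    obtain ⟨y, hy, hmax⟩ := Finset.exists_max_image _
      (fun p : ℕ × ℕ => toLex (p.1, OrderDual.toDual p.2)) hne
    simp only [Finset.mem_filter] at hy hmax
    refine ⟨y, hy.1, hy.2, ?_⟩
    rw [rowSum_eq_posSum, rowSum_eq_posSum, posSum, posSum]
    refine Finset.sum_congr ?_ fun _ _ => rfl
    ext z
    simp only [Finset.mem_filter, and_congr_right_iff]
    intro hz
    constructor
    · intro hzw
      have := hmax z ⟨hz, hzw⟩
      rw [Prod.Lex.toLex_le_toLex] at this
      simp only [OrderDual.toDual_le_toDual] at this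
      obtain ⟨z1, z2⟩ := z
      obtain ⟨y1, y2⟩ := y
      simp only [Bef, Prod.mk.injEq] at *
      omega
    · rintro (rfl | h)
      · exact hy.2
      · rcases hy.2 with rfl | h'
        · exact Or.inr h
        · exact Or.inr (h.trans h')
  · left
    rw [Finset.not_nonempty_iff_eq_empty] at hne
    rw [rowSum_eq_posSum, posSum, hne, Finset.sum_empty]

theorem dominant_iff_rowSum (i : ℕ) :
    WordDominantFor i (T.word χ.semitic) ↔ ∀ w, T.rowSum i w ≤ 0 := by
  rw [SkewTableau.word, wordDominantFor_map_iff χ.semitic.cells_eq (pairwise_bef_semitic χ)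
    Bef.irrefl Bef.asymm]
  simp only [χ.semitic.mem_squares, ← rowSum_eq_posSum]
  constructor
  · intro h w
    rcases rowSum_eq_zero_or (T := T) i w with h' | ⟨y, hy, -, h'⟩
    · exact h'.le
    · exact h' ▸ h y hy
  · exact fun h w _ => h w

/-- The position `(R, 0)` comes after all squares, so its prefix sum is the total. The position `(0,
χ.outer.rowLen 0)` stands for the empty prefix. -/
theorem antiDominant_iff_rowSum (i : ℕ) {R : ℕ} (hR : ∀ c ∈ χ.cells, c.1 < R) :
    WordAntiDominantFor i (T.word χ.semitic) ↔
      ∀ w, T.rowSum i w ≤ T.rowSum i (R, 0) := by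
  rw [SkewTableau.word, wordAntiDominantFor_map_iff χ.semitic.cells_eq (pairwise_bef_semitic χ)
    Bef.irrefl Bef.asymm]
  have htot : ∑ y ∈ χ.cells, letterSign i (T.entry y) = T.rowSum i (R, 0) := by
    rw [rowSum_eq_posSum, posSum]
    refine Finset.sum_congr ?_ fun _ _ => rfl
    ext y
    simp only [Finset.mem_filter, iff_self_and]
    exact fun hy => Or.inr (Or.inl (hR y hy))
  rw [htot]
  simp only [χ.semitic.mem_squares, ← rowSum_eq_posSum]
  constructor
  · rintro ⟨h0, h⟩ w
    rcases rowSum_eq_zero_or (T := T) i w with h' | ⟨y, hy, -, h'⟩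
    · exact h'.le.trans h0
    · exact h' ▸ h y hy
  · intro h
    refine ⟨?_, fun w _ => h w⟩
    have := h (0, χ.outer.rowLen 0)
    rwa [rowSum, gridSum_zero] at this

/-- `FirstMax` needs no positivity clause: `(0, χ.outer.rowLen 0)` precedes `x` and has prefix sum
0. The filling `f` is arbitrary because the lemma is applied before the raised filling is known to
be a tableau. -/
theorem wordRaise_map_grid_iff (i : ℕ) (f : ℕ × ℕ → ℕ) :
    WordRaise i (T.word χ.semitic) (χ.semitic.squares.map f) ↔
      ∃ x ∈ χ.cells, FirstMax i (χ.outer.rowLen 0) T.grid x ∧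
        ∀ y ∈ χ.cells, f y = Function.update T.entry x i y := by
  rw [SkewTableau.word, wordRaise_map_iff χ.semitic.cells_eq (pairwise_bef_semitic χ)
    Bef.irrefl Bef.asymm]
  simp only [χ.semitic.mem_squares, ← rowSum_eq_posSum]
  refine exists_congr fun x => and_congr_right fun hx => ?_
  constructor
  · rintro ⟨h1, h2, h3, h4, h5, h6⟩
    refine ⟨⟨?_, ?_, ?_⟩, ?_⟩
    · rw [grid_of_mem T hx, h1]
    · intro w hw
      rcases rowSum_eq_zero_or (T := T) i w with h' | ⟨y, hy, hyw, h'⟩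
      · exact h'.le.trans_lt h4
      · refine h'.le.trans_lt (h5 y hy ?_)
        rcases hyw with rfl | hyw
        · exact hw
        · exact hyw.trans hw
    · intro w hw
      rcases rowSum_eq_zero_or (T := T) i w with h' | ⟨y, hy, hyw, h'⟩
      · exact h'.le.trans h4.le
      · refine h'.le.trans ?_
        rcases Bef.trichotomy x y with h | rfl | h
        · exact h6 y hy h
        · exact le_rfl
        · exact (h5 y hy h).le
    · intro y hy
      by_cases hyx : y = x
      · subst hyx
        rw [Function.update_self, h2]
      · rw [Function.update_of_ne hyx, h3 y hy hyx]
  · rintro ⟨⟨h1, h2, h3⟩, h4⟩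
    rw [grid_of_mem T hx] at h1
    refine ⟨by omega, by rw [h4 x hx, Function.update_self], ?_, ?_, ?_, ?_⟩
    · intro y hy hyx
      rw [h4 y hy, Function.update_of_ne hyx]
    · have hb : Bef (0, χ.outer.rowLen 0) x := by
        have := mem_cells_snd_lt hx
        unfold Bef
        simp only
        omega
      have := h2 _ hb
      rwa [gridSum_zero] at this
    · exact fun y _ => h2 y
    · exact fun y _ => h3 y

theorem mem_of_firstMax {i N : ℕ} {x : ℕ × ℕ} (h : FirstMax i N T.grid x) : x ∈ χ.cells := by
  rw [← T.grid_ne_zero, h.1]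
  omega

theorem wordRaise_iff_grid {U : SkewTableau χ} (i : ℕ) :
    WordRaise i (T.word χ.semitic) (U.word χ.semitic) ↔
      ∃ x, FirstMax i (χ.outer.rowLen 0) T.grid x ∧
        U.grid = Function.update T.grid x (i + 1) := by
  rw [SkewTableau.word.eq_def U, wordRaise_map_grid_iff]
  have key : ∀ x ∈ χ.cells, (∀ y ∈ χ.cells, U.entry y = Function.update T.entry x i y) ↔
      U.grid = Function.update T.grid x (i + 1) := by
    intro x hx
    rw [funext_iff]
    refine forall_congr' fun y => ?_
    by_cases hyx : y = x
    · subst hyx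
      simp [hx, grid_of_mem U hx]
    · rw [Function.update_of_ne hyx, Function.update_of_ne hyx]
      unfold grid
      split_ifs with h <;> simp [h]
  constructor
  · rintro ⟨x, hx, h1, h2⟩
    exact ⟨x, h1, (key x hx).1 h2⟩
  · rintro ⟨x, h1, h2⟩
    exact ⟨x, mem_of_firstMax h1, h1, (key x (mem_of_firstMax h1)).2 h2⟩

end SkewTableau

/-! ### Existence of raised and lowered tableaux -/

theorem gridSign_add_two (i : ℕ) : gridSign i (i + 2) = 1 := by simp [gridSign]

theorem gridSign_add_one (i : ℕ) : gridSign i (i + 1) = -1 := by simp [gridSign]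

theorem gridSign_zero (i : ℕ) : gridSign i 0 = 0 := by simp [gridSign]

theorem gridSign_nonneg {i v : ℕ} (h : v ≠ i + 1) : 0 ≤ gridSign i v := by
  unfold gridSign; split_ifs <;> simp

theorem gridSign_nonpos {i v : ℕ} (h : v ≠ i + 2) : gridSign i v ≤ 0 := by
  unfold gridSign; split_ifs <;> simp_all

theorem neg_one_le_gridSign (i v : ℕ) : -1 ≤ gridSign i v := by
  unfold gridSign; split_ifs <;> simp

theorem gridSign_le_one (i v : ℕ) : gridSign i v ≤ 1 := by
  unfold gridSign; split_ifs <;> simp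

theorem exists_end_of_run {g : ℕ × ℕ → ℕ} {N : ℕ} (hN : ∀ a c, N ≤ c → g (a, c) = 0) (a b v : ℕ) :
    ∃ c, b < c ∧ g (a, c) ≠ v + 1 ∧ ∀ j, b < j → j < c → g (a, j) = v + 1 := by
  classical
  have hex : ∃ c, b < c ∧ g (a, c) ≠ v + 1 := by
    refine ⟨b + N + 1, by omega, ?_⟩
    rw [hN a _ (by omega)]
    omega
  obtain ⟨h1, h2⟩ := Nat.find_spec hex
  refine ⟨Nat.find hex, h1, h2, fun j hj hj' => ?_⟩
  by_contra hne
  exact Nat.find_min hex hj' ⟨hj, hne⟩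

theorem exists_first_in_row {g : ℕ × ℕ → ℕ} {a b v : ℕ} (h : g (a, b) = v) :
    ∃ c ≤ b, g (a, c) = v ∧ ∀ j < c, g (a, j) ≠ v := by
  classical
  have hex : ∃ c, g (a, c) = v := ⟨b, h⟩
  exact ⟨Nat.find hex, Nat.find_min' hex h, Nat.find_spec hex, fun j hj => Nat.find_min hex hj⟩

theorem List.exists_map_eq_of_nodup {α β : Type} [DecidableEq α] [Inhabited β] {l : List α}
    (hl : l.Nodup) {w : List β} (h : w.length = l.length) : ∃ f : α → β, l.map f = w := by
  refine ⟨fun y => w.getD (l.idxOf y) default, ?_⟩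
  refine List.ext_getElem (by simp [h]) fun k h1 h2 => ?_
  rw [List.getElem_map, hl.idxOf_getElem, List.getD_eq_getElem]

theorem WordRaise.length_eq {i : ℕ} {w w' : List ℕ} (h : WordRaise i w w') :
    w.length = w'.length := by
  obtain ⟨u, v, -, -, rfl, rfl⟩ := h
  simp

namespace SkewTableau

variable {χ : SkewShape} {T : SkewTableau χ}

theorem grid_ne_zero_of_between {a b c d e f : ℕ} (h1 : T.grid (a, b) ≠ 0)
    (h2 : T.grid (c, d) ≠ 0) (ha : a ≤ e) (hb : b ≤ f) (hc : e ≤ c) (hd : f ≤ d) :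
    T.grid (e, f) ≠ 0 := by
  rw [grid_ne_zero] at *
  exact χ.mem_cells_of_between h1 h2 ha hb hc hd

theorem grid_row_le {a b b' : ℕ} (h : b ≤ b') (h1 : T.grid (a, b) ≠ 0)
    (h2 : T.grid (a, b') ≠ 0) : T.grid (a, b) ≤ T.grid (a, b') := by
  rcases h.eq_or_lt with rfl | h
  · exact le_rfl
  · exact T.grid_row h h1 h2

theorem grid_eq_zero_of_le {a c : ℕ} (h : χ.outer.rowLen 0 ≤ c) : T.grid (a, c) = 0 := by
  by_contra hne
  have := mem_cells_snd_lt ((T.grid_ne_zero _).1 hne)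
  simp only at this
  omega

/-- Otherwise follow the run of letters `i` in row `a` from column `b` up to `c`. Each of them
cancels at most one `i + 1` below, and beyond the run strictness excludes `i + 1` from row `a + 1`.
The prefix sum at `(a + 1, b)` then does not exceed the earlier one at `(a, c)`. -/
theorem above_ne_of_firstMax {i a b : ℕ}
    (hx : FirstMax i (χ.outer.rowLen 0) T.grid (a + 1, b)) : T.grid (a, b) ≠ i + 1 := by
  intro hab
  obtain ⟨c, hbc, hc, hrun⟩ := exists_end_of_run (fun a c => T.grid_eq_zero_of_le (a := a)) a b i
  have h1 := hx.2.1 (a, c) (Or.inl (Nat.lt_add_one a))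
  have h2 : gridSum i (χ.outer.rowLen 0) T.grid (a + 1, b) -
      gridSum i (χ.outer.rowLen 0) T.grid (a, c) ≤ 0 := by
    rw [gridSum_succ_row_sub]
    refine Finset.sum_nonpos fun j _ => ?_
    rcases lt_or_ge j b with hj | hj
    · rw [if_pos (by omega), if_neg (by omega), add_zero]
      refine gridSign_nonpos fun h => ?_
      have := T.grid_row hj (by omega) (show T.grid (a, b) ≠ 0 by omega)
      omega
    · rw [if_pos hj]
      rcases lt_or_ge j c with hj' | hj'
      · have : T.grid (a, j) = i + 1 := by
          rcases hj.eq_or_lt with rfl | hj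
          · exact hab
          · exact hrun j hj hj'
        rw [if_pos hj', this, gridSign_add_one]
        have := gridSign_le_one i (T.grid (a + 1, j))
        omega
      · rw [if_neg (by omega), zero_add]
        refine gridSign_nonpos fun h => ?_
        have hb0 : T.grid (a, b) ≠ 0 := by omega
        have hj0 : T.grid (a + 1, j) ≠ 0 := by omega
        have h3 : T.grid (a, j) ≠ 0 :=
          grid_ne_zero_of_between hb0 hj0 le_rfl hj (by omega) le_rfl
        have h4 : T.grid (a, c) ≠ 0 :=
          grid_ne_zero_of_between hb0 h3 le_rfl (by omega) le_rfl hj'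
        have h5 := T.grid_row hbc hb0 h4
        have h6 := grid_row_le hj' h4 h3
        have h7 := T.grid_col (Nat.lt_add_one a) h3 hj0
        omega
  omega

/-- An `i + 1` on the left is read next and would produce a larger prefix sum. -/
theorem left_ne_of_firstMax {i a b : ℕ}
    (hx : FirstMax i (χ.outer.rowLen 0) T.grid (a, b + 1)) : T.grid (a, b) ≠ i + 2 := by
  intro hab
  have h1 := hx.2.2 (a, b) (Or.inr ⟨rfl, Nat.lt_add_one b⟩)
  have hb : b < χ.outer.rowLen 0 := by
    by_contra hcon
    rw [grid_eq_zero_of_le (by omega)] at hab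
    omega
  rw [gridSum_succ_col _ _ _ _ _ hb, hab, gridSign_add_two] at h1
  omega

/-- Decreasing one entry can violate only the inequalities with its left and upper neighbours. The
two lemmas above exclude the neighbours for which this happens. -/
theorem exists_raise {i : ℕ} (h : ¬ WordDominantFor i (T.word χ.semitic)) :
    ∃ U : SkewTableau χ, WordRaise i (T.word χ.semitic) (U.word χ.semitic) := by
  obtain ⟨w', hw⟩ := exists_wordRaise_from h
  obtain ⟨f, rfl⟩ := List.exists_map_eq_of_nodup χ.semitic.nodup (w := w')
    (by rw [← hw.length_eq, SkewTableau.word, List.length_map])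
  obtain ⟨⟨a, b⟩, hx, hmax, -⟩ := (wordRaise_map_grid_iff i f).1 hw
  have hgx := hmax.1
  have hex : ∃ U : SkewTableau χ, U.grid = Function.update T.grid (a, b) (i + 1) := by
    refine exists_grid_eq χ _ ?_ ?_ ?_
    · intro c
      by_cases hc : c = (a, b)
      · subst hc
        simp [hx]
      · rw [Function.update_of_ne hc, grid_ne_zero]
    · intro e f f' hlt
      by_cases h1 : (e, f) = (a, b)
      · obtain ⟨rfl, rfl⟩ := Prod.mk.inj h1
        rw [Function.update_self, Function.update_of_ne (by simp; omega)]
        intro _ h2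
        have := T.grid_row hlt (by omega) h2
        omega
      · rw [Function.update_of_ne h1]
        by_cases h2 : (e, f') = (a, b)
        · obtain ⟨rfl, rfl⟩ := Prod.mk.inj h2
          rw [Function.update_self]
          intro h3 _
          have h4 := T.grid_row hlt h3 (by omega)
          obtain ⟨k, rfl⟩ : ∃ k, f' = k + 1 := ⟨f' - 1, by omega⟩
          have h5 : T.grid (e, k) ≠ 0 := grid_ne_zero_of_between h3
            (show T.grid (e, k + 1) ≠ 0 by omega) le_rfl (by omega) le_rfl (by omega)
          have h6 := grid_row_le (show f ≤ k by omega) h3 h5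
          have h7 := T.grid_row (Nat.lt_add_one k) h5 (by omega)
          have h8 := left_ne_of_firstMax hmax
          omega
        · rw [Function.update_of_ne h2]
          exact T.grid_row hlt
    · intro e e' f hlt
      by_cases h1 : (e, f) = (a, b)
      · obtain ⟨rfl, rfl⟩ := Prod.mk.inj h1
        rw [Function.update_self, Function.update_of_ne (by simp; omega)]
        intro _ h2
        have := T.grid_col hlt (by omega) h2
        omega
      · rw [Function.update_of_ne h1]
        by_cases h2 : (e', f) = (a, b)
        · obtain ⟨rfl, rfl⟩ := Prod.mk.inj h2
          rw [Function.update_self]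
          intro h3 _
          have h4 := T.grid_col hlt h3 (by omega)
          obtain ⟨k, rfl⟩ : ∃ k, e' = k + 1 := ⟨e' - 1, by omega⟩
          have h8 := above_ne_of_firstMax hmax
          rcases (show e ≤ k by omega).eq_or_lt with rfl | hek
          · omega
          · have h5 : T.grid (k, f) ≠ 0 := grid_ne_zero_of_between h3
              (show T.grid (k + 1, f) ≠ 0 by omega) hek.le le_rfl (by omega) le_rfl
            have h6 := T.grid_col hek h3 h5
            have h7 := T.grid_col (Nat.lt_add_one k) h5 (by omega)
            omega
        · rw [Function.update_of_ne h2]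
          exact T.grid_col hlt
  obtain ⟨U, hU⟩ := hex
  exact ⟨U, (wordRaise_iff_grid i).2 ⟨_, hmax, hU⟩⟩

/-- `x` carries the letter `i` and follows the last position where the prefix sums are maximal. -/
def LastMax (i N : ℕ) (g : ℕ × ℕ → ℕ) (x : ℕ × ℕ) : Prop :=
  g x = i + 1 ∧ (∀ w, Bef w x → gridSum i N g w ≤ gridSum i N g x + 1) ∧
    ∀ w, Bef x w → gridSum i N g w ≤ gridSum i N g x

/-- Otherwise take the leftmost `i + 1` of row `a + 1`, in column `c`. Column by column the letters
`i + 1` from there on outweigh the letters `i` read after `(a, b + 1)`, so the maximum attained at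
`(a, b + 1)` recurs after `x`. -/
theorem below_ne_of_lastMax {i a b : ℕ}
    (hx : LastMax i (χ.outer.rowLen 0) T.grid (a, b)) : T.grid (a + 1, b) ≠ i + 2 := by
  intro hab
  have hgx := hx.1
  obtain ⟨c, hcb, hc, hlt⟩ := exists_first_in_row hab
  have h1 := hx.2.2 (a + 1, c) (Or.inl (Nat.lt_add_one a))
  have hb : b < χ.outer.rowLen 0 := by
    by_contra hcon
    rw [grid_eq_zero_of_le (by omega)] at hab
    omega
  have hb0 : T.grid (a + 1, b) ≠ 0 := by omega
  have h2 : 0 ≤ gridSum i (χ.outer.rowLen 0) T.grid (a + 1, c) -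
      gridSum i (χ.outer.rowLen 0) T.grid (a, b + 1) := by
    rw [gridSum_succ_row_sub]
    refine Finset.sum_nonneg fun j _ => ?_
    rcases lt_or_ge j c with hj | hj
    · rw [if_pos (by omega), if_neg (by omega), add_zero]
      refine gridSign_nonneg fun h => ?_
      have h3 : T.grid (a, j) ≠ 0 := by omega
      have h4 : T.grid (a + 1, j) ≠ 0 :=
        grid_ne_zero_of_between h3 hb0 (by omega) le_rfl le_rfl (by omega)
      have h5 := T.grid_row (show j < b by omega) h4 hb0
      have h6 := T.grid_col (Nat.lt_add_one a) h3 h4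
      have := hlt j hj
      omega
    · rw [if_pos hj]
      rcases lt_or_ge j (b + 1) with hj' | hj'
      · have h4 : T.grid (a + 1, j) ≠ 0 :=
          grid_ne_zero_of_between (show T.grid (a + 1, c) ≠ 0 by omega) hb0 (by omega) hj le_rfl
            (by omega)
        have h5 := grid_row_le hj (by omega) h4
        have h6 := grid_row_le (show j ≤ b by omega) h4 hb0
        have h7 : T.grid (a + 1, j) = i + 2 := by omega
        rw [if_pos hj', h7, gridSign_add_two]
        have := neg_one_le_gridSign i (T.grid (a, j))
        omega
      · rw [if_neg (by omega), zero_add]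
        refine gridSign_nonneg fun h => ?_
        have := T.grid_row (show b < j by omega) hb0 (by omega)
        omega
  have h3 := gridSum_succ_col i _ T.grid a b hb
  rw [hx.1, gridSign_add_one] at h3
  omega

theorem right_ne_of_lastMax {i a b : ℕ}
    (hx : LastMax i (χ.outer.rowLen 0) T.grid (a, b)) : T.grid (a, b + 1) ≠ i + 1 := by
  intro hab
  have h1 := hx.2.1 (a, b + 1 + 1) (Or.inr ⟨rfl, by simp only; omega⟩)
  have hb : b + 1 < χ.outer.rowLen 0 := by
    by_contra hcon
    rw [grid_eq_zero_of_le (by omega)] at hab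
    omega
  have h2 := gridSum_succ_col i _ T.grid a (b + 1) hb
  have h3 := gridSum_succ_col i (χ.outer.rowLen 0) T.grid a b (by omega)
  rw [hab, gridSign_add_one] at h2
  rw [hx.1, gridSign_add_one] at h3
  omega

theorem rowSum_update_succ {i : ℕ} {x : ℕ × ℕ} (hx : x ∈ χ.cells) (h : T.entry x = i)
    {f : ℕ × ℕ → ℕ} (hfx : f x = i + 1) (hf : ∀ y ∈ χ.cells, y ≠ x → T.entry y = f y)
    (w : ℕ × ℕ) : posSum Bef χ.cells f i w =
      T.rowSum i w + if x = w ∨ Bef x w then 2 else 0 := by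
  rw [rowSum_eq_posSum, posSum, posSum, Finset.sum_filter, Finset.sum_filter,
    ← sub_eq_iff_eq_add', ← Finset.sum_sub_distrib, Finset.sum_eq_single x]
  · split_ifs
    · rw [h, hfx, letterSign_succ, letterSign_self]
      norm_num
    · rfl
  · intro y hy hyx
    rw [hf y hy hyx, sub_self]
  · exact fun h => absurd hx h

/-- The lowered filling `f` has its first maximum at the changed square. Its sums exceed those of
`T` by 2 from there on, which translates into `LastMax` for `T`. Only the right and lower neighbours
could then be in the way. -/
theorem exists_lower {i : ℕ} (h : ¬ WordAntiDominantFor i (T.word χ.semitic)) :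
    ∃ U : SkewTableau χ, WordRaise i (U.word χ.semitic) (T.word χ.semitic) := by
  obtain ⟨w', hw⟩ := exists_wordRaise_to h
  obtain ⟨f, rfl⟩ := List.exists_map_eq_of_nodup χ.semitic.nodup (w := w')
    (by rw [hw.length_eq, SkewTableau.word, List.length_map])
  have hw' := hw
  rw [SkewTableau.word, wordRaise_map_iff χ.semitic.cells_eq (pairwise_bef_semitic χ)
    Bef.irrefl Bef.asymm] at hw
  simp only [χ.semitic.mem_squares] at hw
  obtain ⟨⟨a, b⟩, hx, hfx, hTx, hTf, h0, h1, h2⟩ := hw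
  have hsum := rowSum_update_succ hx hTx hfx hTf
  have hmax : LastMax i (χ.outer.rowLen 0) T.grid (a, b) := by
    rw [hsum, if_pos (Or.inl rfl)] at h0
    refine ⟨by rw [grid_of_mem T hx, hTx], fun w hw => ?_, fun w hw => ?_⟩
    · rcases rowSum_eq_zero_or (T := T) i w with h' | ⟨y, hy, hyw, h'⟩
      · change T.rowSum i w ≤ T.rowSum i (a, b) + 1
        omega
      · have hyx : Bef y (a, b) := by
          rcases hyw with rfl | hyw
          · exact hw
          · exact hyw.trans hw
        have h3 := h1 y hy hyx
        rw [hsum, hsum, if_pos (Or.inl rfl), if_neg] at h3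
        · change T.rowSum i w ≤ T.rowSum i (a, b) + 1
          omega
        · rintro (h | h)
          · exact Bef.irrefl _ (h ▸ hyx)
          · exact Bef.asymm _ _ h hyx
    -- As `w` may be unoccupied, pass to the last square of the shape up to `w`; `(a, b)` shows that
    -- there is one.
    · let s := χ.cells.filter fun y => y = w ∨ Bef y w
      have hle : posSum Bef χ.cells f i w ≤ posSum Bef χ.cells f i (a, b) := by
        obtain ⟨y, hy, hmaxy⟩ := Finset.exists_max_image s
          (fun p : ℕ × ℕ => toLex (p.1, OrderDual.toDual p.2))
          ⟨(a, b), Finset.mem_filter.2 ⟨hx, Or.inr hw⟩⟩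
        simp only [s, Finset.mem_filter] at hy hmaxy
        have hyw : posSum Bef χ.cells f i w = posSum Bef χ.cells f i y := by
          refine Finset.sum_congr ?_ fun _ _ => rfl
          ext z
          simp only [Finset.mem_filter, and_congr_right_iff]
          intro hz
          constructor
          · intro hzw
            have := hmaxy z ⟨hz, hzw⟩
            rw [Prod.Lex.toLex_le_toLex] at this
            simp only [OrderDual.toDual_le_toDual] at this
            obtain ⟨z1, z2⟩ := z
            obtain ⟨y1, y2⟩ := y
            simp only [Bef, Prod.mk.injEq] at *
            omega
          · rintro (rfl | h)
            · exact hy.2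
            · rcases hy.2 with rfl | h'
              · exact Or.inr h
              · exact Or.inr (h.trans h')
        rw [hyw]
        rcases Bef.trichotomy (a, b) y with h | rfl | h
        · exact h2 y hy.1 h
        · exact le_rfl
        · exact (h1 y hy.1 h).le
      rw [hsum, hsum, if_pos (Or.inl rfl), if_pos (Or.inr hw)] at hle
      have : T.rowSum i w ≤ T.rowSum i (a, b) := by omega
      exact this
  have hgx := hmax.1
  have hex : ∃ U : SkewTableau χ, U.grid = Function.update T.grid (a, b) (i + 2) := by
    refine exists_grid_eq χ _ ?_ ?_ ?_
    · intro c
      by_cases hc : c = (a, b)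
      · subst hc
        simp [hx]
      · rw [Function.update_of_ne hc, grid_ne_zero]
    · intro e f f' hlt
      by_cases h1 : (e, f) = (a, b)
      · obtain ⟨rfl, rfl⟩ := Prod.mk.inj h1
        rw [Function.update_self, Function.update_of_ne (by simp; omega)]
        intro _ h2
        have h4 := T.grid_row hlt (by omega) h2
        have h5 : T.grid (e, f + 1) ≠ 0 := grid_ne_zero_of_between
            (show T.grid (e, f) ≠ 0 by omega) h2 le_rfl (by omega) le_rfl (by omega)
        have h6 := grid_row_le (show f + 1 ≤ f' by omega) h5 h2
        have h7 := T.grid_row (Nat.lt_add_one f) (by omega) h5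
        have h8 := right_ne_of_lastMax hmax
        omega
      · rw [Function.update_of_ne h1]
        by_cases h2 : (e, f') = (a, b)
        · obtain ⟨rfl, rfl⟩ := Prod.mk.inj h2
          rw [Function.update_self]
          intro h3 _
          have h4 := T.grid_row hlt h3 (by omega)
          omega
        · rw [Function.update_of_ne h2]
          exact T.grid_row hlt
    · intro e e' f hlt
      by_cases h1 : (e, f) = (a, b)
      · obtain ⟨rfl, rfl⟩ := Prod.mk.inj h1
        rw [Function.update_self, Function.update_of_ne (by simp; omega)]
        intro _ h2
        have h4 := T.grid_col hlt (by omega) h2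
        have h8 := below_ne_of_lastMax hmax
        rcases (show e + 1 ≤ e' by omega).eq_or_lt with rfl | hek
        · omega
        · have h5 : T.grid (e + 1, f) ≠ 0 := grid_ne_zero_of_between
            (show T.grid (e, f) ≠ 0 by omega) h2 (by omega) le_rfl (by omega) le_rfl
          have h6 := T.grid_col hek h5 h2
          have h7 := T.grid_col (Nat.lt_add_one e) (by omega) h5
          omega
      · rw [Function.update_of_ne h1]
        by_cases h2 : (e', f) = (a, b)
        · obtain ⟨rfl, rfl⟩ := Prod.mk.inj h2
          rw [Function.update_self]
          intro h3 _
          have h4 := T.grid_col hlt h3 (by omega)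
          omega
        · rw [Function.update_of_ne h2]
          exact T.grid_col hlt
  obtain ⟨U, hU⟩ := hex
  refine ⟨U, ?_⟩
  have : U.word χ.semitic = χ.semitic.squares.map f := by
    refine List.map_congr_left fun y hy => ?_
    rw [χ.semitic.mem_squares] at hy
    have hy' := congrFun hU y
    rw [grid_of_mem U hy] at hy'
    by_cases hyx : y = (a, b)
    · subst hyx
      rw [Function.update_self] at hy'
      omega
    · rw [Function.update_of_ne hyx, grid_of_mem T hy, hTf y hy hyx] at hy'
      omega
  rw [this]
  exact hw'

end SkewTableau

/-! ### Punctured tableaux and the moves of an inward slide -/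

/-- A filling of the squares of `lam / inn` other than `h` that is weakly increasing along rows and
strictly increasing down columns. -/
structure Punct (lam inn : YoungDiagram) (h : ℕ × ℕ) (g : ℕ × ℕ → ℕ) : Prop where
  mem : h ∈ lam
  notMem : h ∉ inn
  dom : ∀ c, g c ≠ 0 ↔ c ∈ lam ∧ c ∉ inn ∧ c ≠ h
  row : ∀ a b b', b < b' → g (a, b) ≠ 0 → g (a, b') ≠ 0 → g (a, b) ≤ g (a, b')
  col : ∀ a a' b, a < a' → g (a, b) ≠ 0 → g (a', b) ≠ 0 → g (a, b) < g (a', b)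

/-- Move the value at `q` to `p`. -/
def shift (g : ℕ × ℕ → ℕ) (p q : ℕ × ℕ) : ℕ × ℕ → ℕ :=
  Function.update (Function.update g p (g q)) q 0

/-- The moves of an inward slide in terms of fillings. -/
inductive GridMove : (ℕ × ℕ) × (ℕ × ℕ → ℕ) → (ℕ × ℕ) × (ℕ × ℕ → ℕ) → Prop
  | up (a b : ℕ) (g : ℕ × ℕ → ℕ) (h0 : g (a + 1, b) ≠ 0)
      (hle : g (a, b + 1) ≠ 0 → g (a + 1, b) ≤ g (a, b + 1)) :
      GridMove ((a, b), g) ((a + 1, b), shift g (a, b) (a + 1, b))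
  | left (a b : ℕ) (g : ℕ × ℕ → ℕ) (h0 : g (a, b + 1) ≠ 0)
      (hlt : g (a + 1, b) ≠ 0 → g (a, b + 1) < g (a + 1, b)) :
      GridMove ((a, b), g) ((a, b + 1), shift g (a, b) (a, b + 1))

theorem GridMove.right_unique {s s₁ s₂ : (ℕ × ℕ) × (ℕ × ℕ → ℕ)} (h₁ : GridMove s s₁)
    (h₂ : GridMove s s₂) : s₁ = s₂ := by
  cases h₁ <;> cases h₂
  · rfl
  · rename_i a b g h1 h2 h3 h4
    have := h2 h3
    have := h4 h1
    omega
  · rename_i a b g h1 h2 h3 h4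
    have := h2 h3
    have := h4 h1
    omega
  · rfl

/-- The coordinate sum of the empty square counts moves. It gives termination, and it shows that
runs with the same end points have the same length. -/
theorem GridMove.sum_eq {s s' : (ℕ × ℕ) × (ℕ × ℕ → ℕ)} (h : GridMove s s') :
    s'.1.1 + s'.1.2 = s.1.1 + s.1.2 + 1 := by
  cases h <;> simp only <;> omega

theorem GridMove.sum_le {s s' : (ℕ × ℕ) × (ℕ × ℕ → ℕ)} (h : Relation.ReflTransGen GridMove s s') :
    s.1.1 + s.1.2 ≤ s'.1.1 + s'.1.2 := by
  induction h with
  | refl => exact le_rfl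
  | tail _ h ih => have := h.sum_eq; omega

/-- The moved letter is now read earlier, so it enters precisely the prefixes that end at `(a, b)`
or later but before `(a + 1, b)`. -/
theorem gridSum_shift_up (i N : ℕ) {g : ℕ × ℕ → ℕ} {a b : ℕ} (hb : b < N) (h0 : g (a, b) = 0)
    (w : ℕ × ℕ) : gridSum i N (shift g (a, b) (a + 1, b)) w = gridSum i N g w +
      if (w.1 = a ∧ w.2 ≤ b) ∨ (w.1 = a + 1 ∧ b < w.2) then gridSign i (g (a + 1, b)) else 0 := by
  rw [shift, gridSum_update _ _ _ _ hb, gridSum_update _ _ _ _ hb,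
    Function.update_of_ne (by simp), h0, gridSign_zero]
  obtain ⟨c, d⟩ := w
  simp only [Bef, Prod.mk.injEq]
  split_ifs <;> omega

theorem gridSum_shift_left (i N : ℕ) {g : ℕ × ℕ → ℕ} {a b : ℕ} (hb : b + 1 < N)
    (h0 : g (a, b) = 0) (w : ℕ × ℕ) :
    gridSum i N (shift g (a, b) (a, b + 1)) w = gridSum i N g w -
      if w = (a, b + 1) then gridSign i (g (a, b + 1)) else 0 := by
  rw [shift, gridSum_update _ _ _ _ hb, gridSum_update _ _ _ _ (show (a, b).2 < N by simp; omega),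
    Function.update_of_ne (by simp), h0, gridSign_zero]
  obtain ⟨c, d⟩ := w
  simp only [Bef, Prod.mk.injEq]
  split_ifs <;> omega

namespace Punct

variable {lam inn : YoungDiagram} {h : ℕ × ℕ} {g : ℕ × ℕ → ℕ}

theorem hole_eq_zero (P : Punct lam inn h g) : g h = 0 := by
  by_contra hne
  exact ((P.dom h).1 hne).2.2 rfl

theorem ne_zero_of_between (P : Punct lam inn h g) {a b c d e f : ℕ}
    (h1 : g (a, b) ≠ 0 ∨ (a, b) = h) (h2 : g (c, d) ≠ 0 ∨ (c, d) = h) (ha : a ≤ e) (hb : b ≤ f)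
    (hc : e ≤ c) (hd : f ≤ d) (hne : (e, f) ≠ h) : g (e, f) ≠ 0 := by
  rw [P.dom]
  have h1' : (a, b) ∉ inn := by
    rcases h1 with h1 | rfl
    · exact ((P.dom _).1 h1).2.1
    · exact P.notMem
  have h2' : (c, d) ∈ lam := by
    rcases h2 with h2 | rfl
    · exact ((P.dom _).1 h2).1
    · exact P.mem
  exact ⟨lam.up_left_mem hc hd h2', fun h => h1' (inn.up_left_mem ha hb h), hne⟩

theorem row_le (P : Punct lam inn h g) {a b b' : ℕ} (hb : b ≤ b') (h1 : g (a, b) ≠ 0)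
    (h2 : g (a, b') ≠ 0) : g (a, b) ≤ g (a, b') := by
  rcases hb.eq_or_lt with rfl | hb
  · exact le_rfl
  · exact P.row _ _ _ hb h1 h2

theorem eq_zero_of_le (P : Punct lam inn h g) {a c : ℕ} (hc : lam.rowLen 0 ≤ c) :
    g (a, c) = 0 := by
  by_contra hne
  have := lam.up_left_mem (Nat.zero_le a) le_rfl ((P.dom _).1 hne).1
  rw [YoungDiagram.mem_iff_lt_rowLen] at this
  omega

theorem lt_of_ne_zero (P : Punct lam inn h g) {a c : ℕ} (hc : g (a, c) ≠ 0) :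
    c < lam.rowLen 0 := by
  by_contra hcon
  exact hc (P.eq_zero_of_le (not_lt.1 hcon))

theorem shift_up {a b : ℕ} (P : Punct lam inn (a, b) g) (h0 : g (a + 1, b) ≠ 0)
    (hle : g (a, b + 1) ≠ 0 → g (a + 1, b) ≤ g (a, b + 1)) :
    Punct lam inn (a + 1, b) (shift g (a, b) (a + 1, b)) := by
  have hd := (P.dom _).1 h0
  have hself : shift g (a, b) (a + 1, b) (a, b) = g (a + 1, b) := by simp [shift]
  have hnew : shift g (a, b) (a + 1, b) (a + 1, b) = 0 := by simp [shift]
  have hoff : ∀ c, c ≠ (a, b) → c ≠ (a + 1, b) → shift g (a, b) (a + 1, b) c = g c := by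
    intro c h1 h2
    rw [shift, Function.update_of_ne h2, Function.update_of_ne h1]
  refine ⟨hd.1, hd.2.1, ?_, ?_, ?_⟩
  · intro c
    by_cases h1 : c = (a, b)
    · subst h1
      rw [hself]
      exact ⟨fun _ => ⟨P.mem, P.notMem, by simp⟩, fun _ => h0⟩
    · by_cases h2 : c = (a + 1, b)
      · subst h2
        simp [hnew]
      · rw [hoff c h1 h2, P.dom]
        simp [h1, h2]
  · intro e f f' hlt
    by_cases h1 : (e, f) = (a + 1, b)
    · rw [h1, hnew]; simp
    by_cases h2 : (e, f') = (a + 1, b)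
    · rw [h2, hnew]; simp
    by_cases h3 : (e, f) = (a, b)
    · obtain ⟨rfl, rfl⟩ := Prod.mk.inj h3
      rw [hself, hoff _ (by simp; omega) h2]
      intro _ h4
      have h5 : g (e, f + 1) ≠ 0 := P.ne_zero_of_between (Or.inr rfl) (Or.inl h4) le_rfl (by omega)
        le_rfl (by omega) (by simp)
      exact (hle h5).trans (P.row_le (by omega) h5 h4)
    · by_cases h4 : (e, f') = (a, b)
      · obtain ⟨rfl, rfl⟩ := Prod.mk.inj h4
        rw [hself, hoff _ h3 h1]
        intro h5 _
        have h6 : g (e + 1, f) ≠ 0 := P.ne_zero_of_between (Or.inl h5) (Or.inl h0) (by omega) le_rfl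
          le_rfl (by omega) (by simp)
        exact (P.col _ _ _ (Nat.lt_add_one e) h5 h6).le.trans (P.row _ _ _ hlt h6 h0)
      · rw [hoff _ h3 h1, hoff _ h4 h2]
        exact P.row _ _ _ hlt
  · intro e e' f hlt
    by_cases h1 : (e, f) = (a + 1, b)
    · rw [h1, hnew]; simp
    by_cases h2 : (e', f) = (a + 1, b)
    · rw [h2, hnew]; simp
    by_cases h3 : (e, f) = (a, b)
    · obtain ⟨rfl, rfl⟩ := Prod.mk.inj h3
      rw [hself, hoff _ (by simp; omega) h2]
      intro _ h4
      refine P.col _ _ _ ?_ h0 h4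
      simp only [Prod.mk.injEq, and_true] at h2
      omega
    · by_cases h4 : (e', f) = (a, b)
      · obtain ⟨rfl, rfl⟩ := Prod.mk.inj h4
        rw [hself, hoff _ h3 h1]
        intro h5 _
        exact P.col _ _ _ (by omega) h5 h0
      · rw [hoff _ h3 h1, hoff _ h4 h2]
        exact P.col _ _ _ hlt

theorem shift_left {a b : ℕ} (P : Punct lam inn (a, b) g) (h0 : g (a, b + 1) ≠ 0)
    (hle : g (a + 1, b) ≠ 0 → g (a, b + 1) < g (a + 1, b)) :
    Punct lam inn (a, b + 1) (shift g (a, b) (a, b + 1)) := by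
  have hd := (P.dom _).1 h0
  have hself : shift g (a, b) (a, b + 1) (a, b) = g (a, b + 1) := by simp [shift]
  have hnew : shift g (a, b) (a, b + 1) (a, b + 1) = 0 := by simp [shift]
  have hoff : ∀ c, c ≠ (a, b) → c ≠ (a, b + 1) → shift g (a, b) (a, b + 1) c = g c := by
    intro c h1 h2
    rw [shift, Function.update_of_ne h2, Function.update_of_ne h1]
  refine ⟨hd.1, hd.2.1, ?_, ?_, ?_⟩
  · intro c
    by_cases h1 : c = (a, b)
    · subst h1
      rw [hself]
      exact ⟨fun _ => ⟨P.mem, P.notMem, by simp⟩, fun _ => h0⟩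
    · by_cases h2 : c = (a, b + 1)
      · subst h2
        simp [hnew]
      · rw [hoff c h1 h2, P.dom]
        simp [h1, h2]
  · intro e f f' hlt
    by_cases h1 : (e, f) = (a, b + 1)
    · rw [h1, hnew]; simp
    by_cases h2 : (e, f') = (a, b + 1)
    · rw [h2, hnew]; simp
    by_cases h3 : (e, f) = (a, b)
    · obtain ⟨rfl, rfl⟩ := Prod.mk.inj h3
      rw [hself, hoff _ (by simp; omega) h2]
      intro _ h4
      refine P.row_le ?_ h0 h4
      omega
    · by_cases h4 : (e, f') = (a, b)
      · obtain ⟨rfl, rfl⟩ := Prod.mk.inj h4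
        rw [hself, hoff _ h3 h1]
        intro h5 _
        exact P.row _ _ _ (by omega) h5 h0
      · rw [hoff _ h3 h1, hoff _ h4 h2]
        exact P.row _ _ _ hlt
  · intro e e' f hlt
    by_cases h1 : (e, f) = (a, b + 1)
    · rw [h1, hnew]; simp
    by_cases h2 : (e', f) = (a, b + 1)
    · rw [h2, hnew]; simp
    by_cases h3 : (e, f) = (a, b)
    · obtain ⟨rfl, rfl⟩ := Prod.mk.inj h3
      rw [hself, hoff _ (by simp; omega) h2]
      intro _ h4
      have h5 : g (e + 1, f) ≠ 0 := P.ne_zero_of_between (Or.inr rfl) (Or.inl h4) (by omega) le_rfl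
        (by omega) le_rfl (by simp)
      refine (hle h5).trans_le ?_
      rcases (show e + 1 ≤ e' by omega).eq_or_lt with rfl | h6
      · exact le_rfl
      · exact (P.col _ _ _ h6 h5 h4).le
    · by_cases h4 : (e', f) = (a, b)
      · obtain ⟨rfl, rfl⟩ := Prod.mk.inj h4
        rw [hself, hoff _ h3 h1]
        intro h5 _
        have h6 : g (e, f + 1) ≠ 0 := P.ne_zero_of_between (Or.inl h5) (Or.inl h0) le_rfl (by omega)
          (by omega) le_rfl (by simp)
        exact (P.row _ _ _ (Nat.lt_add_one f) h5 h6).trans_lt (P.col _ _ _ hlt h6 h0)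
      · rw [hoff _ h3 h1, hoff _ h4 h2]
        exact P.col _ _ _ hlt

theorem move (P : Punct lam inn h g) {h' : ℕ × ℕ} {g' : ℕ × ℕ → ℕ}
    (hm : GridMove (h, g) (h', g')) : Punct lam inn h' g' := by
  cases hm with
  | up a b _ h0 hle => exact P.shift_up h0 hle
  | left a b _ h0 hlt => exact P.shift_left h0 hlt

theorem moves (P : Punct lam inn h g) {s : (ℕ × ℕ) × (ℕ × ℕ → ℕ)}
    (hm : Relation.ReflTransGen GridMove (h, g) s) : Punct lam inn s.1 s.2 := by
  induction hm with
  | refl => exact P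
  | tail _ hs ih => exact ih.move hs

/-! ### Prefix sums around the empty square -/

variable {a b i : ℕ}

theorem above_left_lt (P : Punct lam inn (a, b) g) {j k : ℕ} (hj : j ≤ k)
    (h0 : g (a + 1, k) ≠ 0) (hj0 : g (a, j) ≠ 0) : g (a, j) < g (a + 1, k) := by
  have h6 : g (a + 1, j) ≠ 0 := P.ne_zero_of_between (Or.inl hj0) (Or.inl h0) (by omega) le_rfl
    le_rfl (by omega) (by simp)
  exact (P.col _ _ _ (Nat.lt_add_one a) hj0 h6).trans_le (P.row_le hj h6 h0)

/-- Row `a + 1` carries `i + 1` in columns `c` to `b`. In column `b` the empty square offers no `i`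
to cancel it, which gains 1. Column `c` gains another 1 if it lies further left and has no `i`
above. No other column loses. -/
theorem add_one_le_gridSum (P : Punct lam inn (a, b) g) (hy : g (a + 1, b) = i + 2) {c : ℕ}
    (hc : c ≤ b) (hc1 : g (a + 1, c) = i + 2) (hlt : ∀ j < c, g (a, j) ≠ i + 1) :
    gridSum i (lam.rowLen 0) g (a, b + 1) + 1 +
        (if c < b ∧ g (a, c) ≠ i + 1 then 1 else 0) ≤
      gridSum i (lam.rowLen 0) g (a + 1, c) := by
  have hbN : b < lam.rowLen 0 := P.lt_of_ne_zero (a := a + 1) (by omega)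
  have hsum : ∑ j ∈ Finset.range (lam.rowLen 0), ((if j = b then (1 : ℤ) else 0) +
      (if j = c then (if c < b ∧ g (a, c) ≠ i + 1 then 1 else 0) else 0)) =
      1 + (if c < b ∧ g (a, c) ≠ i + 1 then 1 else 0) := by
    rw [Finset.sum_add_distrib, Finset.sum_ite_eq', Finset.sum_ite_eq', if_pos (by simpa using hbN),
      if_pos (by simp; omega)]
  have hkey := gridSum_succ_row_sub i (lam.rowLen 0) g a (b + 1) c
  have hle : ∑ j ∈ Finset.range (lam.rowLen 0), ((if j = b then (1 : ℤ) else 0) +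
      (if j = c then (if c < b ∧ g (a, c) ≠ i + 1 then 1 else 0) else 0)) ≤
      gridSum i (lam.rowLen 0) g (a + 1, c) - gridSum i (lam.rowLen 0) g (a, b + 1) := by
    rw [hkey]
    refine Finset.sum_le_sum fun j _ => ?_
    rcases lt_or_ge j c with hj | hj
    · rw [if_neg (by omega), if_neg (by omega), if_pos (by omega), if_neg (by omega)]
      have := gridSign_nonneg (hlt j hj)
      omega
    · rcases lt_trichotomy j b with hj' | rfl | hj'
      · have h4 : g (a + 1, j) ≠ 0 := P.ne_zero_of_between (Or.inl (show g (a + 1, c) ≠ 0 by omega))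
          (Or.inl (show g (a + 1, b) ≠ 0 by omega)) le_rfl hj le_rfl hj'.le (by simp)
        have h5 := P.row_le hj (by omega) h4
        have h6 := P.row_le hj'.le h4 (by omega)
        have h7 : g (a + 1, j) = i + 2 := by omega
        rw [if_neg (by omega), if_pos (show j < b + 1 by omega), if_pos hj, h7, gridSign_add_two]
        by_cases hjc : j = c
        · subst hjc
          rw [if_pos rfl]
          split_ifs with h8
          · have := gridSign_nonneg h8.2
            omega
          · have := neg_one_le_gridSign i (g (a, j))
            omega
        · rw [if_neg hjc]
          have := neg_one_le_gridSign i (g (a, j))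
          omega
      · rw [if_pos rfl, if_pos (Nat.lt_add_one j), if_pos hj, hy, P.hole_eq_zero, gridSign_add_two,
          gridSign_zero]
        split_ifs <;> omega
      · rw [if_neg (by omega), if_neg (by omega), if_neg (by omega), if_pos hj]
        have : 0 ≤ gridSign i (g (a + 1, j)) := gridSign_nonneg fun h8 => by
          have := P.row _ _ _ hj' (show g (a + 1, b) ≠ 0 by omega) (by omega)
          omega
        omega
  omega

/-- Let `c` be the leftmost column with `i + 1` in row `a + 1`. An `i` in row `a` further left would
have an `i + 1` below it. -/
theorem exists_add_one_le_gridSum (P : Punct lam inn (a, b) g) (hy : g (a + 1, b) = i + 2) :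
    ∃ c ≤ b, gridSum i (lam.rowLen 0) g (a, b + 1) + 1 ≤
      gridSum i (lam.rowLen 0) g (a + 1, c) := by
  obtain ⟨c, hc, hc1, hlt⟩ := exists_first_in_row hy
  have := P.add_one_le_gridSum hy hc hc1 ?_
  · refine ⟨c, hc, ?_⟩
    split_ifs at this <;> omega
  · intro j hj hj1
    have h1 : g (a + 1, j) ≠ 0 := P.ne_zero_of_between (Or.inl (show g (a, j) ≠ 0 by omega))
      (Or.inl (show g (a + 1, c) ≠ 0 by omega)) (by omega) le_rfl le_rfl hj.le (by simp)
    have h2 := P.col _ _ _ (Nat.lt_add_one a) (by omega) h1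
    have h3 := P.row _ _ _ hj h1 (by omega)
    have := hlt j hj
    omega

/-- The `w` considered are the positions whose sums grow by 1 when an `i + 1` moves up. No `i + 1`
is read between `(a, b + 1)` and them: left of the empty square letters of row `a` are smaller, and
right of it letters of row `a + 1` are larger. -/
theorem gridSum_le_of_up (P : Punct lam inn (a, b) g) (hy : g (a + 1, b) = i + 2)
    (hle : g (a, b + 1) ≠ 0 → g (a + 1, b) ≤ g (a, b + 1)) {w : ℕ × ℕ}
    (hw : (w.1 = a ∧ w.2 ≤ b) ∨ (w.1 = a + 1 ∧ b < w.2)) :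
    gridSum i (lam.rowLen 0) g w ≤ gridSum i (lam.rowLen 0) g (a, b + 1) := by
  obtain ⟨c, d⟩ := w
  have hleft : ∀ j, j < b + 1 → gridSign i (g (a, j)) ≤ 0 := fun j hj => gridSign_nonpos fun h => by
    have := P.above_left_lt (show j ≤ b by omega) (by omega) (show g (a, j) ≠ 0 by omega)
    omega
  rcases hw with ⟨rfl, hd⟩ | ⟨rfl, hd⟩
  · simp only at *
    rw [← sub_nonpos, gridSum_row_sub]
    refine Finset.sum_nonpos fun j _ => ?_
    by_cases hj : j < b + 1
    · have := hleft j hj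
      split_ifs <;> omega
    · split_ifs <;> omega
  · simp only at *
    rw [← sub_nonpos, gridSum_succ_row_sub]
    refine Finset.sum_nonpos fun j _ => ?_
    by_cases hj : j < b + 1
    · have := hleft j hj
      split_ifs <;> omega
    · rw [if_neg hj, zero_add]
      split_ifs with hj'
      · refine gridSign_nonpos fun h => ?_
        have h1 : g (a + 1, j) ≠ 0 := by omega
        have h2 : g (a, j) ≠ 0 := P.ne_zero_of_between (Or.inr rfl) (Or.inl h1) le_rfl (by omega)
          (by omega) le_rfl (by simp; omega)
        have h3 : g (a, b + 1) ≠ 0 := P.ne_zero_of_between (Or.inr rfl) (Or.inl h2) le_rfl (by omega)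
          le_rfl (by omega) (by simp)
        have h4 := hle h3
        have h5 := P.row_le (show b + 1 ≤ j by omega) h3 h2
        have h6 := P.col _ _ _ (Nat.lt_add_one a) h2 h1
        omega
      · exact le_rfl

/-- Along the run, an `i` in row `a` cancels a possible `i + 1` below it. From column `c` on,
letters of row `a` exceed `i`, so those below exceed `i + 1`. -/
theorem gridSum_terms_nonpos (P : Punct lam inn (a, b) g) {c : ℕ} (hbc : b < c)
    (hc : g (a, c) ≠ i + 1) (hrun : ∀ j, b < j → j < c → g (a, j) = i + 1)
    (hleft : ∀ j < b, g (a, j) ≠ i + 2) (hle : g (a, b + 1) ≠ 0 → i + 1 ≤ g (a, b + 1))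
    (j : ℕ) {k : ℕ} (hk : b < k) : (if j < c then gridSign i (g (a, j)) else 0) +
        (if k ≤ j then gridSign i (g (a + 1, j)) else 0) ≤ 0 := by
  rcases lt_trichotomy j b with hj | rfl | hj
  · rw [if_pos (by omega), if_neg (by omega), add_zero]
    exact gridSign_nonpos (hleft j hj)
  · rw [if_pos (by omega), if_neg (by omega), add_zero, P.hole_eq_zero, gridSign_zero]
  · by_cases hjc : j < c
    · rw [if_pos hjc, hrun j hj hjc, gridSign_add_one]
      have := gridSign_le_one i (g (a + 1, j))
      split_ifs <;> omega
    · rw [if_neg hjc, zero_add]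
      split_ifs
      · refine gridSign_nonpos fun h => ?_
        have h1 : g (a + 1, j) ≠ 0 := by omega
        have h2 : g (a, j) ≠ 0 := P.ne_zero_of_between (Or.inr rfl) (Or.inl h1) le_rfl (by omega)
          (by omega) le_rfl (by simp; omega)
        have h3 : g (a, b + 1) ≠ 0 := P.ne_zero_of_between (Or.inr rfl) (Or.inl h2) le_rfl (by omega)
          le_rfl (by omega) (by simp)
        have h4 : g (a, c) ≠ 0 := P.ne_zero_of_between (Or.inr rfl) (Or.inl h2) le_rfl (by omega)
          le_rfl (by omega) (by simp; omega)
        have h5 := hle h3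
        have h6 := P.row_le (show b + 1 ≤ c by omega) h3 h4
        have h7 := P.row_le (show c ≤ j by omega) h4 h2
        have h8 := P.col _ _ _ (Nat.lt_add_one a) h2 h1
        omega
      · exact le_rfl

/-- From `c` down to `k` only letters that do not increase the sum are read. If the run of letters
`i` is nonempty, its last one, in column `c - 1`, costs 1; `hc` keeps that column in the range of
summation. -/
theorem gridSum_row_le (P : Punct lam inn (a, b) g) {c : ℕ} (hbc : b < c)
    (hrun : ∀ j, b < j → j < c → g (a, j) = i + 1)
    (hleft : ∀ j < b, g (a, j) ≠ i + 2) {k : ℕ} (hk : k < c) (hc : b + 1 < c → c ≤ lam.rowLen 0) :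
    gridSum i (lam.rowLen 0) g (a, k) + (if b + 1 < c then 1 else 0) ≤
      gridSum i (lam.rowLen 0) g (a, c) := by
  have hterm : ∀ j, (if k ≤ j then gridSign i (g (a, j)) else 0) -
        (if c ≤ j then gridSign i (g (a, j)) else 0) ≤
          -(if j = c - 1 then (if b + 1 < c then 1 else 0) else 0) := by
    intro j
    by_cases hjc : c ≤ j
    · rw [if_pos (by omega), if_pos hjc, if_neg (by omega)]
      simp
    · rw [if_neg hjc, sub_zero]
      rcases lt_trichotomy j b with hj | rfl | hj
      · have := gridSign_nonpos (hleft j hj)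
        split_ifs <;> omega
      · rw [P.hole_eq_zero, gridSign_zero]
        split_ifs <;> omega
      · rw [hrun j hj (by omega), gridSign_add_one]
        split_ifs <;> omega
  have h1 := gridSum_row_sub i (lam.rowLen 0) g a k c
  have h2 := Finset.sum_le_sum fun j (_ : j ∈ Finset.range (lam.rowLen 0)) => hterm j
  rw [← h1, Finset.sum_neg_distrib, Finset.sum_ite_eq'] at h2
  simp only [Finset.mem_range] at h2
  split_ifs at h2 ⊢ with h3 h4 <;> omega

/-- When an `i` moves up, the sums at these `w` drop by 1. They do not exceed the sum at an earlier
position `(a, c)`, just past the run of letters `i` right of the empty square, so none of them is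
the first maximum. -/
theorem exists_before_of_up (P : Punct lam inn (a, b) g) (hy : g (a + 1, b) = i + 1)
    (hle : g (a, b + 1) ≠ 0 → g (a + 1, b) ≤ g (a, b + 1)) :
    ∃ c, b < c ∧ ∀ w : ℕ × ℕ, (w.1 = a ∧ w.2 ≤ b) ∨ (w.1 = a + 1 ∧ b < w.2) →
      gridSum i (lam.rowLen 0) g w ≤ gridSum i (lam.rowLen 0) g (a, c) := by
  obtain ⟨c, hbc, hc, hrun⟩ := exists_end_of_run (fun a c => P.eq_zero_of_le (a := a)) a b i
  have hleft : ∀ j < b, g (a, j) ≠ i + 2 := fun j hj h => by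
    have := P.above_left_lt hj.le (by omega) (show g (a, j) ≠ 0 by omega)
    omega
  refine ⟨c, hbc, ?_⟩
  rintro ⟨e, k⟩ (⟨he, hk⟩ | ⟨he, hk⟩) <;> simp only at he hk <;> subst he
  · have hcN : b + 1 < c → c ≤ lam.rowLen 0 := fun h => by
      have := P.lt_of_ne_zero (a := e) (c := c - 1) (by rw [hrun _ (by omega) (by omega)]; omega)
      omega
    have := P.gridSum_row_le hbc hrun hleft (show k < c by omega) hcN
    split_ifs at this <;> omega
  · rw [← sub_nonpos, gridSum_succ_row_sub]
    exact Finset.sum_nonpos fun j _ => P.gridSum_terms_nonpos hbc hc hrun hleft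
      (fun h => by have := hle h; omega) j hk

/-! ### Moves preserve bounds on prefix sums -/

/-- Sums increase only if an `i + 1` moves up, and then only at positions where they were below some
other sum. In a move to the left, the one changed sum becomes that of the position read just before.
-/
theorem gridSum_le_of_move (P : Punct lam inn h g) {h' : ℕ × ℕ} {g' : ℕ × ℕ → ℕ}
    (hm : GridMove (h, g) (h', g')) {M : ℤ} (hM : ∀ w, gridSum i (lam.rowLen 0) g w ≤ M)
    (w : ℕ × ℕ) : gridSum i (lam.rowLen 0) g' w ≤ M := by
  cases hm with
  | up a b _ h0 hle =>
    rw [gridSum_shift_up _ _ (P.lt_of_ne_zero h0) P.hole_eq_zero]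
    split_ifs with hw
    · by_cases hy : g (a + 1, b) = i + 2
      · obtain ⟨c, _, hc⟩ := P.exists_add_one_le_gridSum hy
        have h1 := P.gridSum_le_of_up hy hle hw
        have h2 := hM (a + 1, c)
        rw [hy, gridSign_add_two]
        omega
      · have h1 := gridSign_nonpos hy
        have h2 := hM w
        omega
    · rw [add_zero]
      exact hM w
  | left a b _ h0 hlt =>
    have hb := P.lt_of_ne_zero h0
    rw [gridSum_shift_left _ _ hb P.hole_eq_zero]
    split_ifs with hw
    · subst hw
      rw [gridSum_succ_col _ _ _ _ _ hb, add_sub_cancel_right]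
      exact hM _
    · rw [sub_zero]
      exact hM w

/-! ### Moves preserve the position of the first maximum -/

theorem firstMax_of_left (P : Punct lam inn (a, b) g) (h0 : g (a, b + 1) ≠ 0) {x : ℕ × ℕ}
    (hx : FirstMax i (lam.rowLen 0) g x) :
    ∃ x', FirstMax i (lam.rowLen 0) (shift g (a, b) (a, b + 1)) x' ∧
      shift (Function.update g x (i + 1)) (a, b) (a, b + 1) =
        Function.update (shift g (a, b) (a, b + 1)) x' (i + 1) := by
  have hb := P.lt_of_ne_zero h0
  have hS := gridSum_shift_left i (lam.rowLen 0) hb P.hole_eq_zero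
  have h1 := gridSum_succ_col i (lam.rowLen 0) g a (b + 1) hb
  have h2 := gridSum_succ_col i (lam.rowLen 0) g a b (by omega)
  rw [P.hole_eq_zero, gridSign_zero, add_zero] at h2
  obtain ⟨hx0, hx1, hx2⟩ := hx
  by_cases hxy : x = (a, b + 1)
  · subst hxy
    rw [hx0, gridSign_add_two] at h1
    refine ⟨(a, b), ⟨by simp [shift, hx0], fun w hw => ?_, fun w hw => ?_⟩, ?_⟩
    · rw [hS, hS, if_neg (show (a, b) ≠ (a, b + 1) by simp), sub_zero, h2]
      split_ifs with hw'
      · subst hw'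
        rw [hx0, gridSign_add_two]
        omega
      · rw [sub_zero]
        refine hx1 w ?_
        obtain ⟨c, d⟩ := w
        simp only [Bef, Prod.mk.injEq] at *
        omega
    · rw [hS, hS, if_neg (show (a, b) ≠ (a, b + 1) by simp), sub_zero, h2, if_neg, sub_zero]
      · refine hx2 w ?_
        obtain ⟨c, d⟩ := w
        simp only [Bef] at *
        omega
      · rintro rfl
        simp [Bef] at hw
    · funext c
      simp only [shift, Function.update_apply]
      have : (a, b) ≠ (a, b + 1) := by simp
      split_ifs <;> simp_all
  · have hxab : x ≠ (a, b) := by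
      rintro rfl
      rw [P.hole_eq_zero] at hx0
      omega
    refine ⟨x, ⟨?_, fun w hw => ?_, fun w hw => ?_⟩, ?_⟩
    · rw [shift, Function.update_of_ne hxy, Function.update_of_ne hxab, hx0]
    · rw [hS, hS, if_neg hxy, sub_zero]
      split_ifs with hw'
      · subst hw'
        rw [h1, add_sub_cancel_right]
        refine hx1 _ (Bef.trans ?_ hw)
        exact Or.inr ⟨rfl, Nat.lt_add_one _⟩
      · rw [sub_zero]
        exact hx1 w hw
    · rw [hS, hS, if_neg hxy, sub_zero]
      split_ifs with hw'
      · subst hw'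
        rw [h1, add_sub_cancel_right]
        by_cases hx3 : x = (a, b + 1 + 1)
        · rw [hx3]
        · refine hx2 _ ?_
          obtain ⟨c, d⟩ := x
          simp only [Bef, ne_eq, Prod.mk.injEq] at *
          omega
      · rw [sub_zero]
        exact hx2 w hw
    · rw [shift, shift, Function.update_of_ne (Ne.symm hxy), Function.update_comm hxab,
        Function.update_comm hxy]

/-- The first maximum moves only if it is the letter that moves. Otherwise a moving `i + 1` raises
sums that stay below the maximum, and any other letter does not raise sums and leaves the one at `x`
alone. -/
theorem firstMax_of_up (P : Punct lam inn (a, b) g) (h0 : g (a + 1, b) ≠ 0)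
    (hle : g (a, b + 1) ≠ 0 → g (a + 1, b) ≤ g (a, b + 1)) {x : ℕ × ℕ}
    (hx : FirstMax i (lam.rowLen 0) g x)
    (P' : Punct lam inn (a, b) (Function.update g x (i + 1))) :
    ∃ x', FirstMax i (lam.rowLen 0) (shift g (a, b) (a + 1, b)) x' ∧
      shift (Function.update g x (i + 1)) (a, b) (a + 1, b) =
        Function.update (shift g (a, b) (a + 1, b)) x' (i + 1) := by
  have hb := P.lt_of_ne_zero h0
  have hS := gridSum_shift_up i (lam.rowLen 0) hb P.hole_eq_zero
  have h1 := gridSum_succ_col i (lam.rowLen 0) g (a + 1) b hb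
  have h2 := gridSum_succ_col i (lam.rowLen 0) g a b hb
  rw [P.hole_eq_zero, gridSign_zero, add_zero] at h2
  obtain ⟨hx0, hx1, hx2⟩ := hx
  by_cases hxy : x = (a + 1, b)
  · subst hxy
    rw [hx0, gridSign_add_two] at h1
    have hI := fun w hw => P.gridSum_le_of_up hx0 hle (w := w) hw
    have h3 := hI (a + 1, b + 1) (Or.inr ⟨rfl, Nat.lt_add_one b⟩)
    have hSx := hS (a, b)
    rw [if_pos (Or.inl ⟨rfl, le_rfl⟩), hx0, gridSign_add_two] at hSx
    refine ⟨(a, b), ⟨by simp [shift, hx0], fun w hw => ?_, fun w hw => ?_⟩, ?_⟩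
    · rw [hSx, hS, if_neg, add_zero]
      · have := hx1 w (hw.trans (Or.inl (Nat.lt_add_one a)))
        omega
      · unfold Bef at hw
        simp only at hw
        omega
    · rw [hSx, hS]
      split_ifs with hw'
      · rw [hx0, gridSign_add_two]
        have := hI w hw'
        omega
      · rw [add_zero]
        rcases Bef.trichotomy w (a + 1, b) with h | rfl | h
        · have := hx1 w h
          omega
        · omega
        · have := hx2 w h
          omega
    · funext c
      simp only [shift, Function.update_apply]
      have : (a, b) ≠ (a + 1, b) := by simp
      split_ifs <;> simp_all
  · have hxab : x ≠ (a, b) := by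
      rintro rfl
      rw [P.hole_eq_zero] at hx0
      omega
    have hmax : ∀ w, gridSum i (lam.rowLen 0) g w ≤ gridSum i (lam.rowLen 0) g x := by
      intro w
      rcases Bef.trichotomy w x with h | rfl | h
      · exact (hx1 w h).le
      · exact le_rfl
      · exact hx2 w h
    refine ⟨x, ?_, ?_⟩
    swap
    · rw [shift, shift, Function.update_of_ne (Ne.symm hxy), Function.update_comm hxab,
        Function.update_comm hxy]
    have hgx : shift g (a, b) (a + 1, b) x = i + 2 := by
      rw [shift, Function.update_of_ne hxy, Function.update_of_ne hxab, hx0]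
    by_cases hy2 : g (a + 1, b) = i + 2
    · have hI := fun w hw => P.gridSum_le_of_up hy2 hle (w := w) hw
      obtain ⟨c, hcb, hc⟩ := P.exists_add_one_le_gridSum hy2
      have hxI : ¬ ((x.1 = a ∧ x.2 ≤ b) ∨ (x.1 = a + 1 ∧ b < x.2)) := fun h => by
        have := hI x h
        have := hmax (a + 1, c)
        omega
      refine ⟨hgx, fun w hw => ?_, fun w hw => ?_⟩
      · rw [hS, hS, if_neg hxI, add_zero]
        split_ifs with hw'
        · have h3 := hI w hw'
          rw [hy2, gridSign_add_two]
          by_cases hxr : x.1 = a + 1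
          · obtain ⟨e, k⟩ := x
            simp only at hxr
            subst hxr
            have hkb : k < b := by
              simp only [Prod.mk.injEq, true_and] at hxy
              omega
            -- After raising, `(a + 1, k)` carries `i`, so letters weakly to its left in row `a` are
            -- smaller than `i`. This supplies the extra 1 of `add_one_le_gridSum`, needed for a
            -- strict inequality.
            have h4 : ∀ j ≤ k, g (a, j) ≠ i + 1 := by
              intro j hj hj1
              have h5 : Function.update g (a + 1, k) (i + 1) (a, j) = g (a, j) :=
                Function.update_of_ne (by simp) _ _
              have h6 := P'.above_left_lt hj (by simp) (by rw [h5]; omega)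
              rw [h5, Function.update_self] at h6
              omega
            have h5 := P.add_one_le_gridSum hy2 hkb.le hx0 (fun j hj => h4 j hj.le)
            rw [if_pos ⟨hkb, h4 k le_rfl⟩] at h5
            omega
          · have := hx1 (a + 1, c) (by unfold Bef at *; simp only; omega)
            omega
        · rw [add_zero]
          exact hx1 w hw
      · rw [hS, hS, if_neg hxI, add_zero]
        split_ifs with hw'
        · have h3 := hI w hw'
          have h4 := hmax (a + 1, c)
          rw [hy2, gridSign_add_two]
          omega
        · rw [add_zero]
          exact hx2 w hw
    · have hneg := gridSign_nonpos hy2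
      have hSle : ∀ w, gridSum i (lam.rowLen 0) (shift g (a, b) (a + 1, b)) w ≤
          gridSum i (lam.rowLen 0) g w := by
        intro w
        rw [hS]
        split_ifs <;> omega
      have hSx : gridSum i (lam.rowLen 0) (shift g (a, b) (a + 1, b)) x =
          gridSum i (lam.rowLen 0) g x := by
        rw [hS]
        split_ifs with hxI
        · by_cases hy1 : g (a + 1, b) = i + 1
          · obtain ⟨c, hbc, hc⟩ := P.exists_before_of_up hy1 hle
            have h3 := hc x hxI
            have h4 := hx1 (a, c) (by unfold Bef; simp only; omega)
            omega
          · have := gridSign_nonneg hy1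
            omega
        · rw [add_zero]
      exact ⟨hgx, fun w hw => by rw [hSx]; exact (hSle w).trans_lt (hx1 w hw),
        fun w hw => by rw [hSx]; exact (hSle w).trans (hx2 w hw)⟩

end Punct

/-! ### Slides commute with raising -/

theorem gridMove_run {g : ℕ × ℕ → ℕ} {r b v : ℕ} (hv : v ≠ 0) (h0 : g (r, b) = 0) (e : ℕ)
    (hbe : b ≤ e) (hrun : ∀ j, b < j → j ≤ e → g (r, j) = v)
    (hbelow : ∀ j, b ≤ j → j < e → g (r + 1, j) ≠ 0 → v < g (r + 1, j)) :
    Relation.ReflTransGen GridMove ((r, b), g)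
      ((r, e), Function.update (Function.update g (r, b) v) (r, e) 0) := by
  induction e, hbe using Nat.le_induction with
  | base =>
    rw [Function.update_idem, ← h0, Function.update_eq_self]
  | succ e hbe ih =>
    refine (ih (fun j h1 h2 => hrun j h1 (by omega))
      (fun j h1 h2 => hbelow j h1 (by omega))).tail ?_
    have hr := hrun (e + 1) (by omega) le_rfl
    set k := Function.update (Function.update g (r, b) v) (r, e) 0 with hk
    have hk1 : k (r, e + 1) = v := by
      rw [hk, Function.update_of_ne (by simp), Function.update_of_ne (by simp; omega), hr]
    have hk2 : k (r + 1, e) = g (r + 1, e) := by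
      rw [hk, Function.update_of_ne (by simp), Function.update_of_ne (by simp)]
    have hm := GridMove.left r e k (by rw [hk1]; exact hv)
      (by rw [hk1, hk2]; exact hbelow e hbe (Nat.lt_add_one e))
    have hs : shift k (r, e) (r, e + 1) =
        Function.update (Function.update g (r, b) v) (r, e + 1) 0 := by
      funext c
      rw [shift, hk1]
      by_cases h1 : c = (r, e + 1)
      · subst h1; simp
      · rw [Function.update_of_ne h1, Function.update_of_ne h1]
        by_cases h2 : c = (r, e)
        · subst h2
          rw [Function.update_self]
          rcases hbe.eq_or_lt with rfl | hlt
          · rw [Function.update_self]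
          · rw [Function.update_of_ne (by simp; omega), hrun e hlt (by omega)]
        · rw [Function.update_of_ne h2, hk, Function.update_of_ne h2]
    rwa [hs] at hm

namespace Punct

variable {lam inn : YoungDiagram} {h : ℕ × ℕ} {g : ℕ × ℕ → ℕ} {a b i : ℕ}

/-- The sum at `x` strictly exceeds the one at `(a, c)`. The `i + 1` at `x` provides only 1, and the
remaining columns contribute at most 0 each, so each contributes exactly 0 and every `i` of the run
has an `i + 1` below it. -/
theorem firstMax_below_run (P : Punct lam inn (a, b) g) (hz : g (a, b + 1) = i + 1)
    (hx : FirstMax i (lam.rowLen 0) g (a + 1, b)) {c : ℕ} (hbc : b < c) (hc : g (a, c) ≠ i + 1)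
    (hrun : ∀ j, b < j → j < c → g (a, j) = i + 1) :
    (∀ j, b < j → j < c → g (a + 1, j) = i + 2) ∧
      gridSum i (lam.rowLen 0) g (a + 1, b) = gridSum i (lam.rowLen 0) g (a, c) + 1 := by
  obtain ⟨hx0, hx1, hx2⟩ := hx
  have hb : b < lam.rowLen 0 := P.lt_of_ne_zero (a := a + 1) (by omega)
  have h1 := hx1 (a, c) (Or.inl (Nat.lt_add_one a))
  have h2 := gridSum_succ_col i (lam.rowLen 0) g (a + 1) b hb
  rw [hx0, gridSign_add_two] at h2
  have hleft : ∀ j < b, g (a, j) ≠ i + 2 := fun j hj h => by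
    have := P.row a j (b + 1) (by omega) (by omega) (by omega)
    omega
  have h3 := gridSum_succ_row_sub i (lam.rowLen 0) g a c (b + 1)
  have hterm := fun j (_ : j ∈ Finset.range (lam.rowLen 0)) =>
    P.gridSum_terms_nonpos hbc hc hrun hleft (fun _ => hz.ge) j (Nat.lt_add_one b)
  have h4 := Finset.sum_nonpos hterm
  have h5 : ∑ j ∈ Finset.range (lam.rowLen 0), ((if j < c then gridSign i (g (a, j)) else 0) +
        (if b + 1 ≤ j then gridSign i (g (a + 1, j)) else 0)) = 0 := by omega
  refine ⟨fun j hj hjc => ?_, by omega⟩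
  have hr := hrun j hj hjc
  have h6 := (Finset.sum_eq_zero_iff_of_nonpos hterm).1 h5 j
    (Finset.mem_range.2 (P.lt_of_ne_zero (a := a) (by omega)))
  rw [if_pos hjc, if_pos (by omega), hr, gridSign_add_one] at h6
  by_contra hne
  have := gridSign_nonpos hne
  omega

/-- When the slides on a tableau and on its raised version first differ, they meet again later. -/
theorem exists_meet (P : Punct lam inn (a, b) g) (hz : g (a, b + 1) = i + 1)
    (hx : FirstMax i (lam.rowLen 0) g (a + 1, b)) :
    ∃ (e : ℕ) (g' u' : ℕ × ℕ → ℕ) (x' : ℕ × ℕ), b < e ∧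
      Relation.ReflTransGen GridMove ((a, b), g) ((a + 1, e), g') ∧
      Relation.ReflTransGen GridMove ((a, b), Function.update g (a + 1, b) (i + 1))
        ((a + 1, e), u') ∧
      FirstMax i (lam.rowLen 0) g' x' ∧ u' = Function.update g' x' (i + 1) := by
  have hx' := hx
  obtain ⟨hx0, hx1, hx2⟩ := hx'
  obtain ⟨c, hbc, hc, hrun⟩ := exists_end_of_run (fun a c => P.eq_zero_of_le (a := a)) a b i
  obtain ⟨hrun', hSx⟩ := P.firstMax_below_run hz hx hbc hc hrun
  have hbc' : b + 1 < c := by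
    rcases (show b + 1 ≤ c by omega).eq_or_lt with rfl | h
    · exact absurd hz hc
    · exact h
  obtain ⟨e, rfl⟩ : ∃ e, c = e + 1 := ⟨c - 1, by omega⟩
  have hbe : b < e := by omega
  have hae := hrun e hbe (Nat.lt_add_one e)
  have hae' := hrun' e hbe (Nat.lt_add_one e)
  have heN : e < lam.rowLen 0 := P.lt_of_ne_zero (a := a) (by omega)
  have hhole := P.hole_eq_zero
  have hne1 : (a, b) ≠ (a, e) := by simp; omega
  -- For `g` the empty square runs right along the letters `i` of row `a` to column `e`, then down.
  -- After raising it goes down first, then right along the letters `i + 1` of row `a + 1`. The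
  -- results differ only at `(a, e)`.
  set g' := Function.update (Function.update (Function.update g (a, b) (i + 1)) (a, e) (i + 2))
    (a + 1, e) 0 with hg'
  refine ⟨e, g', Function.update g' (a, e) (i + 1), (a, e), hbe, ?_, ?_, ?_, rfl⟩
  · have h1 := gridMove_run (v := i + 1) (by omega) hhole e hbe.le
      (fun j h1 h2 => hrun j h1 (by omega)) (fun j h1 h2 _ => by
        rcases h1.eq_or_lt with rfl | h1
        · omega
        · rw [hrun' j h1 (by omega)]; omega)
    refine h1.tail ?_
    set k := Function.update (Function.update g (a, b) (i + 1)) (a, e) 0 with hk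
    have hk1 : k (a + 1, e) = i + 2 := by
      rw [hk, Function.update_of_ne (by simp), Function.update_of_ne (by simp), hae']
    have hk2 : k (a, e + 1) = g (a, e + 1) := by
      rw [hk, Function.update_of_ne (by simp), Function.update_of_ne (by simp; omega)]
    have hm := GridMove.up a e k (by omega) (by
      rw [hk1, hk2]
      intro h
      have := P.row a e (e + 1) (Nat.lt_add_one e) (by omega) h
      omega)
    have hs : shift k (a, e) (a + 1, e) = g' := by
      rw [shift, hk1, hk, Function.update_idem]
    rwa [hs] at hm
  · set u := Function.update g (a + 1, b) (i + 1) with hu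
    have hu1 : u (a + 1, b) = i + 1 := Function.update_self _ _ _
    have hu0 : ∀ p, p ≠ (a + 1, b) → u p = g p := fun p hp => Function.update_of_ne hp _ _
    have hm := GridMove.up a b u (by omega) (by
      rw [hu1, hu0 _ (by simp), hz]; intro; rfl)
    refine Relation.ReflTransGen.head hm ?_
    set k := shift u (a, b) (a + 1, b) with hk
    have hk1 : k (a + 1, b) = 0 := by simp [hk, shift]
    have hk0 : ∀ p, p ≠ (a + 1, b) → p ≠ (a, b) → k p = g p := fun p hp hp' => by
      rw [hk, shift, Function.update_of_ne hp, Function.update_of_ne hp', hu0 p hp]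
    have hm' := gridMove_run (g := k) (r := a + 1) (b := b) (v := i + 2) (by omega) hk1 e hbe.le
      (fun j h1 h2 => by
        rw [hk0 _ (by simp; omega) (by simp)]
        exact hrun' j h1 (by omega)) (fun j h1 h2 => by
        rw [hk0 _ (by simp) (by simp only [ne_eq, Prod.mk.injEq]; omega)]
        intro h3
        have h4 : g (a + 1, j) = i + 2 := by
          rcases h1.eq_or_lt with rfl | h1
          · exact hx0
          · exact hrun' j h1 (by omega)
        have := P.col (a + 1) (a + 1 + 1) j (Nat.lt_add_one _) (by omega) h3
        omega)
    have hs : Function.update (Function.update k (a + 1, b) (i + 2)) (a + 1, e) 0 =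
        Function.update g' (a, e) (i + 1) := by
      funext p
      by_cases h1 : p = (a + 1, e)
      · subst h1
        rw [Function.update_self, Function.update_of_ne (by simp), hg', Function.update_self]
      rw [Function.update_of_ne h1]
      by_cases h2 : p = (a, e)
      · subst h2
        rw [Function.update_self, Function.update_of_ne (by simp), hk0 _ (by simp)
          (by simp; omega), hae]
      rw [Function.update_of_ne h2, hg', Function.update_of_ne h1, Function.update_of_ne h2]
      by_cases h3 : p = (a + 1, b)
      · subst h3
        rw [Function.update_self, Function.update_of_ne (by simp), hx0]
      rw [Function.update_of_ne h3]
      by_cases h4 : p = (a, b)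
      · subst h4
        rw [Function.update_self, hk, shift, Function.update_of_ne (by simp), Function.update_self,
          hu1]
      · rw [Function.update_of_ne h4, hk0 p h3 h4]
    rwa [hs] at hm'
  -- The total effect: an `i` appears at `(a, b)`, the `i` at `(a, e)` becomes `i + 1`, and the `i +
  -- 1` at `(a + 1, e)` disappears.
  · have hS : ∀ w, gridSum i (lam.rowLen 0) g' w = gridSum i (lam.rowLen 0) g w +
        (if (a, b) = w ∨ Bef (a, b) w then -1 else 0) +
        (if (a, e) = w ∨ Bef (a, e) w then 2 else 0) +
        (if (a + 1, e) = w ∨ Bef (a + 1, e) w then -1 else 0) := by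
      intro w
      rw [hg', gridSum_update _ _ _ _ heN, gridSum_update _ _ _ _ heN,
        gridSum_update _ _ _ _ (show (a, b).2 < _ from hbe.trans heN), hhole,
        Function.update_of_ne hne1.symm, hae, Function.update_of_ne (show (a + 1, e) ≠ (a, e) by simp),
        Function.update_of_ne (show (a + 1, e) ≠ (a, b) by simp), hae']
      simp only [gridSign_add_one, gridSign_add_two, gridSign_zero]
      norm_num
    have hcol := gridSum_succ_col i (lam.rowLen 0) g a e heN
    rw [hae, gridSign_add_one] at hcol
    have hSx' : gridSum i (lam.rowLen 0) g' (a, e) = gridSum i (lam.rowLen 0) g (a, e + 1) + 1 := by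
      rw [hS, if_neg, if_pos (Or.inl rfl), if_neg]
      · omega
      · simp [Bef]
      · simp [Bef]; omega
    have hmax : ∀ w, gridSum i (lam.rowLen 0) g w ≤ gridSum i (lam.rowLen 0) g (a + 1, b) := by
      intro w
      rcases Bef.trichotomy w (a + 1, b) with h | rfl | h
      · exact (hx1 w h).le
      · exact le_rfl
      · exact hx2 w h
    have hleft : ∀ j < b, g (a, j) ≠ i + 2 := fun j hj h => by
      have := P.row a j (b + 1) (by omega) (by omega) (by omega)
      omega
    refine ⟨by rw [hg', Function.update_of_ne (by simp), Function.update_self], ?_, ?_⟩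
    · rintro ⟨c, d⟩ hw
      have := hx1 (c, d) (hw.trans (Or.inl (Nat.lt_add_one a)))
      rw [hSx', hS, if_neg, if_neg, if_neg]
      · omega
      all_goals simp only [Bef, Prod.mk.injEq] at *; omega
    · rintro ⟨r, k⟩ hw
      rw [hSx']
      have hm := hmax (r, k)
      by_cases hr : r = a
      · subst hr
        have hk : k < e := by
          simp only [Bef] at hw
          omega
        have h1 := P.gridSum_row_le hbc hrun hleft (show k < e + 1 by omega) (fun _ => heN)
        rw [if_pos hbc'] at h1
        rw [hS, if_neg (show ¬ ((r + 1, e) = (r, k) ∨ Bef (r + 1, e) (r, k)) by simp [Bef])]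
        split_ifs <;> omega
      · by_cases hr' : r = a + 1 ∧ e < k
        · obtain ⟨rfl, hk⟩ := hr'
          have h1 : gridSum i (lam.rowLen 0) g (a + 1, k) -
              gridSum i (lam.rowLen 0) g (a, e + 1) ≤ 0 := by
            rw [gridSum_succ_row_sub]
            exact Finset.sum_nonpos fun j _ => P.gridSum_terms_nonpos hbc hc hrun hleft
              (fun _ => hz.ge) j (by omega)
          rw [hS, if_pos, if_pos, if_neg]
          · omega
          all_goals simp only [Bef, Prod.mk.injEq]; omega
        · rw [hS, if_pos, if_pos, if_pos]
          · omega
          all_goals simp only [Bef, Prod.mk.injEq] at *; omega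

/-- Induction on the distance still to be covered by the empty square. The two slides agree on the
next move unless the changed letter is next to the empty square and decides the comparison. -/
theorem slide_raise (n : ℕ) : ∀ {h t : ℕ × ℕ} {g g' : ℕ × ℕ → ℕ} {x : ℕ × ℕ},
    t.1 + t.2 - (h.1 + h.2) = n → Punct lam inn h g →
    Punct lam inn h (Function.update g x (i + 1)) → FirstMax i (lam.rowLen 0) g x →
    IsNormalFormOf GridMove (h, g) (t, g') →
    ∃ x', FirstMax i (lam.rowLen 0) g' x' ∧
      IsNormalFormOf GridMove (h, Function.update g x (i + 1))
        (t, Function.update g' x' (i + 1)) := by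
  induction n using Nat.strong_induction_on with
  | _ n ih =>
  intro h t g g' x hn P P' hx hnf
  obtain ⟨a, b⟩ := h
  set u := Function.update g x (i + 1) with hu
  have hu0 : ∀ p, p ≠ x → u p = g p := fun p hp => Function.update_of_ne hp _ _
  have hux : u x = i + 1 := Function.update_self _ _ _
  have hz : ∀ p, u p ≠ 0 ↔ g p ≠ 0 := fun p => by rw [P.dom, P'.dom]
  have hgx := hx.1
  -- continue from a common later position of the empty square
  have step : ∀ (h₂ : ℕ × ℕ) (g₂ u₂ : ℕ × ℕ → ℕ) (x₂ : ℕ × ℕ), a + b < h₂.1 + h₂.2 →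
      Relation.ReflTransGen GridMove ((a, b), g) (h₂, g₂) →
      Relation.ReflTransGen GridMove ((a, b), u) (h₂, u₂) →
      FirstMax i (lam.rowLen 0) g₂ x₂ → u₂ = Function.update g₂ x₂ (i + 1) →
      ∃ x', FirstMax i (lam.rowLen 0) g' x' ∧
        IsNormalFormOf GridMove ((a, b), u) (t, Function.update g' x' (i + 1)) := by
    rintro h₂ g₂ u₂ x₂ hlt hg hru hx₂ rfl
    have hrest : Relation.ReflTransGen GridMove (h₂, g₂) (t, g') := by
      rcases Relation.ReflTransGen.total_of_right_unique
        (fun _ _ _ h₁ h₂ => h₁.right_unique h₂) hg hnf.1 with h | h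
      · exact h
      · rcases Relation.ReflTransGen.cases_head h with h | ⟨z, hz, -⟩
        · rw [h]
        · exact absurd hz (hnf.2 z)
    have hle := GridMove.sum_le hrest
    simp only at hle hn
    obtain ⟨x', h1, h2⟩ := ih (t.1 + t.2 - (h₂.1 + h₂.2)) (by omega) rfl (P.moves hg)
      (P'.moves hru) hx₂ ⟨hrest, hnf.2⟩
    exact ⟨x', h1, hru.trans h2.1, h2.2⟩
  rcases Relation.ReflTransGen.cases_head hnf.1 with he | ⟨z, hmz, -⟩
  · obtain ⟨rfl, rfl⟩ := Prod.mk.inj he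
    refine ⟨x, hx, Relation.ReflTransGen.refl, fun z hz' => ?_⟩
    have h1 : g (a + 1, b) = 0 := by
      by_contra h1
      by_cases h2 : g (a, b + 1) ≠ 0 → g (a + 1, b) ≤ g (a, b + 1)
      · exact hnf.2 _ (GridMove.up a b g h1 h2)
      · push Not at h2
        exact hnf.2 _ (GridMove.left a b g h2.1 (fun _ => h2.2))
    have h2 : g (a, b + 1) = 0 := by
      by_contra h2
      exact hnf.2 _ (GridMove.left a b g h2 (fun h => absurd h1 h))
    cases hz' with
    | up _ _ _ h0 _ => exact (hz _).1 h0 h1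
    | left _ _ _ h0 _ => exact (hz _).1 h0 h2
  · cases hmz with
    | up _ _ _ h0 hle =>
      by_cases hul : u (a, b + 1) ≠ 0 → u (a + 1, b) ≤ u (a, b + 1)
      · obtain ⟨x₂, h1, h2⟩ := P.firstMax_of_up h0 hle hx P'
        exact step _ _ _ x₂ (by simp only; omega) (.single (GridMove.up a b g h0 hle))
          (.single (GridMove.up a b u ((hz _).2 h0) hul)) h1 h2
      -- The raised letter would be the right neighbour, with an `i + 1` also below the empty
      -- square. By `exists_add_one_le_gridSum` a later prefix sum would then exceed that at `x`.
      · exfalso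
        push Not at hul
        have h1 := hle ((hz _).1 hul.1)
        have hxr : x = (a, b + 1) := by
          by_contra hne
          rw [hu0 _ (Ne.symm hne)] at hul
          by_cases hxb : x = (a + 1, b)
          · subst hxb
            omega
          · rw [hu0 _ (Ne.symm hxb)] at hul
            omega
        subst hxr
        rw [hux, hu0 _ (by simp)] at hul
        obtain ⟨c, -, hc⟩ := P.exists_add_one_le_gridSum (i := i) (by omega)
        have := hx.2.2 (a + 1, c) (Or.inl (Nat.lt_add_one a))
        omega
    | left _ _ _ h0 hlt =>
      by_cases hul : u (a + 1, b) ≠ 0 → u (a, b + 1) < u (a + 1, b)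
      · obtain ⟨x₂, h1, h2⟩ := P.firstMax_of_left h0 hx
        exact step _ _ _ x₂ (by simp only; omega) (.single (GridMove.left a b g h0 hlt))
          (.single (GridMove.left a b u ((hz _).2 h0) hul)) h1 h2
      · push Not at hul
        have h1 := hlt ((hz _).1 hul.1)
        have hxb : x = (a + 1, b) := by
          by_contra hne
          rw [hu0 _ (Ne.symm hne)] at hul
          by_cases hxr : x = (a, b + 1)
          · subst hxr
            omega
          · rw [hu0 _ (Ne.symm hxr)] at hul
            omega
        subst hxb
        rw [hux, hu0 _ (by simp)] at hul
        -- Raising the letter below creates a tie with an `i` on the right, and ties go to the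
        -- letter below. This is the only way to part.
        obtain ⟨e, g₂, u₂, x₂, he, h2, h3, h4, h5⟩ := P.exists_meet (i := i) (by omega) hx
        exact step _ g₂ u₂ x₂ (by simp only; omega) h2 h3 h4 h5

/-! ### Reversing slides, and existence of slides -/

/-- Compare the entries above and to the left of the new empty square. After a move of the empty
square down, the left one is at most the upper one; after a move to the right, it is larger. So the
last move can be read off and undone. -/
theorem move_left_unique {h₁ h₂ h' : ℕ × ℕ} {g₁ g₂ g' : ℕ × ℕ → ℕ} (P₁ : Punct lam inn h₁ g₁)
    (P₂ : Punct lam inn h₂ g₂) (hm₁ : GridMove (h₁, g₁) (h', g'))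
    (hm₂ : GridMove (h₂, g₂) (h', g')) : (h₁, g₁) = (h₂, g₂) := by
  have key : ∀ {p q : ℕ × ℕ} {k : ℕ × ℕ → ℕ}, p ≠ q → k p = 0 →
      k = Function.update (Function.update (shift k p q) p 0) q (shift k p q p) := by
    intro p q k hpq hp
    funext c
    by_cases h1 : c = q
    · subst h1
      rw [Function.update_self, shift, Function.update_of_ne hpq, Function.update_self]
    · rw [Function.update_of_ne h1]
      by_cases h2 : c = p
      · subst h2
        rw [Function.update_self, hp]
      · rw [Function.update_of_ne h2, shift, Function.update_of_ne h1, Function.update_of_ne h2]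
  cases hm₁ with
  | up a b _ h0 hle =>
    generalize hs : shift g₁ (a, b) (a + 1, b) = g' at hm₂
    generalize hp : (a + 1, b) = p at hm₂
    cases hm₂ with
    | up c d _ h0' hle' =>
      obtain ⟨h1, rfl⟩ := Prod.mk.inj hp
      obtain rfl : a = c := by omega
      have e1 := key (show (a, b) ≠ (a + 1, b) by simp) P₁.hole_eq_zero
      have e2 := key (show (a, b) ≠ (a + 1, b) by simp) P₂.hole_eq_zero
      rw [hs] at e1
      exact congrArg _ (e1.trans e2.symm)
    | left c d _ h0' hlt' =>
      exfalso
      obtain ⟨rfl, rfl⟩ := Prod.mk.inj hp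
      have e1 := congrFun hs (a, d + 1)
      have e2 := congrFun hs (a + 1, d)
      simp only [shift] at e1 e2
      rw [Function.update_of_ne (by simp), Function.update_self, Function.update_of_ne (by simp),
        Function.update_of_ne (by simp)] at e1
      rw [Function.update_of_ne (by simp), Function.update_of_ne (by simp),
        Function.update_of_ne (by simp), Function.update_self] at e2
      have h1 := P₁.row (a + 1) d (d + 1) (Nat.lt_add_one d) (by omega) h0
      have h2 := P₂.col a (a + 1) (d + 1) (Nat.lt_add_one a) (by omega) h0'
      omega
  | left a b _ h0 hlt =>
    generalize hs : shift g₁ (a, b) (a, b + 1) = g' at hm₂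
    generalize hp : (a, b + 1) = p at hm₂
    cases hm₂ with
    | up c d _ h0' hle' =>
      exfalso
      obtain ⟨rfl, rfl⟩ := Prod.mk.inj hp
      have e1 := congrFun hs (c, b + 1)
      have e2 := congrFun hs (c + 1, b)
      simp only [shift] at e1 e2
      rw [Function.update_of_ne (by simp), Function.update_of_ne (by simp),
        Function.update_of_ne (by simp), Function.update_self] at e1
      rw [Function.update_of_ne (by simp), Function.update_self, Function.update_of_ne (by simp),
        Function.update_of_ne (by simp)] at e2
      have h1 := P₂.row (c + 1) b (b + 1) (Nat.lt_add_one b) (by omega) h0'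
      have h2 := P₁.col c (c + 1) (b + 1) (Nat.lt_add_one c) (by omega) h0
      omega
    | left c d _ h0' hlt' =>
      obtain ⟨rfl, h1⟩ := Prod.mk.inj hp
      obtain rfl : b = d := by omega
      have e1 := key (show (a, b) ≠ (a, b + 1) by simp) P₁.hole_eq_zero
      have e2 := key (show (a, b) ≠ (a, b + 1) by simp) P₂.hole_eq_zero
      rw [hs] at e1
      exact congrArg _ (e1.trans e2.symm)

theorem moves_left_unique {s : ℕ × ℕ} {g₁ g₂ : ℕ × ℕ → ℕ} {st : (ℕ × ℕ) × (ℕ × ℕ → ℕ)}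
    (P₁ : Punct lam inn s g₁) (P₂ : Punct lam inn s g₂)
    (h₁ : Relation.ReflTransGen GridMove (s, g₁) st)
    (h₂ : Relation.ReflTransGen GridMove (s, g₂) st) : g₁ = g₂ := by
  induction h₁ with
  | refl =>
    rcases Relation.ReflTransGen.cases_head h₂ with h | ⟨z, h, h'⟩
    · exact (Prod.mk.inj h).2.symm
    · have h1 := h.sum_eq
      have h2 := GridMove.sum_le h'
      simp only at h1 h2
      omega
  | tail hr hm ih =>
    rcases Relation.ReflTransGen.cases_tail h₂ with h | ⟨z, hr', hm'⟩
    · have h1 := hm.sum_eq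
      have h2 := GridMove.sum_le hr
      rw [h] at h1
      simp only at h1 h2
      omega
    · have := move_left_unique (P₁.moves hr) (P₂.moves hr') hm hm'
      rw [Prod.mk.eta, Prod.mk.eta] at this
      exact ih (this ▸ hr')

theorem exists_normalForm (P : Punct lam inn h g) :
    ∃ t g', IsNormalFormOf GridMove (h, g) (t, g') := by
  obtain ⟨n, hn⟩ : ∃ n, lam.colLen 0 + lam.rowLen 0 - (h.1 + h.2) = n := ⟨_, rfl⟩
  induction n using Nat.strong_induction_on generalizing h g with
  | _ n ih =>
  by_cases hex : ∃ z, GridMove (h, g) z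
  · obtain ⟨⟨h', g'⟩, hz⟩ := hex
    have h1 := hz.sum_eq
    have h2 := lam.up_left_mem (Nat.zero_le _) le_rfl (P.move hz).mem
    have h3 := lam.up_left_mem le_rfl (Nat.zero_le _) (P.move hz).mem
    rw [YoungDiagram.mem_iff_lt_rowLen] at h2
    rw [YoungDiagram.mem_iff_lt_colLen] at h3
    simp only at h1
    obtain ⟨t, g'', h4, h5⟩ := ih _ (by omega) (P.move hz) rfl
    exact ⟨t, g'', Relation.ReflTransGen.head hz h4, h5⟩
  · exact ⟨h, g, Relation.ReflTransGen.refl, fun z hz => hex ⟨z, hz⟩⟩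

/-! ### Invariants of sequences of moves -/

theorem gridSum_le_of_moves (P : Punct lam inn h g) {s : (ℕ × ℕ) × (ℕ × ℕ → ℕ)}
    (hm : Relation.ReflTransGen GridMove (h, g) s) {M : ℤ}
    (hM : ∀ w, gridSum i (lam.rowLen 0) g w ≤ M) (w : ℕ × ℕ) :
    gridSum i (lam.rowLen 0) s.2 w ≤ M := by
  induction hm generalizing w with
  | refl => exact hM w
  | tail hr hs ih => exact (P.moves hr).gridSum_le_of_move hs ih w

theorem ncard_of_moves (P : Punct lam inn h g) {s : (ℕ × ℕ) × (ℕ × ℕ → ℕ)}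
    (hm : Relation.ReflTransGen GridMove (h, g) s) {v : ℕ} :
    {c | s.2 c = v}.ncard = {c | g c = v}.ncard := by
  have key : ∀ {p q : ℕ × ℕ} {k : ℕ × ℕ → ℕ}, k p = 0 → {c | shift k p q c = v}.ncard =
      {c | k c = v}.ncard := by
    intro p q k hp
    -- As the empty square carries 0, a move exchanges the values at `p` and `q`.
    have : {c | shift k p q c = v} = Equiv.swap p q ⁻¹' {c | k c = v} := by
      ext c
      simp only [Set.mem_ofPred_eq, Set.mem_preimage]
      rw [shift]
      by_cases h1 : c = q
      · subst h1
        rw [Function.update_self, Equiv.swap_apply_right, hp]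
      · rw [Function.update_of_ne h1]
        by_cases h2 : c = p
        · subst h2
          rw [Function.update_self, Equiv.swap_apply_left]
        · rw [Function.update_of_ne h2, Equiv.swap_apply_of_ne_of_ne h2 h1]
    rw [this, Set.ncard_preimage_of_injective_subset_range (Equiv.injective _)]
    simp
  induction hm with
  | refl => rfl
  | tail hr hs ih =>
    have hz := (P.moves hr).hole_eq_zero
    rw [← ih]
    cases hs with
    | up a b k h0 hle => exact key hz
    | left a b k h0 hlt => exact key hz

end Punct

/-! ### Slides of skew tableaux -/

/-- An inward slide from the square `s` to the square `t`. -/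
def Slide (s t : ℕ × ℕ) (T T' : Σ χ : SkewShape, SkewTableau χ) : Prop :=
  s ∈ T.1.inner ∧ T'.1.inner.cells = T.1.inner.cells.erase s ∧
    T'.1.outer.cells = T.1.outer.cells.erase t ∧
    IsNormalFormOf GridMove (s, T.2.grid) (t, T'.2.grid)

theorem SkewTableau.punct {χ : SkewShape} (T : SkewTableau χ) {s : ℕ × ℕ} (hs : s ∈ χ.inner)
    {inn : YoungDiagram} (hinn : inn.cells = χ.inner.cells.erase s) :
    Punct χ.outer inn s T.grid := by
  have hmem : ∀ c, c ∈ inn ↔ c ≠ s ∧ c ∈ χ.inner := fun c => by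
    rw [← YoungDiagram.mem_cells, hinn, Finset.mem_erase, YoungDiagram.mem_cells]
  refine ⟨χ.inner_le hs, fun h => ((hmem s).1 h).1 rfl, fun c => ?_, fun _ _ _ => T.grid_row,
    fun _ _ _ => T.grid_col⟩
  rw [T.grid_ne_zero, SkewShape.mem_cells, hmem]
  constructor
  · rintro ⟨h1, h2⟩
    exact ⟨h1, fun h => h2 h.2, by rintro rfl; exact h2 hs⟩
  · rintro ⟨h1, h2, h3⟩
    exact ⟨h1, fun h => h2 ⟨h3, h⟩⟩

/-! ### Translation between entries and fillings -/

theorem pred_shift (g : ℕ × ℕ → ℕ) (p q : ℕ × ℕ) : (fun c => shift g p q c - 1) =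
    Function.update (Function.update (fun c => g c - 1) p (g q - 1)) q 0 := by
  funext c
  simp only [shift, Function.update_apply]
  split_ifs <;> rfl

namespace Punct

variable {lam inn : YoungDiagram} {h : ℕ × ℕ} {g : ℕ × ℕ → ℕ}

theorem below_ne_zero {a b : ℕ} (P : Punct lam inn (a, b) g) :
    g (a + 1, b) ≠ 0 ↔ (a + 1, b) ∈ lam := by
  rw [P.dom]
  exact ⟨fun h => h.1, fun h => ⟨h, fun h' => P.notMem (inn.up_left_mem (by omega) le_rfl h'),
    by simp⟩⟩

theorem right_ne_zero {a b : ℕ} (P : Punct lam inn (a, b) g) :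
    g (a, b + 1) ≠ 0 ↔ (a, b + 1) ∈ lam := by
  rw [P.dom]
  exact ⟨fun h => h.1, fun h => ⟨h, fun h' => P.notMem (inn.up_left_mem le_rfl (by omega) h'),
    by simp⟩⟩

theorem slideMove_iff (P : Punct lam inn h g) (z : (ℕ × ℕ) × (ℕ × ℕ → ℕ)) :
    SlideMove lam (h, fun c => g c - 1) z ↔
      ∃ g', GridMove (h, g) (z.1, g') ∧ z.2 = fun c => g' c - 1 := by
  obtain ⟨a, b⟩ := h
  have hb := P.below_ne_zero
  have hr := P.right_ne_zero
  constructor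
  · intro hm
    cases hm with
    | up _ _ _ hmem hle =>
      refine ⟨_, GridMove.up a b g (hb.2 hmem) fun h => ?_, (pred_shift _ _ _).symm⟩
      have h1 := hle (hr.1 h)
      simp only at h1
      have := hb.2 hmem
      omega
    | left _ _ _ hmem hlt =>
      refine ⟨_, GridMove.left a b g (hr.2 hmem) fun h => ?_, (pred_shift _ _ _).symm⟩
      have h1 := hlt (hb.1 h)
      simp only at h1
      omega
  · obtain ⟨h', f⟩ := z
    rintro ⟨g', hm, hf⟩
    simp only at hm hf
    subst hf
    cases hm with
    | up _ _ _ h0 hle =>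
      rw [pred_shift]
      refine SlideMove.up a b (fun c => g c - 1) (hb.1 h0) fun h => ?_
      have := hle (hr.2 h)
      omega
    | left _ _ _ h0 hlt =>
      rw [pred_shift]
      refine SlideMove.left a b (fun c => g c - 1) (hr.1 h0) fun h => ?_
      have := hlt (hb.2 h)
      omega

theorem slideMoves_iff (P : Punct lam inn h g) (z : (ℕ × ℕ) × (ℕ × ℕ → ℕ)) :
    Relation.ReflTransGen (SlideMove lam) (h, fun c => g c - 1) z ↔
      ∃ g', Relation.ReflTransGen GridMove (h, g) (z.1, g') ∧ z.2 = fun c => g' c - 1 := by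
  constructor
  · intro hm
    induction hm with
    | refl => exact ⟨g, .refl, rfl⟩
    | @tail y z _ hs ih =>
      obtain ⟨g', h1, h2⟩ := ih
      rw [← Prod.mk.eta (p := y), h2] at hs
      obtain ⟨g'', h3, h4⟩ := ((P.moves h1).slideMove_iff z).1 hs
      exact ⟨g'', h1.tail h3, h4⟩
  · obtain ⟨h', f⟩ := z
    rintro ⟨g', hm, hf⟩
    simp only at hm hf
    subst hf
    generalize hy : (h', g') = y at hm
    have : Relation.ReflTransGen (SlideMove lam) (h, fun c => g c - 1)
        (y.1, fun c => y.2 c - 1) := by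
      clear hy
      induction hm with
      | refl => exact .refl
      | tail hr hs ih => exact ih.tail (((P.moves hr).slideMove_iff _).2 ⟨_, hs, rfl⟩)
    subst hy
    exact this

theorem isNormalFormOf_slideMove_iff (P : Punct lam inn h g) (t : ℕ × ℕ) (f : ℕ × ℕ → ℕ) :
    IsNormalFormOf (SlideMove lam) (h, fun c => g c - 1) (t, f) ↔
      ∃ g', IsNormalFormOf GridMove (h, g) (t, g') ∧ f = fun c => g' c - 1 := by
  rw [IsNormalFormOf, P.slideMoves_iff]
  constructor
  · rintro ⟨⟨g', h1, h2⟩, h3⟩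
    simp only at h1 h2
    refine ⟨g', ⟨h1, fun z hz => h3 (z.1, fun c => z.2 c - 1) ?_⟩, h2⟩
    rw [h2]
    exact ((P.moves h1).slideMove_iff _).2 ⟨_, hz, rfl⟩
  · rintro ⟨g', ⟨h1, h3⟩, h2⟩
    refine ⟨⟨g', h1, h2⟩, fun z hz => ?_⟩
    rw [h2] at hz
    obtain ⟨g'', h4, -⟩ := ((P.moves h1).slideMove_iff _).1 hz
    exact h3 _ h4

theorem gridSum_total_of_moves (P : Punct lam inn h g) {s : (ℕ × ℕ) × (ℕ × ℕ → ℕ)}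
    (hm : Relation.ReflTransGen GridMove (h, g) s) (i : ℕ) :
    gridSum i (lam.rowLen 0) s.2 (lam.colLen 0, 0) =
      gridSum i (lam.rowLen 0) g (lam.colLen 0, 0) := by
  induction hm with
  | refl => rfl
  | tail hr hs ih =>
    rw [← ih]
    have Pr := P.moves hr
    have h2 := lam.up_left_mem le_rfl (Nat.zero_le _) (Pr.move hs).mem
    rw [YoungDiagram.mem_iff_lt_colLen] at h2
    cases hs with
    | up a b k h0 hle =>
      simp only at h2
      rw [gridSum_shift_up _ _ (Pr.lt_of_ne_zero h0) Pr.hole_eq_zero, if_neg (by simp only; omega),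
        add_zero]
    | left a b k h0 hlt =>
      simp only at h2
      rw [gridSum_shift_left _ _ (Pr.lt_of_ne_zero h0) Pr.hole_eq_zero, if_neg, sub_zero]
      simp only [Prod.mk.injEq]
      omega

end Punct

theorem Sigma.ext_grid {T T' : Σ χ : SkewShape, SkewTableau χ} (h1 : T.1.outer = T'.1.outer)
    (h2 : T.1.inner = T'.1.inner) (h3 : T.2.grid = T'.2.grid) : T = T' := by
  obtain ⟨⟨o, n, hle⟩, T⟩ := T
  obtain ⟨⟨o', n', hle'⟩, T'⟩ := T'
  simp only at h1 h2
  subst h1 h2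
  exact congrArg _ (SkewTableau.grid_injective h3)

theorem YoungDiagram.ext_cells {μ ν : YoungDiagram} (h : μ.cells = ν.cells) : μ = ν :=
  YoungDiagram.ext h

namespace Slide

variable {s t : ℕ × ℕ} {T T' : Σ χ : SkewShape, SkewTableau χ}

theorem punct (h : Slide s t T T') : Punct T.1.outer T'.1.inner s T.2.grid :=
  T.2.punct h.1 h.2.1

theorem punct' (h : Slide s t T T') : Punct T.1.outer T'.1.inner t T'.2.grid :=
  h.punct.moves h.2.2.2.1

theorem cells_subset (h : Slide s t T T') {c : ℕ × ℕ} (hc : c ∈ T'.1.cells) :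
    c ∈ T.1.outer := by
  have := (SkewShape.mem_cells.1 hc).1
  rw [← YoungDiagram.mem_cells, h.2.2.1] at this
  exact Finset.mem_of_mem_erase this

end Slide

theorem slide_of_inwardSlide {T T' : Σ χ : SkewShape, SkewTableau χ} :
    InwardSlide T T' ↔ ∃ s t, Slide s t T T' := by
  refine exists_congr fun s => exists_congr fun t => and_congr_right fun h1 =>
    and_congr_right fun h2 => and_congr_right fun h3 => ?_
  have P := T.2.punct h1 h2
  rw [T.2.entry_eq_grid, P.isNormalFormOf_slideMove_iff]
  constructor
  · rintro ⟨g', hg, hf⟩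
    have P' := P.moves hg.1
    -- Subtracting 1 confuses unoccupied squares with letters 0; the common domain of the two
    -- fillings tells them apart.
    have : T'.2.grid = g' := by
      funext c
      have hdom := P'.dom c
      have hdom' := T'.2.grid_ne_zero c
      have hiff : g' c ≠ 0 ↔ T'.2.grid c ≠ 0 := by
        rw [hdom, hdom', SkewShape.mem_cells, ← YoungDiagram.mem_cells (μ := T'.1.outer), h3,
          Finset.mem_erase, YoungDiagram.mem_cells]
        simp only
        tauto
      have hc := congrFun hf c
      rw [T'.2.entry_eq_grid] at hc
      simp only at hc
      by_cases h0 : g' c = 0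
      · rw [h0]
        by_contra h
        exact hiff.2 h h0
      · have := hiff.1 h0
        omega
    rw [this]
    exact hg
  · intro h
    exact ⟨_, h, T'.2.entry_eq_grid⟩

/-- When no move is left, the squares right of and below the empty square are outside the outer
shape. It is thus a corner, and erasing it leaves a Young diagram. -/
theorem exists_slide (T : Σ χ : SkewShape, SkewTableau χ) {s : ℕ × ℕ} (hs : s ∈ T.1.inner)
    {inn : YoungDiagram} (hinn : inn.cells = T.1.inner.cells.erase s) :
    ∃ t T', Slide s t T T' := by
  have P := T.2.punct hs hinn
  obtain ⟨t, g', hnf⟩ := P.exists_normalForm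
  have P' := P.moves hnf.1
  simp only at P'
  obtain ⟨a, b⟩ := t
  have hb : (a + 1, b) ∉ T.1.outer := by
    intro hb
    by_cases hr : g' (a, b + 1) ≠ 0 → g' (a + 1, b) ≤ g' (a, b + 1)
    · exact hnf.2 _ (GridMove.up a b g' (P'.below_ne_zero.2 hb) hr)
    · push Not at hr
      exact hnf.2 _ (GridMove.left a b g' hr.1 fun _ => hr.2)
  have hr : (a, b + 1) ∉ T.1.outer := by
    intro hr
    exact hnf.2 _ (GridMove.left a b g' (P'.right_ne_zero.2 hr)
      fun h => absurd (P'.below_ne_zero.1 h) hb)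
  let out : YoungDiagram := ⟨T.1.outer.cells.erase (a, b), by
    rintro ⟨c, d⟩ ⟨e, f⟩ hle hc
    simp only [Finset.coe_erase, Set.mem_sdiff, Finset.mem_coe, Set.mem_singleton_iff] at hc ⊢
    rw [Prod.mk_le_mk] at hle
    refine ⟨T.1.outer.up_left_mem hle.1 hle.2 hc.1, ?_⟩
    intro he
    obtain ⟨rfl, rfl⟩ := Prod.mk.inj he
    by_cases hec : e < c
    · exact hb (T.1.outer.up_left_mem hec hle.2 hc.1)
    · refine hr (T.1.outer.up_left_mem hle.1 ?_ hc.1)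
      have := hc.2
      simp only [Prod.mk.injEq] at this
      omega⟩
  have hout : ∀ c, c ∈ out ↔ c ≠ (a, b) ∧ c ∈ T.1.outer := fun c => by
    rw [← YoungDiagram.mem_cells, ← YoungDiagram.mem_cells]
    exact Finset.mem_erase
  have hle : inn ≤ out := by
    intro c hc
    rw [hout]
    refine ⟨?_, ?_⟩
    · rintro rfl
      exact P'.notMem hc
    · rw [← YoungDiagram.mem_cells, hinn] at hc
      exact T.1.inner_le (Finset.mem_of_mem_erase hc)
  obtain ⟨U, hU⟩ := SkewTableau.exists_grid_eq ⟨out, inn, hle⟩ g' (fun c => by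
    rw [P'.dom, SkewShape.mem_cells, hout]
    tauto) P'.row P'.col
  refine ⟨(a, b), ⟨_, U⟩, hs, hinn, rfl, ?_⟩
  rw [hU]
  exact hnf

namespace Slide

variable {s t t' : ℕ × ℕ} {T T' T₁ T₂ U : Σ χ : SkewShape, SkewTableau χ}

theorem right_unique (h₁ : Slide s t T T₁) (h₂ : Slide s t' T T₂) : t = t' ∧ T₁ = T₂ := by
  have hru : Relator.RightUnique GridMove := fun _ _ _ h₁ h₂ => GridMove.right_unique h₁ h₂
  have key : (t, T₁.2.grid) = (t', T₂.2.grid) := by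
    rcases Relation.ReflTransGen.total_of_right_unique hru h₁.2.2.2.1 h₂.2.2.2.1 with h | h
    · rcases Relation.ReflTransGen.cases_head h with h | ⟨z, hz, -⟩
      · exact h
      · exact absurd hz (h₁.2.2.2.2 z)
    · rcases Relation.ReflTransGen.cases_head h with h | ⟨z, hz, -⟩
      · exact h.symm
      · exact absurd hz (h₂.2.2.2.2 z)
  obtain ⟨rfl, h3⟩ := Prod.mk.inj key
  exact ⟨rfl, Sigma.ext_grid (YoungDiagram.ext_cells (h₁.2.2.1.trans h₂.2.2.1.symm))
    (YoungDiagram.ext_cells (h₁.2.1.trans h₂.2.1.symm)) h3⟩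

/-- Inserting `s` and `t` recovers the two shapes; then the moves are undone one at a time. -/
theorem left_unique (h₁ : Slide s t T₁ T) (h₂ : Slide s t T₂ T) : T₁ = T₂ := by
  have hi : ∀ {T'}, Slide s t T' T → T'.1.inner.cells = insert s T.1.inner.cells := fun {T'} h => by
    rw [h.2.1, Finset.insert_erase]
    exact h.1
  have ho : ∀ {T'}, Slide s t T' T → T'.1.outer.cells = insert t T.1.outer.cells := fun {T'} h => by
    rw [h.2.2.1, Finset.insert_erase]
    exact h.punct'.mem
  have hout := YoungDiagram.ext_cells ((ho h₁).trans (ho h₂).symm)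
  exact Sigma.ext_grid hout
    (YoungDiagram.ext_cells ((hi h₁).trans (hi h₂).symm))
    (h₁.punct.moves_left_unique (hout ▸ h₂.punct) h₁.2.2.2.1 h₂.2.2.2.1)

theorem rowLen_le (h : Slide s t T T') {c : ℕ × ℕ} (hc : c ∈ T'.1.cells) :
    c.2 < T.1.outer.rowLen 0 := by
  rw [← YoungDiagram.mem_iff_lt_rowLen]
  exact T.1.outer.up_left_mem (Nat.zero_le _) le_rfl (h.cells_subset hc)

/-- A slide may shorten the top row, but the column lost is unoccupied. -/
theorem gridSum_eq (h : Slide s t T T') {g : ℕ × ℕ → ℕ} (hg : ∀ c, g c ≠ 0 → c ∈ T'.1.cells)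
    (i : ℕ) (w : ℕ × ℕ) :
    gridSum i (T'.1.outer.rowLen 0) g w = gridSum i (T.1.outer.rowLen 0) g w := by
  rw [gridSum_eq_sum _ _ _ T'.1.cells hg (fun c => SkewTableau.mem_cells_snd_lt),
    gridSum_eq_sum _ _ _ T'.1.cells hg (fun c => h.rowLen_le)]

theorem rowSum_eq (h : Slide s t T T') (i : ℕ) (w : ℕ × ℕ) :
    T'.2.rowSum i w = gridSum i (T.1.outer.rowLen 0) T'.2.grid w :=
  h.gridSum_eq (fun c => (T'.2.grid_ne_zero c).1) i w

theorem dominant (h : Slide s t T T') {i : ℕ} (hd : WordDominantFor i (T.2.word T.1.semitic)) :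
    WordDominantFor i (T'.2.word T'.1.semitic) := by
  rw [SkewTableau.dominant_iff_rowSum] at *
  intro w
  rw [h.rowSum_eq]
  exact h.punct.gridSum_le_of_moves h.2.2.2.1 hd w

/-- Use the total as the bound preserved by moves; the total itself does not change. -/
theorem antiDominant (h : Slide s t T T') {i : ℕ}
    (hd : WordAntiDominantFor i (T.2.word T.1.semitic)) :
    WordAntiDominantFor i (T'.2.word T'.1.semitic) := by
  rw [SkewTableau.antiDominant_iff_rowSum i (R := T.1.outer.colLen 0)
    (fun c => SkewTableau.mem_cells_fst_lt)] at hd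
  rw [SkewTableau.antiDominant_iff_rowSum i (R := T.1.outer.colLen 0)]
  · intro w
    rw [h.rowSum_eq, h.rowSum_eq]
    have := h.punct.gridSum_total_of_moves h.2.2.2.1 i
    simp only at this
    rw [this]
    exact h.punct.gridSum_le_of_moves h.2.2.2.1 hd w
  · intro c hc
    rw [← YoungDiagram.mem_iff_lt_colLen]
    exact T.1.outer.up_left_mem le_rfl (Nat.zero_le _) (h.cells_subset hc)

end Slide

theorem SkewTableau.weight_eq_ncard {χ : SkewShape} (T : SkewTableau χ) (v : ℕ) :
    T.weight v = {c | T.grid c = v + 1}.ncard := by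
  rw [SkewTableau.weight, ← Set.ncard_coe_finset]
  congr 1
  ext c
  simp only [Finset.coe_filter, Set.mem_ofPred_eq, SkewTableau.grid]
  split_ifs with h <;> simp [h]

theorem Slide.weight_eq {s t : ℕ × ℕ} {T T' : Σ χ : SkewShape, SkewTableau χ}
    (h : Slide s t T T') : T'.2.weight = T.2.weight := by
  funext v
  rw [SkewTableau.weight_eq_ncard, SkewTableau.weight_eq_ncard]
  exact h.punct.ncard_of_moves h.2.2.2.1

/-! ### Raising tableaux of arbitrary shape -/

/-- `U = e_i(T)`. -/
def Raise (i : ℕ) (T U : Σ χ : SkewShape, SkewTableau χ) : Prop :=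
  ∃ (χ : SkewShape) (A B : SkewTableau χ), T = ⟨χ, A⟩ ∧ U = ⟨χ, B⟩ ∧
    WordRaise i (A.word χ.semitic) (B.word χ.semitic)

theorem SkewTableau.word_injective {χ : SkewShape} {A B : SkewTableau χ}
    (h : A.word χ.semitic = B.word χ.semitic) : A = B := by
  ext c
  by_cases hc : c ∈ χ.cells
  · exact List.map_inj_left.1 h c ((χ.semitic.mem_squares c).2 hc)
  · rw [A.zeros c hc, B.zeros c hc]

namespace Raise

variable {i : ℕ} {T T₁ T₂ U : Σ χ : SkewShape, SkewTableau χ}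

theorem shape_eq (h : Raise i T U) : U.1 = T.1 := by
  obtain ⟨χ, A, B, rfl, rfl, -⟩ := h
  rfl

theorem left_unique (h₁ : Raise i T₁ T) (h₂ : Raise i T₂ T) : T₁ = T₂ := by
  obtain ⟨χ, A, B, rfl, rfl, h₁⟩ := h₁
  obtain ⟨χ', A', B', rfl, e, h₂⟩ := h₂
  obtain ⟨rfl, e⟩ := Sigma.mk.inj e
  obtain rfl := eq_of_heq e
  rw [SkewTableau.word_injective (h₁.left_unique h₂)]

theorem not_dominant (h : Raise i T U) : ¬ WordDominantFor i (T.2.word T.1.semitic) := by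
  obtain ⟨χ, A, B, rfl, rfl, h⟩ := h
  exact h.not_dominant

theorem not_antiDominant (h : Raise i T U) : ¬ WordAntiDominantFor i (U.2.word U.1.semitic) := by
  obtain ⟨χ, A, B, rfl, rfl, h⟩ := h
  exact h.not_antiDominant

end Raise

theorem exists_raise_from {i : ℕ} {T : Σ χ : SkewShape, SkewTableau χ}
    (h : ¬ WordDominantFor i (T.2.word T.1.semitic)) : ∃ U, Raise i T U := by
  obtain ⟨U, hU⟩ := SkewTableau.exists_raise h
  exact ⟨⟨T.1, U⟩, T.1, T.2, U, rfl, rfl, hU⟩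

theorem exists_raise_to {i : ℕ} {T : Σ χ : SkewShape, SkewTableau χ}
    (h : ¬ WordAntiDominantFor i (T.2.word T.1.semitic)) : ∃ U, Raise i U T := by
  obtain ⟨U, hU⟩ := SkewTableau.exists_lower h
  exact ⟨⟨T.1, U⟩, T.1, U, T.2, rfl, rfl, hU⟩

namespace Slide

variable {s t : ℕ × ℕ} {i : ℕ} {T T' U U' : Σ χ : SkewShape, SkewTableau χ}

theorem raise_right (h : Slide s t T T') (hr : Raise i T U) :
    ∃ U', Slide s t U U' ∧ Raise i T' U' := by
  obtain ⟨χ, A, B, rfl, rfl, hw⟩ := hr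
  obtain ⟨x, hx, hB⟩ := (SkewTableau.wordRaise_iff_grid i).1 hw
  have P := h.punct
  have PB := B.punct h.1 h.2.1
  simp only at P PB
  rw [hB] at PB
  obtain ⟨x', hx', hnf⟩ := P.slide_raise _ rfl PB hx h.2.2.2
  have PB' := PB.moves hnf.1
  simp only at PB'
  obtain ⟨V, hV⟩ := SkewTableau.exists_grid_eq T'.1 _ (fun c => by
    rw [PB'.dom, ← T'.2.grid_ne_zero, h.punct'.dom]) PB'.row PB'.col
  refine ⟨⟨T'.1, V⟩, ⟨h.1, h.2.1, h.2.2.1, ?_⟩, T'.1, T'.2, V, rfl, rfl, ?_⟩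
  · simp only
    rw [hV, hB]
    exact hnf
  · rw [SkewTableau.wordRaise_iff_grid]
    refine ⟨x', ?_, hV⟩
    unfold FirstMax at hx' ⊢
    have := h.gridSum_eq (fun c => (T'.2.grid_ne_zero c).1) i
    simp only [this]
    exact hx'

/-- Slide `T` from `s` and compare with `U`: the slide of `U` is unique, so the final squares agree.
-/
theorem raise_left (h : Slide s t U U') (hr : Raise i T U) :
    ∃ T', Slide s t T T' ∧ Raise i T' U' := by
  have hs : T.1 = U.1 := hr.shape_eq.symm
  obtain ⟨t', T', hT⟩ := exists_slide T (s := s) (hs ▸ h.1) (inn := U'.1.inner) (hs ▸ h.2.1)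
  obtain ⟨U'', h1, h2⟩ := hT.raise_right hr
  obtain ⟨rfl, rfl⟩ := h1.right_unique h
  exact ⟨T', hT, h2⟩

/-- Because slides preserve anti-dominance, `U` can be lowered if `U'` can. The slide of the lowered
tableau raises to `U'`, hence is `T'`. -/
theorem lift_raise_left (h : Slide s t U U') (hr : Raise i T' U') :
    ∃ T, Slide s t T T' ∧ Raise i T U := by
  obtain ⟨T, hT⟩ := exists_raise_to fun hd => hr.not_antiDominant (h.antiDominant hd)
  obtain ⟨T'', h1, h2⟩ := h.raise_left hT
  obtain rfl := h2.left_unique hr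
  exact ⟨T, h1, hT⟩

end Slide

/-! ### Labelled chains of rewrite steps -/

section Chains

variable {X : Type} {ι κ : Type}

/-- `y` is reached from `x` by steps with the given labels. -/
def LabelledChain (R : ι → X → X → Prop) : List ι → X → X → Prop
  | [], x, y => x = y
  | a :: l, x, z => ∃ y, R a x y ∧ LabelledChain R l y z

namespace LabelledChain

variable {R : ι → X → X → Prop} {Q : κ → X → X → Prop}

theorem left_unique (hR : ∀ a x y z, R a x z → R a y z → x = y) {l : List ι} {x y z : X}
    (h₁ : LabelledChain R l x z) (h₂ : LabelledChain R l y z) : x = y := by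
  induction l generalizing x y with
  | nil => exact h₁.trans h₂.symm
  | cons a l ih =>
    obtain ⟨x', hx, h₁⟩ := h₁
    obtain ⟨y', hy, h₂⟩ := h₂
    obtain rfl := ih h₁ h₂
    exact hR a _ _ _ hx hy

theorem append {l m : List ι} {x y z : X} (h₁ : LabelledChain R l x y)
    (h₂ : LabelledChain R m y z) : LabelledChain R (l ++ m) x z := by
  induction l generalizing x with
  | nil => exact (show x = y from h₁) ▸ h₂
  | cons a l ih =>
    obtain ⟨x', hx, h₁⟩ := h₁
    exact ⟨x', hx, ih h₁⟩

theorem flip {l : List ι} {x y : X} (h : LabelledChain R l x y) :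
    LabelledChain (fun a x y => R a y x) l.reverse y x := by
  induction l generalizing x with
  | nil => exact (show x = y from h).symm
  | cons a l ih =>
    obtain ⟨x', hx, h⟩ := h
    rw [List.reverse_cons]
    exact (ih h).append ⟨x, hx, rfl⟩

theorem of_flip {l : List ι} {x y : X} (h : LabelledChain (fun a x y => R a y x) l.reverse y x) :
    LabelledChain R l x y := by
  have := h.flip
  rwa [List.reverse_reverse] at this

theorem reflTransGen_iff {x y : X} : Relation.ReflTransGen (fun x y => ∃ a, R a x y) x y ↔
    ∃ l, LabelledChain R l x y := by
  constructor
  · intro h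
    induction h with
    | refl => exact ⟨[], rfl⟩
    | tail _ hs ih =>
      obtain ⟨l, hl⟩ := ih
      obtain ⟨a, ha⟩ := hs
      exact ⟨l ++ [a], hl.append ⟨_, ha, rfl⟩⟩
  · rintro ⟨l, h⟩
    induction l generalizing x with
    | nil => exact (show x = y from h) ▸ .refl
    | cons a l ih =>
      obtain ⟨x', hx, h⟩ := h
      exact .head ⟨a, hx⟩ (ih h)

/-- A rectangle is tiled by elementary squares, one row at a time. Flipping either relation gives
the versions based at other corners. -/
theorem square (H : ∀ a b x x' y, R a x x' → Q b x y → ∃ y', R a y y' ∧ Q b x' y')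
    {l : List ι} {m : List κ} {x x' y : X} (h₁ : LabelledChain R l x x')
    (h₂ : LabelledChain Q m x y) :
    ∃ y', LabelledChain R l y y' ∧ LabelledChain Q m x' y' := by
  have single : ∀ {a : ι} {m : List κ} {x x' y : X}, R a x x' → LabelledChain Q m x y →
      ∃ y', R a y y' ∧ LabelledChain Q m x' y' := by
    intro a m
    induction m with
    | nil =>
      rintro x x' y h rfl
      exact ⟨x', h, rfl⟩
    | cons b m ih =>
      rintro x x' y h ⟨z, hz, hm⟩
      obtain ⟨z', h1, h2⟩ := H a b x x' z h hz
      obtain ⟨y', h3, h4⟩ := ih h1 hm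
      exact ⟨y', h3, z', h2, h4⟩
  induction l generalizing x y with
  | nil => exact ⟨y, rfl, (show x = x' from h₁) ▸ h₂⟩
  | cons a l ih =>
    obtain ⟨z, hz, h₁⟩ := h₁
    obtain ⟨w, h3, h4⟩ := single hz h₂
    obtain ⟨y', h5, h6⟩ := ih h₁ h4
    exact ⟨y', ⟨w, h3, h5⟩, h6⟩

end LabelledChain

end Chains

/-! ### Sequences of slides and of raising operations -/

/-- Inward slides from given squares to given squares. -/
abbrev Slides : List ((ℕ × ℕ) × (ℕ × ℕ)) → (Σ χ : SkewShape, SkewTableau χ) →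
    (Σ χ : SkewShape, SkewTableau χ) → Prop :=
  LabelledChain fun p => Slide p.1 p.2

/-- Raising operations `e_i` for given indices `i`. -/
abbrev Raises : List ℕ → (Σ χ : SkewShape, SkewTableau χ) →
    (Σ χ : SkewShape, SkewTableau χ) → Prop :=
  LabelledChain Raise

/-- The reading word is dominant for every `i`. -/
def IsDominant (T : Σ χ : SkewShape, SkewTableau χ) : Prop :=
  ∀ i, WordDominantFor i (T.2.word T.1.semitic)

section Paths

variable {T T' U U' : Σ χ : SkewShape, SkewTableau χ} {σ : List ((ℕ × ℕ) × (ℕ × ℕ))} {l : List ℕ}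

theorem Slides.left_unique (h₁ : Slides σ T U) (h₂ : Slides σ T' U) : T = T' :=
  LabelledChain.left_unique (R := fun p : (ℕ × ℕ) × (ℕ × ℕ) => Slide p.1 p.2)
    (fun _ _ _ _ h h' => Slide.left_unique h h') h₁ h₂

theorem Raises.left_unique (h₁ : Raises l T U) (h₂ : Raises l T' U) : T = T' :=
  LabelledChain.left_unique (R := Raise) (fun _ _ _ _ h h' => Raise.left_unique h h') h₁ h₂

theorem Slides.raises_right (h : Slides σ T T') (hr : Raises l T U) :
    ∃ U', Slides σ U U' ∧ Raises l T' U' :=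
  LabelledChain.square (R := fun p : (ℕ × ℕ) × (ℕ × ℕ) => Slide p.1 p.2) (Q := Raise)
    (fun _ _ _ _ _ h h' => Slide.raise_right h h') h hr

theorem Slides.raises_left (h : Slides σ U U') (hr : Raises l T U) :
    ∃ T', Slides σ T T' ∧ Raises l T' U' := by
  obtain ⟨T', h1, h2⟩ := LabelledChain.square
    (R := fun p : (ℕ × ℕ) × (ℕ × ℕ) => Slide p.1 p.2) (Q := fun i T U => Raise i U T)
    (fun _ _ _ _ _ h h' => Slide.raise_left h h') h hr.flip
  exact ⟨T', h1, h2.of_flip⟩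

theorem Slides.lift_raises_left (h : Slides σ U U') (hr : Raises l T' U') :
    ∃ T, Slides σ T T' ∧ Raises l T U := by
  obtain ⟨T, h1, h2⟩ := LabelledChain.square
    (R := fun (p : (ℕ × ℕ) × (ℕ × ℕ)) T U => Slide p.1 p.2 U T) (Q := fun i T U => Raise i U T)
    (fun _ _ _ _ _ h h' => Slide.lift_raise_left h h') h.flip hr.flip
  exact ⟨T, h1.of_flip, h2.of_flip⟩

theorem Slides.dominant (h : Slides σ T T') (hd : IsDominant T) : IsDominant T' := by
  induction σ generalizing T with
  | nil => exact (show T = T' from h) ▸ hd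
  | cons p σ ih =>
    obtain ⟨z, hz, h⟩ := h
    exact ih h fun i => hz.dominant (hd i)

theorem Slides.weight_eq (h : Slides σ T T') : T'.2.weight = T.2.weight := by
  induction σ generalizing T with
  | nil => exact (show T = T' from h) ▸ rfl
  | cons p σ ih =>
    obtain ⟨z, hz, h⟩ := h
    exact (ih h).trans hz.weight_eq

theorem Raises.shape_eq (h : Raises l T U) : U.1 = T.1 := by
  induction l generalizing T with
  | nil => exact (show T = U from h) ▸ rfl
  | cons p σ ih =>
    obtain ⟨z, hz, h⟩ := h
    exact (ih h).trans hz.shape_eq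

theorem isDominant_iff : IsDominant T ↔ ∀ i U, ¬ Raise i T U := by
  constructor
  · exact fun h i U hU => hU.not_dominant (h i)
  · intro h i
    by_contra hd
    obtain ⟨U, hU⟩ := exists_raise_from hd
    exact h i U hU

theorem Raise.sum_eq {i : ℕ} (h : Raise i T U) :
    (T.2.word T.1.semitic).sum = (U.2.word U.1.semitic).sum + 1 := by
  obtain ⟨χ, A, B, rfl, rfl, u, v, -, -, h1, h2⟩ := h
  simp only at *
  rw [h1, h2]
  simp only [List.sum_append, List.sum_cons]
  omega

/-- Each raising lowers the sum of all letters by 1. -/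
theorem exists_raises_isDominant (T : Σ χ : SkewShape, SkewTableau χ) :
    ∃ l L, Raises l T L ∧ IsDominant L := by
  obtain ⟨n, hn⟩ : ∃ n, (T.2.word T.1.semitic).sum = n := ⟨_, rfl⟩
  induction n generalizing T with
  | zero =>
    refine ⟨[], T, rfl, isDominant_iff.2 fun i U hU => ?_⟩
    have := hU.sum_eq
    omega
  | succ n ih =>
    by_cases hT : IsDominant T
    · exact ⟨[], T, rfl, hT⟩
    · rw [isDominant_iff] at hT
      push Not at hT
      obtain ⟨i, U, hU⟩ := hT
      have := hU.sum_eq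
      obtain ⟨l, L, h1, h2⟩ := ih U (by omega)
      exact ⟨i :: l, L, ⟨U, hU, h1⟩, h2⟩

theorem exists_slide_of_ne_bot (h : T.1.inner ≠ ⊥) : ∃ s t T', Slide s t T T' := by
  have hne : T.1.inner.cells.Nonempty := by
    rw [Finset.nonempty_iff_ne_empty]
    intro h'
    refine h (YoungDiagram.ext ?_)
    rw [h', YoungDiagram.cells_bot]
  -- A square with maximal coordinate sum is a corner.
  obtain ⟨s, hs, hmax⟩ := Finset.exists_max_image _ (fun c : ℕ × ℕ => c.1 + c.2) hne
  let inn : YoungDiagram := ⟨T.1.inner.cells.erase s, by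
    intro c d hle hc
    simp only [Finset.coe_erase, Set.mem_sdiff, Finset.mem_coe, Set.mem_singleton_iff] at hc ⊢
    refine ⟨T.1.inner.isLowerSet hle hc.1, ?_⟩
    rintro rfl
    have h1 := hmax c hc.1
    have h2 := hle.1
    have h3 := hle.2
    exact hc.2 (Prod.ext (by omega) (by omega))⟩
  obtain ⟨t, T', hT⟩ := exists_slide T (s := s) ((YoungDiagram.mem_cells _).1 hs) (inn := inn) rfl
  exact ⟨s, t, T', hT⟩

theorem exists_slides_inner_eq_bot (T : Σ χ : SkewShape, SkewTableau χ) :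
    ∃ σ P, Slides σ T P ∧ P.1.inner = ⊥ := by
  obtain ⟨n, hn⟩ : ∃ n, T.1.inner.cells.card = n := ⟨_, rfl⟩
  induction n generalizing T with
  | zero =>
    refine ⟨[], T, rfl, YoungDiagram.ext ?_⟩
    rw [Finset.card_eq_zero.1 hn, YoungDiagram.cells_bot]
  | succ n ih =>
    by_cases hT : T.1.inner = ⊥
    · exact ⟨[], T, rfl, hT⟩
    · obtain ⟨s, t, T', hT'⟩ := exists_slide_of_ne_bot hT
      have hc := congrArg Finset.card hT'.2.1
      rw [Finset.card_erase_of_mem ((YoungDiagram.mem_cells _).2 hT'.1)] at hc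
      obtain ⟨σ, P, h1, h2⟩ := ih T' (by omega)
      exact ⟨(s, t) :: σ, P, ⟨T', hT', h1⟩, h2⟩

theorem isNormalFormOf_inwardSlide_iff : IsNormalFormOf InwardSlide T U ↔
    (∃ σ, Slides σ T U) ∧ U.1.inner = ⊥ := by
  have hrel : InwardSlide = fun T T' => ∃ p : (ℕ × ℕ) × (ℕ × ℕ), Slide p.1 p.2 T T' := by
    funext T T'
    rw [eq_iff_iff, slide_of_inwardSlide]
    exact ⟨fun ⟨s, t, h⟩ => ⟨(s, t), h⟩, fun ⟨p, h⟩ => ⟨p.1, p.2, h⟩⟩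
  rw [IsNormalFormOf, hrel, LabelledChain.reflTransGen_iff]
  refine and_congr_right fun _ => ⟨fun h => ?_, fun h z hz => ?_⟩
  · by_contra hne
    obtain ⟨s, t, T', hT⟩ := exists_slide_of_ne_bot hne
    exact h T' ⟨(s, t), hT⟩
  · obtain ⟨p, hp⟩ := hz
    have := hp.1
    rw [h] at this
    exact YoungDiagram.notMem_bot _ this

end Paths

/-! ### Dominant tableaux of partition shape -/

theorem SkewShape.cells_ofPartition (ν : YoungDiagram) :
    (SkewShape.ofPartition ν).cells = ν.cells := by
  simp [SkewShape.cells, SkewShape.ofPartition]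

/-- By induction earlier rows are constant, and strict columns give entries at least `a`. If the
entry were `i + 1 > a`, no `i` would be read up to `(a, b)`: rows above contain only letters below
`a`, and entries to the right are at least `i + 1`. The prefix sum would be positive. -/
theorem entry_eq_of_dominant {ν : YoungDiagram} {A : SkewTableau (SkewShape.ofPartition ν)}
    (hd : IsDominant ⟨_, A⟩) (a b : ℕ) (hab : (a, b) ∈ ν) : A.entry (a, b) = a := by
  have hcell : ∀ c, c ∈ (SkewShape.ofPartition ν).cells ↔ c ∈ ν := fun c => by
    rw [SkewShape.cells_ofPartition, YoungDiagram.mem_cells]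
  induction a using Nat.strong_induction_on generalizing b with
  | _ a ih =>
  have hge : a ≤ A.entry (a, b) := by
    rcases a with _ | a
    · exact Nat.zero_le _
    · have h1 : (a, b) ∈ ν := ν.up_left_mem (Nat.le_succ a) le_rfl hab
      have h2 := ih a (Nat.lt_add_one a) b h1
      have h3 := A.col_strict a (a + 1) b (Nat.lt_add_one a) ((hcell _).2 h1) ((hcell _).2 hab)
      omega
  by_contra hne
  obtain ⟨i, hi⟩ : ∃ i, A.entry (a, b) = i + 1 := ⟨A.entry (a, b) - 1, by omega⟩
  have hg : A.grid (a, b) = i + 2 := by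
    rw [A.grid_of_mem ((hcell _).2 hab), hi]
  have hS := (SkewTableau.dominant_iff_rowSum i).1 (hd i) (a, b)
  have hb := SkewTableau.mem_cells_snd_lt ((hcell _).2 hab)
  simp only at hS hb
  have h1 : 0 ≤ ∑ e ∈ Finset.range a, ∑ c ∈ Finset.range ((SkewShape.ofPartition ν).outer.rowLen 0),
      gridSign i (A.grid (e, c)) := by
    refine Finset.sum_nonneg fun e he => Finset.sum_nonneg fun c _ => gridSign_nonneg fun h => ?_
    rw [Finset.mem_range] at he
    have hc : (e, c) ∈ (SkewShape.ofPartition ν).cells := by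
      rw [← A.grid_ne_zero]
      omega
    have := ih e he c ((hcell _).1 hc)
    rw [A.grid_of_mem hc] at h
    omega
  have h2 : 1 ≤ ∑ c ∈ Finset.range ((SkewShape.ofPartition ν).outer.rowLen 0),
      if b ≤ c then gridSign i (A.grid (a, c)) else 0 := by
    have h3 : ∀ c ∈ Finset.range ((SkewShape.ofPartition ν).outer.rowLen 0),
        0 ≤ if b ≤ c then gridSign i (A.grid (a, c)) else 0 := by
      intro c _
      split_ifs with hbc
      · refine gridSign_nonneg fun h => ?_
        have := A.grid_row_le (a := a) hbc (by omega) (by omega)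
        omega
      · exact le_rfl
    have h4 := Finset.single_le_sum h3 (Finset.mem_range.2 hb)
    rwa [if_pos le_rfl, hg, gridSign_add_two] at h4
  rw [SkewTableau.rowSum, gridSum] at hS
  simp only at hS
  omega

theorem weight_eq_rowLen_of_dominant {ν : YoungDiagram}
    {A : SkewTableau (SkewShape.ofPartition ν)} (hd : IsDominant ⟨_, A⟩) (i : ℕ) :
    A.weight i = ν.rowLen i := by
  rw [SkewTableau.weight, SkewShape.cells_ofPartition, YoungDiagram.rowLen_eq_card,
    YoungDiagram.row]
  congr 1
  refine Finset.filter_congr fun c hc => ?_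
  have := entry_eq_of_dominant hd c.1 c.2 ((YoungDiagram.mem_cells _).1 hc)
  rw [← this]

theorem eq_of_dominant_of_weight_eq {Q Q' : Σ χ : SkewShape, SkewTableau χ} (hQ : IsDominant Q)
    (hQ' : IsDominant Q') (h : Q.1.inner = ⊥) (h' : Q'.1.inner = ⊥)
    (hw : Q.2.weight = Q'.2.weight) : Q = Q' := by
  have key : ∀ Q : Σ χ : SkewShape, SkewTableau χ, Q.1.inner = ⊥ →
      ∃ A : SkewTableau (SkewShape.ofPartition Q.1.outer), Q = ⟨_, A⟩ := by
    rintro ⟨⟨o, n, hle⟩, A⟩ rfl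
    exact ⟨A, rfl⟩
  obtain ⟨A, hA⟩ := key Q h
  obtain ⟨A', hA'⟩ := key Q' h'
  generalize Q.1.outer = ν at A hA
  generalize Q'.1.outer = ν' at A' hA'
  subst hA hA'
  have hν : ν = ν' := by
    refine YoungDiagram.ext (Finset.ext fun c => ?_)
    have := congrFun hw c.1
    simp only at this
    rw [weight_eq_rowLen_of_dominant hQ, weight_eq_rowLen_of_dominant hQ'] at this
    rw [YoungDiagram.mem_cells, YoungDiagram.mem_cells, ← Prod.mk.eta (p := c),
      YoungDiagram.mem_iff_lt_rowLen, YoungDiagram.mem_iff_lt_rowLen, this]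
  subst hν
  refine congrArg _ (SkewTableau.ext (funext fun c => ?_))
  by_cases hc : c ∈ ν
  · rw [entry_eq_of_dominant hQ c.1 c.2 hc, entry_eq_of_dominant hQ' c.1 c.2 hc]
  · have hc' : c ∉ (SkewShape.ofPartition ν).cells := by
      rwa [SkewShape.cells_ofPartition, YoungDiagram.mem_cells]
    rw [A.zeros c hc', A'.zeros c hc']

/-! ### Uniqueness of normal forms -/

section Uniqueness

variable {T P P' L L' : Σ χ : SkewShape, SkewTableau χ} {σ σ' : List ((ℕ × ℕ) × (ℕ × ℕ))}
  {l l' : List ℕ}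

/-- Raise `T` to a dominant `L`. Both sequences slide `L` to dominant tableaux of partition shape
with the weight of `L`, hence to the same one, and `P` and `P'` arise from it by undoing the same
raisings. -/
theorem Slides.normalForm_unique (h : Slides σ T P) (h' : Slides σ' T P') (hP : P.1.inner = ⊥)
    (hP' : P'.1.inner = ⊥) : P = P' := by
  obtain ⟨l, L, hl, hL⟩ := exists_raises_isDominant T
  obtain ⟨Q, h1, h2⟩ := h.raises_right hl
  obtain ⟨Q', h1', h2'⟩ := h'.raises_right hl
  obtain rfl := eq_of_dominant_of_weight_eq (h1.dominant hL) (h1'.dominant hL)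
    (h2.shape_eq ▸ hP) (h2'.shape_eq ▸ hP') (h1.weight_eq.trans h1'.weight_eq.symm)
  exact h2.left_unique h2'

/-- Dual to the preceding proof: slide `L` and `L'` along one sequence that takes `T` to partition
shape. The results are dominant of the same partition shape, hence equal, and the slides can be
undone. -/
theorem Raises.normalForm_unique (h : Raises l T L) (h' : Raises l' T L') (hL : IsDominant L)
    (hL' : IsDominant L') : L = L' := by
  obtain ⟨σ, P, hσ, hP⟩ := exists_slides_inner_eq_bot T
  obtain ⟨Q, h1, h2⟩ := hσ.raises_right h
  obtain ⟨Q', h1', h2'⟩ := hσ.raises_right h'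
  have key : ∀ {Q Q' : Σ χ : SkewShape, SkewTableau χ}, IsDominant Q → IsDominant Q' →
      Q.1 = Q'.1 → Q.1.inner = ⊥ → Q = Q' := by
    rintro ⟨⟨o, n, hle⟩, A⟩ ⟨⟨o', n', hle'⟩, A'⟩ hQ hQ' hs rfl
    simp only [SkewShape.mk.injEq] at hs
    obtain ⟨rfl, rfl⟩ := hs
    refine eq_of_dominant_of_weight_eq hQ hQ' rfl rfl (funext fun i => ?_)
    exact (weight_eq_rowLen_of_dominant hQ i).trans (weight_eq_rowLen_of_dominant hQ' i).symm
  obtain rfl := key (h1.dominant hL) (h1'.dominant hL') (h2.shape_eq.trans h2'.shape_eq.symm)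
    (h2.shape_eq ▸ hP)
  exact h1.left_unique h1'

end Uniqueness

theorem isNormalFormOf_raisingStep_iff {χ : SkewShape} (r : ReadingOrder χ)
    (T L : SkewTableau χ) : IsNormalFormOf (RaisingStep r) T L ↔
      (∃ l, Raises l ⟨χ, T⟩ ⟨χ, L⟩) ∧ IsDominant ⟨χ, L⟩ := by
  have hstep : ∀ A B : SkewTableau χ, RaisingStep r A B ↔ ∃ i, Raise i ⟨χ, A⟩ ⟨χ, B⟩ := by
    intro A B
    rw [SkewTableau.raisingStep_iff]
    refine exists_congr fun i => ⟨fun h => ⟨χ, A, B, rfl, rfl, h⟩, ?_⟩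
    rintro ⟨χ', A', B', hA, hB, h⟩
    obtain ⟨rfl, hA⟩ := Sigma.mk.inj hA
    obtain rfl := eq_of_heq hA
    obtain rfl := eq_of_heq (Sigma.mk.inj hB).2
    exact h
  refine and_congr ⟨fun h => ?_, ?_⟩ ⟨fun h => ?_, fun h z hz => ?_⟩
  · exact LabelledChain.reflTransGen_iff.1
      (h.lift (fun A => (⟨χ, A⟩ : Σ χ : SkewShape, SkewTableau χ)) fun A B => (hstep A B).1)
  · rintro ⟨l, h⟩
    induction l generalizing T with
    | nil =>
      obtain rfl := eq_of_heq (Sigma.mk.inj (show _ = _ from h)).2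
      exact .refl
    | cons i l ih =>
      obtain ⟨⟨χ', U⟩, hU, h⟩ := h
      obtain rfl : χ' = χ := hU.shape_eq
      exact .head ((hstep T U).2 ⟨i, hU⟩) (ih U h)
  · rw [isDominant_iff]
    rintro i ⟨χ', U⟩ hU
    obtain rfl : χ' = χ := hU.shape_eq
    exact h U ((hstep L U).2 ⟨i, hU⟩)
  · obtain ⟨i, hi⟩ := (hstep L z).1 hz
    exact isDominant_iff.1 h i _ hi

/-! ### The Robinson bijection -/

/-- The bound on entries depends on the weight alone, so it passes through slides in both
directions. -/
theorem forall_entry_lt_iff {χ : SkewShape} (T : SkewTableau χ) (n : ℕ) :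
    (∀ c ∈ χ.cells, T.entry c < n) ↔ ∀ v, n ≤ v → T.weight v = 0 := by
  simp only [SkewTableau.weight, Finset.card_eq_zero, Finset.filter_eq_empty_iff]
  constructor
  · intro h v hv c hc he
    have := h c hc
    omega
  · intro h c hc
    by_contra hcon
    exact h _ (not_lt.1 hcon) hc rfl

theorem robinson_ext {χ : SkewShape} {n : ℕ}
    {R R' : Σ ν : YoungDiagram, LR χ ν × Tab (SkewShape.ofPartition ν) n}
    (h1 : R.2.1.1 = R'.2.1.1)
    (h2 : (⟨_, R.2.2.1⟩ : Σ χ : SkewShape, SkewTableau χ) = ⟨_, R'.2.2.1⟩) : R = R' := by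
  obtain ⟨ν, L, P⟩ := R
  obtain ⟨ν', L', P'⟩ := R'
  obtain rfl : ν = ν' := congrArg (fun Q : Σ χ : SkewShape, SkewTableau χ => Q.1.outer) h2
  obtain rfl : L = L' := Subtype.ext h1
  obtain rfl : P = P' := Subtype.ext (eq_of_heq (Sigma.mk.inj h2).2)
  rfl

/-- That `L` has weight `ν` is seen on its slide `Q`: this has the weight of `L`, and being a raised
version of `P` it has shape `ν`. -/
theorem exists_robinson (χ : SkewShape) (n : ℕ) (T : Tab χ n) :
    ∃ R : Σ ν : YoungDiagram, LR χ ν × Tab (SkewShape.ofPartition ν) n,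
      (∃ l, Raises l ⟨χ, T.1⟩ ⟨χ, R.2.1.1⟩) ∧
        ∃ σ, Slides σ ⟨χ, T.1⟩ ⟨SkewShape.ofPartition R.1, R.2.2.1⟩ := by
  obtain ⟨l, ⟨χ', L⟩, hl, hL⟩ := exists_raises_isDominant ⟨χ, T.1⟩
  obtain rfl : χ' = χ := hl.shape_eq
  obtain ⟨σ, ⟨⟨ν, inn, hle⟩, P⟩, hσ, hP⟩ := exists_slides_inner_eq_bot ⟨χ', T.1⟩
  simp only at hP
  subst hP
  obtain ⟨⟨χ'', Q⟩, h1, h2⟩ := hσ.raises_right hl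
  obtain rfl : χ'' = _ := h2.shape_eq
  have hQ := weight_eq_rowLen_of_dominant (ν := ν) (A := Q) (h1.dominant hL)
  have hLw := h1.weight_eq
  have hPw := hσ.weight_eq
  refine ⟨⟨ν, ⟨L, hL, fun i => ?_⟩, ⟨P, ?_⟩⟩, ⟨l, hl⟩, σ, hσ⟩
  · exact (congrFun hLw i).symm.trans (hQ i)
  · refine (forall_entry_lt_iff P n).2 fun v hv => ?_
    exact (congrFun hPw v).trans ((forall_entry_lt_iff T.1 n).1 T.2 v hv)

theorem mainTheorem4 (χ : SkewShape) (n : ℕ) :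
    ∃ Rob : Tab χ n → Σ ν : YoungDiagram, LR χ ν × Tab (SkewShape.ofPartition ν) n,
      Function.Bijective Rob ∧
      ∀ T : Tab χ n,
        (∀ i : ℕ, (Rob T).2.2.1.weight i = T.1.weight i) ∧
        (∀ (r : ReadingOrder χ) (L : SkewTableau χ),
          IsNormalFormOf (RaisingStep r) T.1 L ↔ L = (Rob T).2.1.1) ∧
        (∀ P : Σ χ' : SkewShape, SkewTableau χ',
          IsNormalFormOf InwardSlide ⟨χ, T.1⟩ P ↔
            P = ⟨SkewShape.ofPartition (Rob T).1, (Rob T).2.2.1⟩) := by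
  choose Rob hraise hslide using exists_robinson χ n
  refine ⟨Rob, ⟨?_, ?_⟩, fun T => ⟨?_, ?_, ?_⟩⟩
  · intro T T' hTT
    obtain ⟨l, hl⟩ := hraise T
    obtain ⟨l', hl'⟩ := hraise T'
    obtain ⟨σ, hσ⟩ := hslide T
    obtain ⟨σ', hσ'⟩ := hslide T'
    -- Carry `σ` from `T` to their common `L`, then back along `l'` to `T'`. So `T'` also slides
    -- along `σ`, to a normal form that is the common `P`, and undoing `σ` gives `T = T'`.
    obtain ⟨Q, h1, hQ⟩ := hσ.raises_right hl
    rw [hTT] at h1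
    obtain ⟨P, h2, h3⟩ := h1.raises_left hl'
    rw [← hTT] at hσ'
    have hP : P.1.inner = ⊥ := by
      rw [← h3.shape_eq, hQ.shape_eq]
      rfl
    have hPP := h2.normalForm_unique hσ' hP rfl
    rw [hPP] at h2
    have := hσ.left_unique h2
    exact Subtype.ext (eq_of_heq (Sigma.mk.inj this).2)
  · rintro ⟨ν, L, P⟩
    obtain ⟨σ, Q, hσ, hQ⟩ := exists_slides_inner_eq_bot ⟨χ, L.1⟩
    obtain ⟨l, ⟨χ', M⟩, hl, hM⟩ := exists_raises_isDominant ⟨SkewShape.ofPartition ν, P.1⟩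
    obtain rfl : χ' = SkewShape.ofPartition ν := hl.shape_eq
    have hL : IsDominant ⟨χ, L.1⟩ := L.2.1
    -- The slide of `L` and the raised version of `P` are both dominant of partition shape and
    -- weight `ν`. This common corner allows the rectangle to be completed to the `T` sought.
    obtain rfl := eq_of_dominant_of_weight_eq (hσ.dominant hL) hM hQ rfl (by
      rw [hσ.weight_eq]
      funext i
      exact (L.2.2 i).trans (weight_eq_rowLen_of_dominant hM i).symm)
    obtain ⟨⟨χ', T⟩, h1, h2⟩ := hσ.lift_raises_left hl
    obtain rfl : χ = χ' := h2.shape_eq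
    have hT : ∀ c ∈ χ.cells, T.entry c < n := (forall_entry_lt_iff T n).2 fun v hv =>
      (congrFun h1.weight_eq v).symm.trans ((forall_entry_lt_iff P.1 n).1 P.2 v hv)
    refine ⟨⟨T, hT⟩, robinson_ext ?_ ?_⟩
    · obtain ⟨l', hl'⟩ := hraise ⟨T, hT⟩
      exact eq_of_heq (Sigma.mk.inj (hl'.normalForm_unique h2 (Rob ⟨T, hT⟩).2.1.2.1 hL)).2
    · obtain ⟨σ', hσ'⟩ := hslide ⟨T, hT⟩
      exact hσ'.normalForm_unique h1 rfl rfl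
  · obtain ⟨σ, hσ⟩ := hslide T
    exact congrFun hσ.weight_eq
  · intro r L
    rw [isNormalFormOf_raisingStep_iff]
    obtain ⟨l, hl⟩ := hraise T
    have hd : IsDominant ⟨χ, (Rob T).2.1.1⟩ := (Rob T).2.1.2.1
    constructor
    · rintro ⟨⟨l', hl'⟩, hL⟩
      exact eq_of_heq (Sigma.mk.inj (hl'.normalForm_unique hl hL hd)).2
    · rintro rfl
      exact ⟨⟨l, hl⟩, hd⟩
  · intro P
    rw [isNormalFormOf_inwardSlide_iff]
    obtain ⟨σ, hσ⟩ := hslide T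
    constructor
    · rintro ⟨⟨σ', hσ'⟩, hP⟩
      exact hσ'.normalForm_unique hσ hP rfl
    · rintro rfl
      exact ⟨⟨σ, hσ⟩, rfl⟩
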